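/- Let $(M,g)$ be a closed (compact, without boundary) smooth Riemannian manifold of dimension $n$, with Riemannian volume measure $\mu$, exterior derivative $d$, codifferential $\delta$ (the formal adjoint of $d$), interior product $\iota_u$ and musical isomorphism $u\mapsto u^\flat=g(u,\cdot)$. For real numbers $a,b,c$ consider on the Lie algebra $T_e\mathrm{Diff}(M)$ of smooth vector fields the symmetric bilinear form $$\langle\!\langle u,v\rangle\!\rangle=a\int_M\langle u,v\rangle\,d\mu+b\int_M\langle\delta u^\flat,\delta v^\flat\rangle\,d\mu+c\int_M\langle du^\flat,dv^\flat\rangle\,d\mu$$ (for $a,b,c\ge 0$ it defines the, possibly degenerate, right-invariant $a$-$b$-$c$ Sobolev $H^1$ metric on $\mathrm{Diff}(M)$), and put $$Au=a\,u^\flat+b\,d\delta u^\flat+c\,\delta du^\flat .$$ The Euler–Arnold equation of $\langle\!\langle\cdot,\cdot\rangle\!\rangle$ is $u_t=-B(u,u)$, where the vector field $B(u,v)$ is characterized by $\langle\!\langle B(u,v),w\rangle\!\rangle=\langle\!\langle u,\mathrm{ad}_v w\rangle\!\rangle$ for all smooth $w$, with $\mathrm{ad}_vw=-[v,w]$. (If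 the form is degenerate, $B(u,u)$ is determined only up to its kernel, and the equation means that $-u_t$ is one such field.) Then $A$ is the inertia operator of this form: $\langle\!\langle u,v\rangle\!\rangle=\int_M (Au)(v)\,d\mu$ for all smooth vector fields $u,v$. Let $u=u(t,x)$ be a time-dependent vector field on $M$, smooth in $(t,x)\in J\times M$, where $J\subseteq\mathbb R$ is an interval with more than one point. Then $u$ solves the Euler–Arnold equation on $J$ if and only if, on $J$, $$\begin{aligned}Au_t=&-a\big((\operatorname{div}u)\,u^\flat+\iota_u du^\flat+d\langle u,u\rangle\big)-b\big((\operatorname{div}u)\,d\delta u^\flat+d\,\iota_u d\delta u^\flat\big)\\&-c\big((\operatorname{div}u)\,\delta du^\flat+\iota_u d\delta du^\flat+d\,\iota_u\delta du^\flat\big).\end{aligned}$$ In particular, the Euler–Arnold equation is equivalent to the following equations. 1. For $a=1$, $b=c=0$: the multi-dimensional Burgers equation $u_t+\nabla_uu+u\operatorname{div}u+\tfrac12\nabla|u|^2=0$, with $\nabla$ the Levi-Civita connection. 2. For $a=b=c=1$: the EPDiff equation $m_t+\mathcal L_um+m\operatorname{div}u=0$, where $m=u^\flat-\Delta u^\flat$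 and $\Delta=-(d\delta+\delta d)$. 3. If $n=1$ and $M$ is a circle with arclength parameter $x$, and $u$ also denotes the component of the vector field with respect to $\partial_x$ (a function of $t$ and $x$), then: - for $a=0$, $b\neq0$ and any $c$: the Hunter–Saxton equation $u_{txx}+2u_xu_{xx}+uu_{xxx}=0$; - for $b=0$, $a\ne0$ and any $c$: the Burgers equation $u_t+3uu_x=0$; - for $a=b=1$ and any $c$: the Camassa–Holm equation $u_t-u_{txx}+3uu_x-2u_xu_{xx}-uu_{xxx}=0$. -/

import Mathlib

open Set MeasureTheory VectorField
open scoped Manifold ContDiff Topology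

noncomputable section

namespace EulerArnold

/-- Euclidean `n`-space, on which the manifolds below are modelled. -/
abbrev Eu (n : ℕ) : Type := EuclideanSpace ℝ (Fin n)

/-- The `i`-th standard basis vector. -/
def e {n : ℕ} (i : Fin n) : Eu n := EuclideanSpace.single i 1

variable {n : ℕ} {M : Type*} [TopologicalSpace M] [ChartedSpace (Eu n) M]

/-! ### Fields and forms -/

variable (n M) in
/-- (Not necessarily smooth) vector fields on `M`. -/
abbrev VF : Type _ := (x : M) → TangentSpace (𝓡 n) x

variable (n M) in
/-- (Not necessarily smooth) one-forms on `M`. -/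
abbrev OneForm : Type _ := (x : M) → TangentSpace (𝓡 n) x →L[ℝ] ℝ

variable (n M) in
/-- (Not necessarily smooth) fields of bilinear forms on `M`; a two-form is an alternating one. -/
abbrev TwoTensor : Type _ :=
  (x : M) → TangentSpace (𝓡 n) x →L[ℝ] TangentSpace (𝓡 n) x →L[ℝ] ℝ

/-- Smooth vector fields, that is, the elements of `T_e Diff(M)`. -/
def SmoothVF [IsManifold (𝓡 n) ∞ M] (u : VF n M) : Prop :=
  ContMDiff (𝓡 n) (𝓡 n).tangent ∞ (fun x => (⟨x, u x⟩ : TangentBundle (𝓡 n) M))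

/-- Time-dependent vector fields that are jointly smooth in time `t ∈ J` and in space. -/
def SmoothTimeVF [IsManifold (𝓡 n) ∞ M] (J : Set ℝ) (u : ℝ → VF n M) : Prop :=
  ContMDiffOn (𝓘(ℝ, ℝ).prod (𝓡 n)) (𝓡 n).tangent ∞
    (fun q : ℝ × M => (⟨q.2, u q.1 q.2⟩ : TangentBundle (𝓡 n) M)) (J ×ˢ univ)

/-! ### Coordinate expressions in the preferred chart `φ` at a point `p` -/

/-- The coordinates `φ p` of `p` in the preferred chart `φ` at `p`. -/
def pt (p : M) : Eu n := extChartAt (𝓡 n) p p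

/-- The differential of `φ` at `p`. -/
def dφ (p : M) : TangentSpace (𝓡 n) p →L[ℝ] Eu n :=
  mfderiv (𝓡 n) 𝓘(ℝ, Eu n) (extChartAt (𝓡 n) p) p

/-- The differential of `φ⁻¹` at a point `y` of the target of `φ`. It sends the `i`-th standard
basis vector to the `i`-th coordinate vector field. -/
def dψ (p : M) (y : Eu n) : Eu n →L[ℝ] TangentSpace (𝓡 n) ((extChartAt (𝓡 n) p).symm y) :=
  mfderiv 𝓘(ℝ, Eu n) (𝓡 n) (extChartAt (𝓡 n) p).symm y

/-- The pullback `(v, w) ↦ β(A v, A w)` of a bilinear form `β` along a linear map `A`. -/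
def pullTwo {V W : Type*} [AddCommGroup V] [Module ℝ V] [TopologicalSpace V]
    [AddCommGroup W] [Module ℝ W] [TopologicalSpace W]
    (A : V →L[ℝ] W) (β : W →L[ℝ] W →L[ℝ] ℝ) : V →L[ℝ] V →L[ℝ] ℝ :=
  ((ContinuousLinearMap.precomp ℝ A).comp β).comp A

/-- The vector field `X` in the chart at `p`. -/
def coordVF (p : M) (X : VF n M) (y : Eu n) : Eu n :=
  (dψ p y).inverse (X ((extChartAt (𝓡 n) p).symm y))

/-- The one-form `α` in the chart at `p`. -/
def coordOne (p : M) (α : OneForm n M) (y : Eu n) : Eu n →L[ℝ] ℝ :=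
  (α ((extChartAt (𝓡 n) p).symm y)).comp (dψ p y)

/-- The two-tensor `β` in the chart at `p`. -/
def coordTwo (p : M) (β : TwoTensor n M) (y : Eu n) : Eu n →L[ℝ] Eu n →L[ℝ] ℝ :=
  pullTwo (dψ p y) (β ((extChartAt (𝓡 n) p).symm y))

/-! ### Exterior derivative and Lie derivative -/

/-- The exterior derivative `df` of a function. -/
def d0 (f : M → ℝ) : OneForm n M := fun x => mvfderiv (𝓡 n) f x

/-- The exterior derivative of a one-form: `(dα)_{ij} = ∂_i α_j - ∂_j α_i`. -/
def d1 (α : OneForm n M) : TwoTensor n M := fun p =>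
  let L := fderiv ℝ (coordOne p α) (pt p)
  pullTwo (dφ p) (L - L.flip)

/-- The Lie derivative `𝓛_X α` of a one-form: `(𝓛_X α)_j = X^i ∂_i α_j + α_i ∂_j X^i`. -/
def lieOne (X : VF n M) (α : OneForm n M) : OneForm n M := fun p =>
  (fderiv ℝ (coordOne p α) (pt p) (coordVF p X (pt p)) +
    (coordOne p α (pt p)).comp (fderiv ℝ (coordVF p X) (pt p))).comp (dφ p)

/-- The interior product `ι_u α` of a vector field with a one-form. -/
def ι1 (u : VF n M) (α : OneForm n M) : M → ℝ := fun x => α x (u x)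

/-- The interior product `ι_u β = β(u, ·)` of a vector field with a two-form. -/
def ι2 (u : VF n M) (β : TwoTensor n M) : OneForm n M := fun x => β x (u x)

/-! ### Riemannian metrics -/

section Riemannian

variable [IsManifold (𝓡 n) ∞ M]

variable (n M) in
/-- Smooth Riemannian metrics on `M`. -/
abbrev Metric : Type _ :=
  Bundle.ContMDiffRiemannianMetric (𝓡 n) ∞ (Eu n) (fun x : M => TangentSpace (𝓡 n) x)

/-- The Gram matrix `(g_{ij}(y))` of the metric in the chart at `p`. -/
def gram (g : Metric n M) (p : M) (y : Eu n) : Matrix (Fin n) (Fin n) ℝ :=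
  Matrix.of fun i j => coordTwo p g.inner y (e i) (e j)

/-- The Riemannian volume density `√(det g_{ij}(y))` in the chart at `p`. -/
def density (g : Metric n M) (p : M) (y : Eu n) : ℝ := √(gram g p y).det

/-- The Riemannian volume of the domain of the chart at `p`: the measure with
density `√(det g_{ij})` in this chart. It vanishes outside of the domain of the chart. -/
def chartVol [MeasurableSpace M] (g : Metric n M) (p : M) : Measure M :=
  ((volume.restrict (extChartAt (𝓡 n) p).target).withDensity
    (fun y => ENNReal.ofReal (density g p y))).map (extChartAt (𝓡 n) p).symm

/-- The Riemannian volume measure `μ` of `(M, g)`. The measures `chartVol g p` agree on overlaps of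
the chart domains, and `μ` is obtained from them by gluing: the least measure above all of them is
the measure that restricts to `chartVol g p` on the domain of the chart at `p`. -/
def vol [MeasurableSpace M] (g : Metric n M) : Measure M := ⨆ p : M, chartVol g p

/-- The one-form `u♭ = g(u, ·)`. -/
def flat (g : Metric n M) (u : VF n M) : OneForm n M := fun x => g.inner x (u x)

/-- The vector field `α♯`, where `♯ = ♭⁻¹`. -/
def sharp (g : Metric n M) (α : OneForm n M) : VF n M := fun x => (g.inner x).inverse (α x)

/-- `sharp` is inverse to `flat`. -/
theorem inner_sharp (g : Metric n M) (α : OneForm n M) (x : M) (w : TangentSpace (𝓡 n) x) :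
    g.inner x (sharp g α x) w = α x w := by
  let T : Eu n →L[ℝ] (Eu n →L[ℝ] ℝ) := g.inner x
  have hinj : Function.Injective T := by
    rw [injective_iff_map_eq_zero]
    intro v hv
    by_contra h
    have h1 := g.pos x v h
    have h2 : T v v = 0 := by rw [hv]; rfl
    exact h1.ne' h2
  have hd : Module.finrank ℝ (Eu n) = Module.finrank ℝ (Eu n →L[ℝ] ℝ) := by
    rw [← LinearMap.toContinuousLinearMap.finrank_eq]
    exact (Subspace.dual_finrank_eq).symm
  let L : Eu n ≃ₗ[ℝ] (Eu n →L[ℝ] ℝ) := LinearEquiv.ofInjectiveOfFinrankEq T.toLinearMap hinj hd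
  have hT : T = (L.toContinuousLinearEquiv : Eu n →L[ℝ] (Eu n →L[ℝ] ℝ)) := by ext; rfl
  have : T (T.inverse (α x)) = α x := by
    rw [hT, ContinuousLinearMap.inverse_equiv]; exact L.apply_symm_apply _
  exact congrArg (fun l : Eu n →L[ℝ] ℝ => l w) this

/-- The function `⟨u, v⟩ = g(u, v)`. -/
def innerVF (g : Metric n M) (u v : VF n M) : M → ℝ := fun x => g.inner x (u x) (v x)

/-- The pointwise inner product of two-forms,
`⟨α, β⟩ = ∑_{i<j, k<l} (g^{ik} g^{jl} - g^{il} g^{jk}) α_{ij} β_{kl}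
        = (1/2) ∑_{ijkl} g^{ik} g^{jl} α_{ij} β_{kl}`. -/
def innerTwo (g : Metric n M) (α β : TwoTensor n M) : M → ℝ := fun p =>
  (1 / 2) * ∑ i, ∑ j, ∑ k, ∑ l, (gram g p (pt p))⁻¹ i k * (gram g p (pt p))⁻¹ j l *
    coordTwo p α (pt p) (e i) (e j) * coordTwo p β (pt p) (e k) (e l)

/-- The divergence of a vector field, `div X = (1/√det g) ∂_i (√det g X^i)`. -/
def divg (g : Metric n M) (X : VF n M) : M → ℝ := fun p =>
  (density g p (pt p))⁻¹ *
    ∑ i, fderiv ℝ (fun y => density g p y * coordVF p X y i) (pt p) (e i)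

/-- The codifferential of a one-form, `δα = -(1/√det g) ∂_i (√det g g^{ij} α_j)`. -/
def δ1 (g : Metric n M) (α : OneForm n M) : M → ℝ := fun p =>
  -((density g p (pt p))⁻¹ *
    ∑ i, fderiv ℝ (fun y => density g p y * ∑ j, (gram g p y)⁻¹ i j * coordOne p α y (e j))
      (pt p) (e i))

/-- The codifferential of a two-form, with the index raised,
`(δβ)^j = -(1/√det g) ∂_i (√det g g^{ik} g^{jl} β_{kl})`. -/
def δ2Coord (g : Metric n M) (β : TwoTensor n M) (p : M) : Eu n :=
  WithLp.toLp 2 fun j => -((density g p (pt p))⁻¹ *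
    ∑ i, fderiv ℝ (fun y => density g p y * ∑ k, ∑ l, (gram g p y)⁻¹ i k * (gram g p y)⁻¹ j l *
      coordTwo p β y (e k) (e l)) (pt p) (e i))

/-- The codifferential `δβ` of a two-form: `(δβ)_k = g_{jk} (δβ)^j`. -/
def δ2 (g : Metric n M) (β : TwoTensor n M) : OneForm n M := fun p =>
  (coordTwo p g.inner (pt p) (δ2Coord g β p)).comp (dφ p)

/-- The gradient of a function. -/
def grad (g : Metric n M) (f : M → ℝ) : VF n M := sharp g (d0 f)

/-- The covariant derivative `∇_X Y` for the Levi-Civita connection: in coordinates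
`g_{kl} (∇_X Y)^k = g_{kl} X^i ∂_i Y^k + Γ_{l,ij} X^i Y^j`, where
`Γ_{l,ij} = (1/2) (∂_i g_{jl} + ∂_j g_{il} - ∂_l g_{ij})`. -/
def nabla (g : Metric n M) (X Y : VF n M) : VF n M :=
  sharp g fun p =>
    let G := coordTwo p g.inner
    let DG := fderiv ℝ G (pt p)
    let x := coordVF p X (pt p)
    let y := coordVF p Y (pt p)
    (G (pt p) (fderiv ℝ (coordVF p Y) (pt p) x) +
      (1 / 2 : ℝ) • (DG x y + DG y x - (DG.flip x).flip y)).comp (dφ p)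

/-- The Laplacian on one-forms, with the sign for which it is nonpositive: `Δ = -(dδ + δd)`. -/
def laplaceOne (g : Metric n M) (α : OneForm n M) : OneForm n M :=
  -(d0 (δ1 g α) + δ2 g (d1 α))

/-! ### The `a`-`b`-`c` metric and its inertia operator -/

/-- The `a`-`b`-`c` Sobolev `H¹` inner product on `T_e Diff(M)`,
`⟪u, v⟫ = a ∫ ⟨u, v⟩ dμ + b ∫ ⟨δu♭, δv♭⟩ dμ + c ∫ ⟨du♭, dv♭⟩ dμ`. -/
def abcInner [MeasurableSpace M] (g : Metric n M) (a b c : ℝ) (u v : VF n M) : ℝ :=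
  a * ∫ x, innerVF g u v x ∂(vol g) +
  b * ∫ x, δ1 g (flat g u) x * δ1 g (flat g v) x ∂(vol g) +
  c * ∫ x, innerTwo g (d1 (flat g u)) (d1 (flat g v)) x ∂(vol g)

/-- The inertia operator `A u = a u♭ + b dδu♭ + c δdu♭`. -/
def inertia (g : Metric n M) (a b c : ℝ) (u : VF n M) : OneForm n M :=
  a • flat g u + b • d0 (δ1 g (flat g u)) + c • δ2 g (d1 (flat g u))

end Riemannian

/-! ### The Euler–Arnold equation on `Diff(M)` -/

/-- The adjoint action of the Lie algebra `T_e Diff(M)`: `ad_u v = -[u, v]`. -/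
def ad (u v : VF n M) : VF n M := -mlieBracket (𝓡 n) u v

/-- `IsB ip u v w` says that the smooth vector field `w` is `B(u, v) = ad_v^* u` with respect to the
inner product `ip` on `T_e Diff(M)`: `⟪w, z⟫ = ⟪u, ad_v z⟫` for all smooth `z`. -/
def IsB [IsManifold (𝓡 n) ∞ M] (ip : VF n M → VF n M → ℝ) (u v w : VF n M) : Prop :=
  SmoothVF w ∧ ∀ z : VF n M, SmoothVF z → ip w z = ip u (ad v z)

/-- The time derivative `u_t` of a time-dependent vector field on the time interval `J`. -/
def dtVF (J : Set ℝ) (u : ℝ → VF n M) (t : ℝ) : VF n M :=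
  fun x => derivWithin (F := Eu n) (fun s => u s x) J t

/-- The time derivative of a time-dependent one-form on the time interval `J`. -/
def dtOne (J : Set ℝ) (m : ℝ → OneForm n M) (t : ℝ) : OneForm n M :=
  fun x => derivWithin (F := Eu n →L[ℝ] ℝ) (fun s => m s x) J t

/-- The Euler–Arnold equation `u_t = -B(u, u)` on the time interval `J`, for the right-invariant
metric on `Diff(M)` that is given by the inner product `ip` on `T_e Diff(M)`. -/
def SolvesEulerArnold [IsManifold (𝓡 n) ∞ M] (ip : VF n M → VF n M → ℝ) (J : Set ℝ)
    (u : ℝ → VF n M) : Prop :=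
  ∀ t ∈ J, ∃ w : VF n M, IsB ip (u t) (u t) w ∧ dtVF J u t = -w

/-! ### Circles -/

/-- The velocity of a curve in `M`. -/
def velocity (γ : ℝ → M) (x : ℝ) : TangentSpace (𝓡 n) (γ x) :=
  mfderiv 𝓘(ℝ, ℝ) (𝓡 n) γ x (1 : ℝ)

/-- `γ : ℝ → M` is a smooth unit speed curve that runs through all of `M`. For a
one-dimensional closed `M` this says that `M` is a circle, with arclength parameter `x ↦ γ x`. -/
def IsArclength [IsManifold (𝓡 n) ∞ M] (g : Metric n M) (γ : ℝ → M) : Prop :=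
  ContMDiff 𝓘(ℝ, ℝ) (𝓡 n) ∞ γ ∧ Function.Surjective γ ∧
    ∀ x, g.inner (γ x) (velocity γ x) (velocity γ x) = 1

/-- The component `f(t, x)` of a time-dependent vector field along a unit speed curve `γ`; if `M` is
one-dimensional, then `u(t, γ x) = f(t, x) γ'(x)`. -/
def component [IsManifold (𝓡 n) ∞ M] (g : Metric n M) (γ : ℝ → M) (u : ℝ → VF n M)
    (t x : ℝ) : ℝ :=
  g.inner (γ x) (u t (γ x)) (velocity γ x)

/-- The partial derivative `f_t`, on the time interval `J`. -/
def pt_t (J : Set ℝ) (f : ℝ → ℝ → ℝ) (t x : ℝ) : ℝ := derivWithin (fun s => f s x) J t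

/-- The partial derivative `∂_x^k f`. -/
def pt_x (k : ℕ) (f : ℝ → ℝ → ℝ) (t x : ℝ) : ℝ := iteratedDeriv k (f t) x

end EulerArnold

end

noncomputable section

set_option linter.unusedSectionVars false

namespace EulerArnold

section

variable {n : ℕ} {M : Type*} [TopologicalSpace M] [ChartedSpace (Eu n) M]

/-! ### Preferred charts -/

/-! Everything rests on two facts about a closed manifold. The divergence theorem `∫ div X = 0`
makes `d` and `δ` adjoint, so that `⟪u, v⟫ = ∫ (Au)(v)` (`abcInner_eq`). The Leibniz rule for `𝓛_X`
gives the pointwise identity `(𝓛_X α + (div X) α)(Z) = div(α(Z) X) - α([X, Z])` (`cartan_divg`), so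
that `∫ α(-[X, Z])` is the integral of `(𝓛_X α + (div X) α)(Z)` (`integral_cartan`).

With `α = Au` and `ad_u z = -[u, z]`, a field `w` is `B(u, u)` iff `∫ (Aw)(z) = ∫ (𝓛_u Au + (div u)
Au)(z)` for all smooth `z`. A smooth one-form is determined by such integrals, so this says `Aw =
𝓛_u Au + (div u) Au` (`isB_iff`). Only the pairing of forms with fields has to be nondegenerate, not
`A`; hence all real `a`, `b`, `c` are treated alike. The Euler–Arnold equation becomes `A u_t =
-(𝓛_u + div u) Au` (`solvesEulerArnold_iff_transport`), and the stated formula follows from Cartan's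
formula and `d d = 0`.

For Burgers, `(∇_u u)♭ = ι_u du♭ + ½ d|u|²`. For EPDiff, `m = Au` and `A` commutes with `∂_t`. On a
circle two-forms vanish and the divergence is the derivative of the component `f` along the unit
speed curve, so `Au` becomes `a f - b f''`, and `𝓛_u + div u` sends a form with component `m` to one
with component `(f m)' + f' m`.

The operators are defined at each point in the preferred chart of that point. To differentiate or
integrate them, they must first be expressed in one fixed chart; the change-of-chart lemmas
`extE_pullback`, `divE_trans`, `density_trans`, `innerE_pullTwo` do this. Smoothness of the results
and exchange with `∂_t` are handled together by the predicate `TD`. -/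

/-- The target of the preferred chart at `p`. -/
abbrev tgt (p : M) : Set (Eu n) := (extChartAt (𝓡 n) p).target

/-- The inverse of the preferred chart at `p`. -/
abbrev ψ (p : M) : Eu n → M := (extChartAt (𝓡 n) p).symm

/-- The differential of the inverse of the preferred chart, as an endomorphism of `Eu n`. -/
def Dψ (p : M) (y : Eu n) : Eu n →L[ℝ] Eu n := dψ p y

/-- The transition map from the chart at `p` to the chart at `q`. -/
def trans (q p : M) (y : Eu n) : Eu n := extChartAt (𝓡 n) q (ψ p y)

theorem isOpen_tgt (p : M) : IsOpen (tgt (n := n) p) := isOpen_extChartAt_target p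

theorem pt_mem_tgt (p : M) : pt (n := n) p ∈ tgt (n := n) p := mem_extChartAt_target p

theorem ψ_pt (p : M) : ψ (n := n) p (pt p) = p := extChartAt_to_inv p

theorem tgt_mem_nhds {p : M} {y : Eu n} (hy : y ∈ tgt p) : tgt p ∈ 𝓝 y :=
  (isOpen_tgt p).mem_nhds hy

theorem ψ_mem_source {p : M} {y : Eu n} (hy : y ∈ tgt p) : ψ p y ∈ (extChartAt (𝓡 n) p).source :=
  (extChartAt (𝓡 n) p).map_target hy

theorem continuousAt_ψ {p : M} {y : Eu n} (hy : y ∈ tgt p) : ContinuousAt (ψ p) y :=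
  continuousAt_extChartAt_symm'' hy

/-- All tangent spaces unfold to `Eu n`. Reading a field as a plain function on `M` with values in a
fixed space lets the base point be rewritten without dependent types; likewise for forms below. -/
theorem coordVF_eq (p : M) (X : VF n M) (y : Eu n) :
    coordVF p X y = (Dψ p y).inverse ((show M → Eu n from X) (ψ p y)) := rfl

theorem coordOne_eq (p : M) (α : OneForm n M) (y : Eu n) :
    coordOne p α y = ((show M → Eu n →L[ℝ] ℝ from α) (ψ p y)).comp (Dψ p y) := rfl

theorem coordTwo_eq (p : M) (β : TwoTensor n M) (y : Eu n) :
    coordTwo p β y = pullTwo (Dψ p y) ((show M → Eu n →L[ℝ] Eu n →L[ℝ] ℝ from β) (ψ p y)) := rfl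

@[simp] theorem pullTwo_apply {V W : Type*} [AddCommGroup V] [Module ℝ V] [TopologicalSpace V]
    [AddCommGroup W] [Module ℝ W] [TopologicalSpace W]
    (A : V →L[ℝ] W) (β : W →L[ℝ] W →L[ℝ] ℝ) (v w : V) : pullTwo A β v w = β (A v) (A w) := rfl

variable [IsManifold (𝓡 n) ∞ M]

theorem trans_mem {q p : M} {y : Eu n} (hq : ψ p y ∈ (extChartAt (𝓡 n) q).source) :
    trans q p y ∈ tgt q := (extChartAt (𝓡 n) q).map_source hq

theorem ψ_trans {q p : M} {y : Eu n} (hq : ψ p y ∈ (extChartAt (𝓡 n) q).source) :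
    ψ q (trans q p y) = ψ p y := (extChartAt (𝓡 n) q).left_inv hq

theorem eventually_source {q p : M} {y : Eu n} (hy : y ∈ tgt p)
    (hq : ψ p y ∈ (extChartAt (𝓡 n) q).source) :
    ∀ᶠ z in 𝓝 y, z ∈ tgt p ∧ ψ p z ∈ (extChartAt (𝓡 n) q).source :=
  (Filter.Eventually.and (tgt_mem_nhds hy)
    ((continuousAt_ψ hy).eventually ((isOpen_extChartAt_source q).mem_nhds hq)))

theorem contMDiffAt_ψ {p : M} {y : Eu n} (hy : y ∈ tgt p) :
    ContMDiffAt 𝓘(ℝ, Eu n) (𝓡 n) ∞ (ψ p) y :=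
  (contMDiffOn_extChartAt_symm p).contMDiffAt (tgt_mem_nhds hy)

theorem contMDiffAt_chart {q x : M} (hq : x ∈ (extChartAt (𝓡 n) q).source) :
    ContMDiffAt (𝓡 n) 𝓘(ℝ, Eu n) ∞ (extChartAt (𝓡 n) q) x :=
  contMDiffAt_extChartAt' (by simpa using hq)

theorem contDiffAt_trans {q p : M} {y : Eu n} (hy : y ∈ tgt p)
    (hq : ψ p y ∈ (extChartAt (𝓡 n) q).source) : ContDiffAt ℝ ∞ (trans q p) y :=
  ((contMDiffAt_chart hq).comp y (contMDiffAt_ψ hy)).contDiffAt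

/-- Chain rule for `ψ p = ψ q ∘ trans q p`, which holds near `y`. All the transformation rules for
tensors come from this. -/
theorem Dψ_trans {q p : M} {y : Eu n} (hy : y ∈ tgt p)
    (hq : ψ p y ∈ (extChartAt (𝓡 n) q).source) :
    Dψ p y = (Dψ q (trans q p y)).comp (fderiv ℝ (trans q p) y) := by
  have h1 : MDifferentiableAt 𝓘(ℝ, Eu n) (𝓡 n) (ψ q) (trans q p y) :=
    (contMDiffAt_ψ (trans_mem hq)).mdifferentiableAt (by simp)
  have h2 : MDifferentiableAt 𝓘(ℝ, Eu n) 𝓘(ℝ, Eu n) (trans q p) y :=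
    ((contDiffAt_trans hy hq).differentiableAt (by simp)).mdifferentiableAt
  have h3 : ψ p =ᶠ[𝓝 y] ψ q ∘ trans q p := by
    filter_upwards [eventually_source hy hq] with z hz
    exact (ψ_trans hz.2).symm
  have h4 := h3.mfderiv_eq (I := 𝓘(ℝ, Eu n)) (I' := 𝓡 n)
  rw [mfderiv_comp y h1 h2, mfderiv_eq_fderiv] at h4
  exact h4

/-- The tangent space at `p` is identified with `Eu n` through the preferred chart at `p` itself. At
`pt p`, coordinates are therefore the values of the tensor. -/
theorem dφ_eq (p : M) : dφ (n := n) p = ContinuousLinearMap.id ℝ (Eu n) :=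
  mfderiv_extChartAt_self

theorem Dψ_pt (p : M) : Dψ (n := n) p (pt p) = ContinuousLinearMap.id ℝ (Eu n) := by
  have := mfderivWithin_range_extChartAt_symm (I := 𝓡 n) (x := p)
  simp only [ModelWithCorners.range_eq_univ, mfderivWithin_univ] at this
  exact this

theorem Dψ_eq_fderiv {p : M} {y : Eu n} (hy : y ∈ tgt p) :
    Dψ p y = fderiv ℝ (trans (ψ p y) p) y := by
  rw [Dψ_trans hy (mem_extChartAt_source _)]
  have : trans (ψ p y) p y = pt (ψ p y) := rfl
  rw [this, Dψ_pt, ContinuousLinearMap.id_comp]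

theorem isInvertible_Dψ {p : M} {y : Eu n} (hy : y ∈ tgt p) : (Dψ p y).IsInvertible := by
  have := isInvertible_mfderivWithin_extChartAt_symm (I := 𝓡 n) hy
  simp only [ModelWithCorners.range_eq_univ, mfderivWithin_univ] at this
  exact this

theorem Dψ_inverse_apply {p : M} {y : Eu n} (hy : y ∈ tgt p) (v : Eu n) :
    (Dψ p y).inverse (Dψ p y v) = v := by
  obtain ⟨A, hA⟩ := isInvertible_Dψ hy
  rw [← hA]; simp

theorem Dψ_apply_inverse {p : M} {y : Eu n} (hy : y ∈ tgt p) (v : Eu n) :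
    Dψ p y ((Dψ p y).inverse v) = v := by
  obtain ⟨A, hA⟩ := isInvertible_Dψ hy
  rw [← hA]; simp

theorem isInvertible_fderiv_trans {q p : M} {y : Eu n} (hy : y ∈ tgt p)
    (hq : ψ p y ∈ (extChartAt (𝓡 n) q).source) : (fderiv ℝ (trans q p) y).IsInvertible := by
  have h := Dψ_trans hy hq
  obtain ⟨A, hA⟩ := isInvertible_Dψ hy
  obtain ⟨B, hB⟩ := isInvertible_Dψ (trans_mem hq)
  refine ⟨A.trans B.symm, ?_⟩
  rw [← hA, ← hB] at h
  ext1 v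
  have := congrArg (fun L => B.symm (L v)) h
  simpa using this

theorem coordVF_pt (p : M) (X : VF n M) : coordVF p X (pt p) = X p := by
  rw [coordVF_eq, Dψ_pt, ψ_pt, ContinuousLinearMap.inverse_id]; rfl

theorem coordOne_pt (p : M) (α : OneForm n M) : coordOne p α (pt p) = α p := by
  rw [coordOne_eq, Dψ_pt, ψ_pt, ContinuousLinearMap.comp_id]

theorem coordTwo_pt (p : M) (β : TwoTensor n M) : coordTwo p β (pt p) = β p := by
  rw [coordTwo_eq, Dψ_pt, ψ_pt]; rfl

/-- Change of charts for vector fields. -/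
theorem coordVF_trans {q p : M} {y : Eu n} (hy : y ∈ tgt p)
    (hq : ψ p y ∈ (extChartAt (𝓡 n) q).source) (X : VF n M) :
    fderiv ℝ (trans q p) y (coordVF p X y) = coordVF q X (trans q p y) := by
  rw [coordVF_eq, coordVF_eq, ψ_trans hq]
  generalize (show M → Eu n from X) (ψ p y) = v
  rw [← Dψ_inverse_apply (trans_mem hq) (fderiv ℝ (trans q p) y _)]
  congr 1
  rw [← ContinuousLinearMap.comp_apply, ← Dψ_trans hy hq, Dψ_apply_inverse hy]

/-- Change of charts for one-forms. -/
theorem coordOne_trans {q p : M} {y : Eu n} (hy : y ∈ tgt p)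
    (hq : ψ p y ∈ (extChartAt (𝓡 n) q).source) (α : OneForm n M) :
    coordOne p α y = (coordOne q α (trans q p y)).comp (fderiv ℝ (trans q p) y) := by
  rw [coordOne_eq, coordOne_eq, ψ_trans hq, Dψ_trans hy hq]; rfl

/-- Change of charts for two-tensors. -/
theorem coordTwo_trans {q p : M} {y : Eu n} (hy : y ∈ tgt p)
    (hq : ψ p y ∈ (extChartAt (𝓡 n) q).source) (β : TwoTensor n M) :
    coordTwo p β y = pullTwo (fderiv ℝ (trans q p) y) (coordTwo q β (trans q p y)) := by
  rw [coordTwo_eq, coordTwo_eq, ψ_trans hq, Dψ_trans hy hq]; rfl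

theorem coordVF_smul (p : M) (f : M → ℝ) (X : VF n M) (y : Eu n) :
    coordVF p (f • X) y = f (ψ p y) • coordVF p X y :=
  (Dψ p y).inverse.map_smul (f (ψ p y)) ((show M → Eu n from X) (ψ p y))

theorem coordVF_neg (p : M) (X : VF n M) (y : Eu n) :
    coordVF p (-X) y = -coordVF p X y :=
  (Dψ p y).inverse.map_neg ((show M → Eu n from X) (ψ p y))

/-- Evaluation of a one-form in a chart. -/
theorem coordOne_coordVF {p : M} {y : Eu n} (hy : y ∈ tgt p) (α : OneForm n M) (X : VF n M) :
    coordOne p α y (coordVF p X y) = α (ψ p y) (X (ψ p y)) := by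
  rw [coordOne_eq, coordVF_eq, ContinuousLinearMap.comp_apply, Dψ_apply_inverse hy]
  rfl

/-- Interior products in a chart. -/
theorem coordOne_ι2 {p : M} {y : Eu n} (hy : y ∈ tgt p) (β : TwoTensor n M) (X : VF n M) :
    coordOne p (ι2 X β) y = coordTwo p β y (coordVF p X y) := by
  ext v
  rw [coordTwo_eq, coordVF_eq, pullTwo_apply, Dψ_apply_inverse hy]
  rfl

end

section

variable {n : ℕ} {M : Type*} [TopologicalSpace M] [ChartedSpace (Eu n) M]

/-! ### Calculus in Euclidean space -/

theorem sum_apply_e (v : Eu n) : v = ∑ i, v i • e i := by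
  ext j
  simp [e, Finset.sum_apply, Pi.single_apply]

theorem clm_apply_eq_sum {F : Type*} [NormedAddCommGroup F] [NormedSpace ℝ F] (A : Eu n →L[ℝ] F)
    (v : Eu n) : A v = ∑ i, v i • A (e i) := by
  conv_lhs => rw [sum_apply_e v]
  simp

/-- The trace of an endomorphism of Euclidean space. -/
def tr (A : Eu n →L[ℝ] Eu n) : ℝ := LinearMap.trace ℝ (Eu n) A

theorem toMatrix_apply_e (A : Eu n →L[ℝ] Eu n) :
    LinearMap.toMatrix (EuclideanSpace.basisFun (Fin n) ℝ).toBasis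
      (EuclideanSpace.basisFun (Fin n) ℝ).toBasis A = Matrix.of fun i j => A (e j) i := by
  ext i j
  simp [LinearMap.toMatrix_apply, e]

theorem tr_eq_sum (A : Eu n →L[ℝ] Eu n) : tr A = ∑ i, A (e i) i := by
  rw [tr, LinearMap.trace_eq_matrix_trace ℝ (EuclideanSpace.basisFun (Fin n) ℝ).toBasis,
    toMatrix_apply_e]
  simp [Matrix.trace]

theorem det_eq_matrix (A : Eu n →L[ℝ] Eu n) : A.det = (Matrix.of fun i j => A (e j) i).det := by
  rw [ContinuousLinearMap.det, ← LinearMap.det_toMatrix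
    (EuclideanSpace.basisFun (Fin n) ℝ).toBasis, toMatrix_apply_e]

theorem tr_comm (A B : Eu n →L[ℝ] Eu n) : tr (A.comp B) = tr (B.comp A) :=
  LinearMap.trace_mul_comm ℝ (A : Eu n →ₗ[ℝ] Eu n) (B : Eu n →ₗ[ℝ] Eu n)

/-- The determinant is a polynomial in `t` whose linear coefficient is the trace. The remainder is
kept as a polynomial times `t ^ 2`, so that its derivative at `0` is visibly zero. -/
theorem det_one_add_smul_eq (A : Eu n →L[ℝ] Eu n) : ∃ c : Polynomial ℝ, ∀ t : ℝ,
    (ContinuousLinearMap.id ℝ (Eu n) + t • A).det = 1 + tr A * t + c.eval t * t ^ 2 := by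
  let N : Matrix (Fin n) (Fin n) ℝ := Matrix.of fun i j => A (e j) i
  refine ⟨(Matrix.det (1 + (Polynomial.X : Polynomial ℝ) •
    N.map Polynomial.C)).divX.divX, fun t => ?_⟩
  have h := Matrix.det_one_add_smul t N
  have h1 : Matrix.trace N = tr A := by rw [tr_eq_sum]; simp [N, Matrix.trace]
  rw [h1] at h
  rw [← h, det_eq_matrix]
  congr 1
  ext i j
  simp [N, Matrix.one_apply, e]

theorem contDiff_det : ContDiff ℝ ∞ (fun A : Eu n →L[ℝ] Eu n => A.det) := by
  simp only [det_eq_matrix, Matrix.det_apply]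
  refine ContDiff.sum fun σ _ => ContDiff.const_smul _ (contDiff_prod fun i _ => ?_)
  simp only [Matrix.of_apply]
  fun_prop

/-- Jacobi's formula. -/
theorem fderiv_det {A B : Eu n →L[ℝ] Eu n} (hB : A.comp B = ContinuousLinearMap.id ℝ (Eu n))
    (H : Eu n →L[ℝ] Eu n) :
    fderiv ℝ (fun A : Eu n →L[ℝ] Eu n => A.det) A H = A.det * tr (B.comp H) := by
  have h1 : HasDerivAt (fun t : ℝ => (A + t • H).det)
      (fderiv ℝ (fun A : Eu n →L[ℝ] Eu n => A.det) A H) 0 := by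
    have h2 : HasDerivAt (fun t : ℝ => A + t • H) H 0 := by
      simpa using ((hasDerivAt_id (0 : ℝ)).smul_const H).const_add A
    have h3 : DifferentiableAt ℝ (fun A : Eu n →L[ℝ] Eu n => A.det) A :=
      contDiff_det.differentiable (by simp) _
    exact h3.hasFDerivAt.comp_hasDerivAt_of_eq (0 : ℝ) h2
      (by rw [show (0 : ℝ) • H = 0 from zero_smul ℝ H, add_zero])
  -- As `A B = 1`, one has `A + t H = A (1 + t B H)`; the determinant factors, and only the linear
  -- term contributes at `t = 0`.
  obtain ⟨c, hc⟩ := det_one_add_smul_eq (B.comp H)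
  have h4 : (fun t : ℝ => (A + t • H).det) =
      fun t => A.det * (1 + tr (B.comp H) * t + c.eval t * t ^ 2) := by
    ext t
    rw [← hc]
    refine Eq.trans ?_ (LinearMap.det_comp (A : Eu n →ₗ[ℝ] Eu n)
      ((ContinuousLinearMap.id ℝ (Eu n) + t • B.comp H : Eu n →L[ℝ] Eu n) : Eu n →ₗ[ℝ] Eu n))
    refine congrArg (fun L : Eu n →L[ℝ] Eu n => L.det) ?_ |>.trans (b := (A.comp
      (ContinuousLinearMap.id ℝ (Eu n) + t • B.comp H)).det) rfl
    have : A.comp (B.comp H) = H := by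
      rw [← ContinuousLinearMap.comp_assoc, hB, ContinuousLinearMap.id_comp]
    rw [ContinuousLinearMap.comp_add, ContinuousLinearMap.comp_smul, this,
      ContinuousLinearMap.comp_id]
  have h5 : HasDerivAt (fun t : ℝ => A.det * (1 + tr (B.comp H) * t + c.eval t * t ^ 2))
      (A.det * tr (B.comp H)) 0 := by
    have h6 := (((hasDerivAt_id (0 : ℝ)).const_mul (tr (B.comp H))).const_add 1).add
      ((c.hasDerivAt 0).mul ((hasDerivAt_id (0 : ℝ)).pow 2)) |>.const_mul A.det
    exact h6.congr_deriv (by simp)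
  rw [h4] at h1
  exact h1.unique h5

/-- The exterior derivative of a one-form on Euclidean space. -/
def extE (a : Eu n → Eu n →L[ℝ] ℝ) (y : Eu n) : Eu n →L[ℝ] Eu n →L[ℝ] ℝ :=
  fderiv ℝ a y - (fderiv ℝ a y).flip

theorem extE_apply (a : Eu n → Eu n →L[ℝ] ℝ) (y v w : Eu n) :
    extE a y v w = fderiv ℝ a y v w - fderiv ℝ a y w v := rfl

theorem extE_congr {a b : Eu n → Eu n →L[ℝ] ℝ} {y : Eu n} (h : a =ᶠ[𝓝 y] b) :
    extE a y = extE b y := by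
  rw [extE, extE, h.fderiv_eq]

theorem fderiv_fderiv_symm {F : Type*} [NormedAddCommGroup F] [NormedSpace ℝ F] {f : Eu n → F}
    {y : Eu n} (hf : ContDiffAt ℝ ∞ f y) (v w : Eu n) :
    fderiv ℝ (fderiv ℝ f) y v w = fderiv ℝ (fderiv ℝ f) y w v :=
  (hf.isSymmSndFDerivAt (by simpa using WithTop.coe_le_coe.2 (le_top : (2 : ℕ∞) ≤ ⊤))).eq v w

theorem differentiableAt_fderiv {F : Type*} [NormedAddCommGroup F] [NormedSpace ℝ F] {f : Eu n → F}
    {y : Eu n} (hf : ContDiffAt ℝ ∞ f y) : DifferentiableAt ℝ (fderiv ℝ f) y :=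
  (hf.fderiv_right (m := ∞) (by simp)).differentiableAt (by simp)

theorem extE_fderiv {f : Eu n → ℝ} {y : Eu n} (hf : ContDiffAt ℝ ∞ f y) :
    extE (fderiv ℝ f) y = 0 := by
  ext v w
  rw [extE_apply, fderiv_fderiv_symm hf v w, sub_self]; rfl

/-- The exterior derivative commutes with pullbacks. -/
theorem extE_pullback {a b : Eu n → Eu n →L[ℝ] ℝ} {Φ : Eu n → Eu n} {y : Eu n}
    (hΦ : ContDiffAt ℝ ∞ Φ y) (ha : DifferentiableAt ℝ a (Φ y))
    (hb : b =ᶠ[𝓝 y] fun z => (a (Φ z)).comp (fderiv ℝ Φ z)) :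
    extE b y = pullTwo (fderiv ℝ Φ y) (extE a (Φ y)) := by
  have h1 : HasFDerivAt (fun z => (a (Φ z)).comp (fderiv ℝ Φ z)) _ y :=
    (ha.hasFDerivAt.comp y (hΦ.differentiableAt (by simp)).hasFDerivAt).clm_comp
      (differentiableAt_fderiv hΦ).hasFDerivAt
  ext v w
  rw [extE_apply, hb.fderiv_eq, h1.fderiv, pullTwo_apply, extE_apply]
  -- The terms with the second derivative of `Φ` are symmetric in `v` and `w` and cancel in the
  -- antisymmetrization.
  simp [fderiv_fderiv_symm hΦ v w]

/-- The divergence of a vector field on Euclidean space with respect to a density. -/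
def divE (ρ : Eu n → ℝ) (X : Eu n → Eu n) (y : Eu n) : ℝ :=
  (ρ y)⁻¹ * ∑ i, fderiv ℝ (fun z => ρ z * X z i) y (e i)

theorem divE_congr {ρ : Eu n → ℝ} {X Y : Eu n → Eu n} {y : Eu n} (h : X =ᶠ[𝓝 y] Y) :
    divE ρ X y = divE ρ Y y := by
  unfold divE
  congr 1
  refine Finset.sum_congr rfl fun i _ => ?_
  have : (fun z => ρ z * X z i) =ᶠ[𝓝 y] fun z => ρ z * Y z i := by
    filter_upwards [h] with z hz
    rw [hz]
  rw [this.fderiv_eq]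

theorem fderiv_coord {X : Eu n → Eu n} {y : Eu n} (hX : DifferentiableAt ℝ X y) (i : Fin n) :
    HasFDerivAt (fun z => X z i) ((EuclideanSpace.proj i).comp (fderiv ℝ X y)) y :=
  (EuclideanSpace.proj i : Eu n →L[ℝ] ℝ).hasFDerivAt.comp y hX.hasFDerivAt

/-- The product rule, put into a form without indices whose two terms can be followed through a
change of coordinates. -/
theorem divE_eq {ρ : Eu n → ℝ} {X : Eu n → Eu n} {y : Eu n} (hρ : DifferentiableAt ℝ ρ y)
    (h0 : ρ y ≠ 0) (hX : DifferentiableAt ℝ X y) :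
    divE ρ X y = tr (fderiv ℝ X y) + (ρ y)⁻¹ * fderiv ℝ ρ y (X y) := by
  have h1 : ∀ i, fderiv ℝ (fun z => ρ z * X z i) y (e i) =
      ρ y * fderiv ℝ X y (e i) i + X y i * fderiv ℝ ρ y (e i) := fun i => by
    rw [(hρ.hasFDerivAt.fun_mul (fderiv_coord hX i)).fderiv]
    simp
  unfold divE
  simp only [h1, Finset.sum_add_distrib, ← Finset.mul_sum]
  rw [clm_apply_eq_sum (fderiv ℝ ρ y) (X y), tr_eq_sum]
  field_simp
  simp

/-- The divergence does not depend on the coordinates. -/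
theorem divE_trans {ρ σ : Eu n → ℝ} {X Y Φ : Eu n → Eu n} {y : Eu n}
    (hΦ : ContDiffAt ℝ ∞ Φ y) (hi : (fderiv ℝ Φ y).IsInvertible)
    (hσ : DifferentiableAt ℝ σ (Φ y)) (h0 : σ (Φ y) ≠ 0)
    (hρ : ρ =ᶠ[𝓝 y] fun z => |(fderiv ℝ Φ z).det| * σ (Φ z))
    (hX : DifferentiableAt ℝ X y) (hY : DifferentiableAt ℝ Y (Φ y))
    (hXY : ∀ᶠ z in 𝓝 y, fderiv ℝ Φ z (X z) = Y (Φ z)) :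
    divE ρ X y = divE σ Y (Φ y) := by
  obtain ⟨A, hA⟩ := hi
  set B : Eu n →L[ℝ] Eu n := (A.symm : Eu n →L[ℝ] Eu n)
  have hAB : (fderiv ℝ Φ y).comp B = ContinuousLinearMap.id ℝ (Eu n) := by
    rw [← hA]; ext1 v; simp [B]
  have hBA : B.comp (fderiv ℝ Φ y) = ContinuousLinearMap.id ℝ (Eu n) := by
    rw [← hA]; ext1 v; simp [B]
  have hd : (fderiv ℝ Φ y).det ≠ 0 := by
    rw [← hA]; exact A.toLinearEquiv.isUnit_det'.ne_zero
  have hΦd := hΦ.differentiableAt (by simp)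
  -- The sign of the Jacobian at `y`. It is the same at nearby points, so the absolute value in `ρ`
  -- may be replaced by this constant and `ρ` can be differentiated.
  set s : ℝ := |(fderiv ℝ Φ y).det| / (fderiv ℝ Φ y).det
  have hs : s ≠ 0 := div_ne_zero (abs_ne_zero.2 hd) hd
  have hdet : HasFDerivAt (fun z => (fderiv ℝ Φ z).det) _ y :=
    (contDiff_det.differentiable (by simp) _).hasFDerivAt.comp y
      (differentiableAt_fderiv hΦ).hasFDerivAt
  have hρ' : ρ =ᶠ[𝓝 y] fun z => s * ((fderiv ℝ Φ z).det * σ (Φ z)) := by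
    have : ∀ᶠ z in 𝓝 y, 0 < (fderiv ℝ Φ z).det / (fderiv ℝ Φ y).det := by
      refine (hdet.continuousAt.div_const _).eventually (lt_mem_nhds ?_)
      simp only [div_self hd, one_pos]
    filter_upwards [hρ, this] with z hz hz'
    rw [hz, ← mul_assoc]
    congr 1
    rcases hd.lt_or_gt with h | h
    · have : (fderiv ℝ Φ z).det < 0 := by
        rcases div_pos_iff.1 hz' with h' | h'
        · exact absurd h'.2 h.not_gt
        · exact h'.1
      simp only [s]
      rw [abs_of_neg h, abs_of_neg this]; field_simp
    · have : 0 < (fderiv ℝ Φ z).det := by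
        rcases div_pos_iff.1 hz' with h' | h'
        · exact h'.1
        · exact absurd h'.2 h.not_gt
      simp only [s]
      rw [abs_of_pos h, abs_of_pos this]; field_simp
  have hσΦ : HasFDerivAt (fun z => σ (Φ z)) _ y := hσ.hasFDerivAt.comp y hΦd.hasFDerivAt
  have hρd : HasFDerivAt ρ _ y := ((hdet.mul hσΦ).const_mul s).congr_of_eventuallyEq hρ'
  have hρ0 : ρ y = s * ((fderiv ℝ Φ y).det * σ (Φ y)) := hρ'.self_of_nhds
  have e1 : HasFDerivAt (fun z => fderiv ℝ Φ z (X z)) _ y :=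
    (differentiableAt_fderiv hΦ).hasFDerivAt.clm_apply hX.hasFDerivAt
  have e2 : HasFDerivAt (fun z => Y (Φ z)) _ y := hY.hasFDerivAt.comp y hΦd.hasFDerivAt
  have e3 := (e2.congr_of_eventuallyEq hXY).unique e1
  -- This is the derivative of `DΦ X = Y ∘ Φ`, multiplied by `B = (DΦ)⁻¹`. In the trace, the second
  -- derivative of `Φ` leaves the term that Jacobi's formula produces from the factor `det DΦ` of
  -- `ρ`, so the two descriptions of the divergence agree.
  have e4 : fderiv ℝ X y + B.comp ((fderiv ℝ (fderiv ℝ Φ) y) (X y)) =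
      B.comp ((fderiv ℝ Y (Φ y)).comp (fderiv ℝ Φ y)) := by
    rw [e3, ContinuousLinearMap.comp_add, ← ContinuousLinearMap.comp_assoc, hBA,
      ContinuousLinearMap.id_comp]
    congr 2
    ext1 v
    simp [fderiv_fderiv_symm hΦ v (X y)]
  have e5 : tr (fderiv ℝ X y) + tr (B.comp ((fderiv ℝ (fderiv ℝ Φ) y) (X y))) =
      tr (fderiv ℝ Y (Φ y)) := by
    have : tr (fderiv ℝ Y (Φ y)) = tr (B.comp ((fderiv ℝ Y (Φ y)).comp (fderiv ℝ Φ y))) := by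
      rw [tr_comm, ContinuousLinearMap.comp_assoc, hAB, ContinuousLinearMap.comp_id]
    rw [this, ← e4]
    simp [tr]
  rw [divE_eq hρd.differentiableAt (by rw [hρ0]; positivity) hX, divE_eq hσ h0 hY, ← e5,
    hρd.fderiv, hρ0, ← hXY.self_of_nhds]
  simp only [smul_apply, add_apply, smul_eq_mul,
    ContinuousLinearMap.comp_apply, fderiv_det hAB]
  field_simp
  ring

end

section

variable {n : ℕ} {M : Type*} [TopologicalSpace M] [ChartedSpace (Eu n) M] [IsManifold (𝓡 n) ∞ M]

/-! ### Smoothness in charts -/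

/-- The bridge between smoothness in the tangent bundle and smoothness of components: the fibre
coordinate of the trivialization at `p` is the component vector in the chart at `p`. -/
theorem trivializationAt_snd {p x : M} (hx : x ∈ (extChartAt (𝓡 n) p).source) (X : VF n M) :
    (trivializationAt (Eu n) (TangentSpace (𝓡 n)) p (⟨x, X x⟩ : TangentBundle (𝓡 n) M)).2 =
      coordVF p X (extChartAt (𝓡 n) p x) := by
  have h := coordVF_trans (n := n) (q := p) (p := x) (pt_mem_tgt x)
    (by rwa [ψ_pt]) X
  rw [coordVF_pt, trans, ψ_pt] at h
  rw [← h, TangentBundle.trivializationAt_apply]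
  simp only [ModelWithCorners.range_eq_univ, fderivWithin_univ]
  rfl

theorem contDiffOn_coordVF_of_smoothTimeVF {J : Set ℝ} {u : ℝ → VF n M} (hu : SmoothTimeVF J u)
    (p : M) : ContDiffOn ℝ ∞ (fun q : ℝ × Eu n => coordVF p (u q.1) q.2) (J ×ˢ tgt p) := by
  have h1 : ContMDiffOn 𝓘(ℝ, ℝ × Eu n) (𝓘(ℝ, ℝ).prod (𝓡 n)) ∞
      (fun q : ℝ × Eu n => (q.1, ψ p q.2)) (J ×ˢ tgt p) := by
    refine ContMDiffOn.prodMk contDiff_fst.contMDiff.contMDiffOn ?_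
    exact (contMDiffOn_extChartAt_symm p).comp contDiff_snd.contMDiff.contMDiffOn
      (fun q hq => hq.2)
  have h2 := hu.comp h1 (fun q hq => ⟨hq.1, trivial⟩)
  have h3 := (Bundle.Trivialization.contMDiffOn_iff
    (e := trivializationAt (Eu n) (TangentSpace (𝓡 n)) p) (fun q hq => by
      have := ψ_mem_source hq.2
      rw [extChartAt_source] at this
      simpa [Bundle.Trivialization.mem_source] using this)).1 h2
  refine (contMDiffOn_iff_contDiffOn.1 h3.2).congr fun q hq => ?_
  have h4 := trivializationAt_snd (ψ_mem_source hq.2) (u q.1)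
  rw [(extChartAt (𝓡 n) p).right_inv hq.2] at h4
  exact h4.symm

theorem contDiffOn_coordVF {X : VF n M} (hX : SmoothVF X) (p : M) :
    ContDiffOn ℝ ∞ (coordVF p X) (tgt p) := by
  have h : SmoothTimeVF univ (fun _ => X) := by
    exact (ContMDiff.comp (g := fun x => (⟨x, X x⟩ : TangentBundle (𝓡 n) M)) hX
      (contMDiff_snd (M := ℝ) (I := 𝓘(ℝ, ℝ)))).contMDiffOn
  have h1 := contDiffOn_coordVF_of_smoothTimeVF h p
  have h2 : ContDiffOn ℝ ∞ (fun y : Eu n => ((0 : ℝ), y)) (tgt p) :=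
    (contDiff_const.prodMk contDiff_id).contDiffOn
  exact ContDiffOn.comp (g := fun q : ℝ × Eu n => coordVF p X q.2) (f := fun y : Eu n => ((0 : ℝ), y))
    h1 h2 (fun y hy => ⟨trivial, hy⟩)

theorem smoothVF_of_coordVF {X : VF n M} (hX : ∀ p, ContDiffOn ℝ ∞ (coordVF p X) (tgt p)) :
    SmoothVF X := by
  intro p
  refine (Bundle.contMDiffAt_section (IB := 𝓡 n) (n := ∞) (F := Eu n)
    (E := fun x : M => TangentSpace (𝓡 n) x) (s := X) p).2 ?_
  have h1 : ContMDiffAt (𝓡 n) 𝓘(ℝ, Eu n) ∞ (fun x => coordVF p X (extChartAt (𝓡 n) p x)) p :=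
    ContMDiffAt.comp (g := coordVF p X) (f := extChartAt (𝓡 n) p) p
      ((hX p).contDiffAt (tgt_mem_nhds (pt_mem_tgt p))).contMDiffAt
      (contMDiffAt_chart (mem_extChartAt_source p))
  refine h1.congr_of_eventuallyEq ?_
  filter_upwards [extChartAt_source_mem_nhds (I := 𝓡 n) p] with x hx
  exact trivializationAt_snd hx X

/-- In the trivialization at `p` the field is the constant `v`. The metric is evaluated on these
fields to see that its coefficients are smooth. -/
theorem contMDiffOn_coordinate_field (p : M) (v : Eu n) :
    ContMDiffOn 𝓘(ℝ, Eu n) (𝓡 n).tangent ∞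
      (fun y => (⟨ψ p y, dψ p y v⟩ : TangentBundle (𝓡 n) M)) (tgt p) := by
  refine (Bundle.Trivialization.contMDiffOn_iff
    (e := trivializationAt (Eu n) (TangentSpace (𝓡 n)) p) (fun y hy => by
      have := ψ_mem_source hy
      rw [extChartAt_source] at this
      simpa [Bundle.Trivialization.mem_source] using this)).2
      ⟨contMDiffOn_extChartAt_symm p, ?_⟩
  refine (contMDiffOn_const (c := v)).congr fun y hy => ?_
  have h4 := trivializationAt_snd (ψ_mem_source hy)
    (show VF n M from fun _ => (Dψ p y v : Eu n))
  rw [(extChartAt (𝓡 n) p).right_inv hy, coordVF_eq] at h4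
  exact h4.trans (Dψ_inverse_apply hy v)

theorem contDiffOn_clm_of_apply_e {F : Type*} [NormedAddCommGroup F] [NormedSpace ℝ F]
    {E : Type*} [NormedAddCommGroup E] [NormedSpace ℝ E]
    {A : E → Eu n →L[ℝ] F} {s : Set E} (h : ∀ i, ContDiffOn ℝ ∞ (fun y => A y (e i)) s) :
    ContDiffOn ℝ ∞ A s := by
  refine contDiffOn_clm_apply.2 fun v => ?_
  simp only [clm_apply_eq_sum _ v]
  exact ContDiffOn.sum fun i _ => (h i).const_smul _

variable (g : Metric n M)

theorem contDiffOn_metric (p : M) : ContDiffOn ℝ ∞ (coordTwo p g.inner) (tgt p) := by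
  refine contDiffOn_clm_of_apply_e fun i => contDiffOn_clm_of_apply_e fun j => ?_
  have h1 : ContMDiffOn 𝓘(ℝ, Eu n) (𝓡 n) ∞ (ψ p) (tgt p) := contMDiffOn_extChartAt_symm p
  have h2 := g.contMDiff.comp_contMDiffOn h1
  have h3 := ContMDiffOn.clm_bundle_apply₂ (F₁ := Eu n) (F₂ := Eu n) (F₃ := ℝ) (E₃ := Bundle.Trivial M ℝ)
    h2 (contMDiffOn_coordinate_field p (e i)) (contMDiffOn_coordinate_field p (e j))
  intro y hy
  have h4 := h3 y hy
  rw [Bundle.contMDiffWithinAt_totalSpace] at h4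
  exact (contMDiffWithinAt_iff_contDiffWithinAt.1 h4.2)

end

section

variable {n : ℕ} {M : Type*} [TopologicalSpace M] [ChartedSpace (Eu n) M] [IsManifold (𝓡 n) ∞ M]

/-! ### The metric in charts -/

theorem trans_trans {q p : M} {y : Eu n} (hy : y ∈ tgt p)
    (hq : ψ p y ∈ (extChartAt (𝓡 n) q).source) : trans p q (trans q p y) = y := by
  rw [trans, ψ_trans hq, (extChartAt (𝓡 n) p).right_inv hy]

theorem coordVF_eventuallyEq {q p : M} {y : Eu n} (hy : y ∈ tgt p)
    (hq : ψ p y ∈ (extChartAt (𝓡 n) q).source) (X : VF n M) :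
    coordVF p X =ᶠ[𝓝 y] fun z =>
      fderiv ℝ (trans p q) (trans q p z) (coordVF q X (trans q p z)) := by
  filter_upwards [eventually_source hy hq] with z hz
  rw [coordVF_trans (trans_mem hz.2) (by rw [ψ_trans hz.2]; exact ψ_mem_source hz.1),
    trans_trans hz.1 hz.2]

/-- The operators at a point use the preferred chart of that point, whereas regularity is known in a
fixed chart; this carries it from one to the other. -/
theorem differentiableAt_coordVF {q p : M} {y : Eu n} (hy : y ∈ tgt p)
    (hq : ψ p y ∈ (extChartAt (𝓡 n) q).source) {X : VF n M}
    (hX : DifferentiableAt ℝ (coordVF q X) (trans q p y)) :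
    DifferentiableAt ℝ (coordVF p X) y := by
  have h1 := (contDiffAt_trans hy hq).differentiableAt (by simp)
  have h2 : ContDiffAt ℝ ∞ (trans p q) (trans q p y) :=
    contDiffAt_trans (trans_mem hq) (by rw [ψ_trans hq]; exact ψ_mem_source hy)
  have h3 : DifferentiableAt ℝ (fun z => fderiv ℝ (trans p q) (trans q p z)) y :=
    (differentiableAt_fderiv h2).comp y h1
  have h4 : DifferentiableAt ℝ (fun z => coordVF q X (trans q p z)) y := hX.comp y h1
  exact (h3.clm_apply h4).congr_of_eventuallyEq (coordVF_eventuallyEq hy hq X)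

theorem differentiableAt_coordOne {q p : M} {y : Eu n} (hy : y ∈ tgt p)
    (hq : ψ p y ∈ (extChartAt (𝓡 n) q).source) {α : OneForm n M}
    (hα : DifferentiableAt ℝ (coordOne q α) (trans q p y)) :
    DifferentiableAt ℝ (coordOne p α) y := by
  have h1 := (contDiffAt_trans hy hq).differentiableAt (by simp)
  have h4 : DifferentiableAt ℝ (fun z => coordOne q α (trans q p z)) y := hα.comp y h1
  refine (h4.clm_comp (differentiableAt_fderiv (contDiffAt_trans hy hq))).congr_of_eventuallyEq ?_
  filter_upwards [eventually_source hy hq] with z hz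
  exact coordOne_trans hz.1 hz.2 α

/-- The exterior derivative of a one-form in a chart. -/
theorem coordTwo_d1 {p : M} {y : Eu n} (hy : y ∈ tgt p) {α : OneForm n M}
    (hα : DifferentiableAt ℝ (coordOne p α) y) :
    coordTwo p (d1 α) y = extE (coordOne p α) y := by
  -- At `ψ p y`, the form `d1 α` is computed in the preferred chart of `ψ p y`, not of `p`. The
  -- pullback rule along the transition map compares the two.
  have hq := mem_extChartAt_source (I := 𝓡 n) (ψ p y)
  have hqp : ψ (ψ p y) (pt (n := n) (ψ p y)) ∈ (extChartAt (𝓡 n) p).source := by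
    rw [ψ_pt]; exact ψ_mem_source hy
  have hα' : DifferentiableAt ℝ (coordOne (ψ p y) α) (trans (ψ p y) p y) := by
    refine differentiableAt_coordOne (q := p) (pt_mem_tgt _) hqp ?_
    rwa [show pt (ψ p y) = trans (ψ p y) p y from rfl, trans_trans hy hq]
  rw [extE_pullback (contDiffAt_trans hy hq) hα' (b := coordOne p α), coordTwo_eq,
    Dψ_eq_fderiv hy]
  · show pullTwo _ (pullTwo (dφ (ψ p y)) _) = _
    rw [dφ_eq]; rfl
  · filter_upwards [eventually_source hy hq] with z hz
    exact coordOne_trans hz.1 hz.2 α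

variable (g : Metric n M)

theorem metric_symm (p : M) (y v w : Eu n) :
    coordTwo p g.inner y v w = coordTwo p g.inner y w v := g.symm _ _ _

theorem metric_pos {p : M} {y v : Eu n} (hy : y ∈ tgt p) (hv : v ≠ 0) :
    0 < coordTwo p g.inner y v v := by
  refine g.pos _ _ fun h => hv ?_
  have := Dψ_inverse_apply hy v
  rw [show Dψ p y v = 0 from h, map_zero] at this
  exact this.symm

theorem isInvertible_of_pos {T : Eu n →L[ℝ] Eu n →L[ℝ] ℝ} (hT : ∀ v, v ≠ 0 → 0 < T v v) :
    T.IsInvertible := by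
  have hinj : Function.Injective T := by
    rw [injective_iff_map_eq_zero]
    intro v hv
    by_contra h
    have h1 := hT v h
    rw [hv] at h1
    exact lt_irrefl _ h1
  have hd : Module.finrank ℝ (Eu n) = Module.finrank ℝ (Eu n →L[ℝ] ℝ) := by
    rw [← LinearMap.toContinuousLinearMap.finrank_eq]
    exact (Subspace.dual_finrank_eq).symm
  let L : Eu n ≃ₗ[ℝ] (Eu n →L[ℝ] ℝ) := LinearEquiv.ofInjectiveOfFinrankEq T.toLinearMap hinj hd
  exact ⟨L.toContinuousLinearEquiv, by ext; rfl⟩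

theorem isInvertible_metric {p : M} {y : Eu n} (hy : y ∈ tgt p) :
    (coordTwo p g.inner y).IsInvertible :=
  isInvertible_of_pos fun _ hv => metric_pos g hy hv

theorem metric_inverse_apply {p : M} {y : Eu n} (hy : y ∈ tgt p) (v : Eu n) :
    (coordTwo p g.inner y).inverse (coordTwo p g.inner y v) = v := by
  obtain ⟨A, hA⟩ := isInvertible_metric g hy
  rw [← hA]; simp

theorem metric_apply_inverse {p : M} {y : Eu n} (hy : y ∈ tgt p) (l : Eu n →L[ℝ] ℝ) :
    coordTwo p g.inner y ((coordTwo p g.inner y).inverse l) = l := by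
  obtain ⟨A, hA⟩ := isInvertible_metric g hy
  rw [← hA]; simp

theorem contDiffOn_metric_inverse (p : M) :
    ContDiffOn ℝ ∞ (fun y => (coordTwo p g.inner y).inverse) (tgt p) := by
  intro y hy
  obtain ⟨A, hA⟩ := isInvertible_metric g hy
  have h1 := contDiffAt_map_inverse (𝕜 := ℝ) (n := ∞) A
  rw [hA] at h1
  exact h1.comp_contDiffWithinAt y (contDiffOn_metric g p y hy)

theorem coordOne_flat {p : M} {y : Eu n} (hy : y ∈ tgt p) (X : VF n M) :
    coordOne p (flat g X) y = coordTwo p g.inner y (coordVF p X y) :=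
  coordOne_ι2 hy g.inner X

theorem flat_sharp (α : OneForm n M) : flat g (sharp g α) = α := by
  funext x
  ext w
  exact inner_sharp g α x w

theorem flat_injective : Function.Injective (flat g : VF n M → OneForm n M) := by
  intro X Y h
  funext x
  by_contra hne
  have h1 := g.pos x (X x - Y x) (sub_ne_zero.2 hne)
  have h2 : g.inner x (X x) = g.inner x (Y x) := congrFun h x
  have h3 : g.inner x (X x - Y x) = 0 := by rw [map_sub, h2, sub_self]
  rw [h3] at h1
  exact lt_irrefl _ h1

theorem sharp_flat (X : VF n M) : sharp g (flat g X) = X :=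
  flat_injective g (flat_sharp g _)

theorem coordVF_sharp {p : M} {y : Eu n} (hy : y ∈ tgt p) (α : OneForm n M) :
    coordVF p (sharp g α) y = (coordTwo p g.inner y).inverse (coordOne p α y) := by
  rw [← metric_inverse_apply g hy (coordVF p (sharp g α) y), ← coordOne_flat g hy, flat_sharp]

theorem gram_apply (p : M) (y : Eu n) (i j : Fin n) :
    gram g p y i j = coordTwo p g.inner y (e i) (e j) := rfl

theorem gram_posDef {p : M} {y : Eu n} (hy : y ∈ tgt p) : (gram g p y).PosDef := by
  refine Matrix.PosDef.of_dotProduct_mulVec_pos ?_ fun v hv => ?_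
  · ext i j
    simp only [Matrix.conjTranspose_apply, gram_apply, star_trivial]
    exact metric_symm g p y _ _
  · have h := metric_pos g hy (v := WithLp.toLp 2 v) (by
      intro h; exact hv (by simpa using congrArg WithLp.ofLp h))
    rw [clm_apply_eq_sum (coordTwo p g.inner y) (WithLp.toLp 2 v)] at h
    simp only [sum_apply, smul_apply] at h
    refine h.trans_eq ?_
    simp only [dotProduct, Matrix.mulVec, gram_apply, star_trivial]
    refine Finset.sum_congr rfl fun i _ => ?_
    rw [clm_apply_eq_sum (coordTwo p g.inner y (e i)) (WithLp.toLp 2 v)]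
    simp [mul_comm]

theorem density_pos {p : M} {y : Eu n} (hy : y ∈ tgt p) : 0 < density g p y :=
  Real.sqrt_pos.2 (gram_posDef g hy).det_pos

theorem contDiffOn_gram (p : M) (i j : Fin n) :
    ContDiffOn ℝ ∞ (fun y => gram g p y i j) (tgt p) :=
  ((contDiffOn_metric g p).clm_apply contDiffOn_const).clm_apply contDiffOn_const

theorem contDiffOn_density (p : M) : ContDiffOn ℝ ∞ (density g p) (tgt p) := by
  refine ContDiffOn.sqrt ?_ fun y hy => (gram_posDef g hy).det_pos.ne'
  simp only [Matrix.det_apply]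
  exact ContDiffOn.sum fun σ _ => (contDiffOn_prod fun i _ => contDiffOn_gram g p _ _).const_smul _

theorem differentiableAt_density {p : M} {y : Eu n} (hy : y ∈ tgt p) :
    DifferentiableAt ℝ (density g p) y :=
  ((contDiffOn_density g p).contDiffAt (tgt_mem_nhds hy)).differentiableAt (by simp)

/-- The matrix of an endomorphism of `Eu n`. -/
def mat (A : Eu n →L[ℝ] Eu n) : Matrix (Fin n) (Fin n) ℝ := Matrix.of fun i j => A (e j) i

/-- The matrix of a bilinear form on `Eu n`. -/
def mat₂ (B : Eu n →L[ℝ] Eu n →L[ℝ] ℝ) : Matrix (Fin n) (Fin n) ℝ :=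
  Matrix.of fun i j => B (e i) (e j)

theorem mat₂_pullTwo (A : Eu n →L[ℝ] Eu n) (B : Eu n →L[ℝ] Eu n →L[ℝ] ℝ) :
    mat₂ (pullTwo A B) = (mat A).transpose * mat₂ B * mat A := by
  ext i j
  simp only [mat₂, Matrix.of_apply, pullTwo_apply, Matrix.mul_apply, Matrix.transpose_apply, mat]
  rw [clm_apply_eq_sum B (A (e i))]
  simp only [sum_apply, smul_apply, smul_eq_mul, Finset.sum_mul]
  rw [Finset.sum_comm]
  refine Finset.sum_congr rfl fun k _ => ?_
  rw [clm_apply_eq_sum (B (e k)) (A (e j)), Finset.mul_sum]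
  refine Finset.sum_congr rfl fun l _ => ?_
  simp only [smul_eq_mul]; ring

theorem gram_trans {q p : M} {y : Eu n} (hy : y ∈ tgt p)
    (hq : ψ p y ∈ (extChartAt (𝓡 n) q).source) :
    gram g p y = (mat (fderiv ℝ (trans q p) y)).transpose * gram g q (trans q p y) *
      mat (fderiv ℝ (trans q p) y) := by
  have := mat₂_pullTwo (fderiv ℝ (trans q p) y) (coordTwo q g.inner (trans q p y))
  rw [← coordTwo_trans hy hq] at this
  exact this

/-- The Gram matrices are congruent by the Jacobian matrix, so their determinants differ by its
squared determinant. The factor is that of the change-of-variables formula, and the one `divE_trans`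
requires. -/
theorem density_trans {q p : M} {y : Eu n} (hy : y ∈ tgt p)
    (hq : ψ p y ∈ (extChartAt (𝓡 n) q).source) :
    density g p y = |(fderiv ℝ (trans q p) y).det| * density g q (trans q p y) := by
  rw [density, density, gram_trans g hy hq, Matrix.det_mul, Matrix.det_mul, Matrix.det_transpose,
    det_eq_matrix, ← Real.sqrt_sq_eq_abs, ← Real.sqrt_mul (sq_nonneg _)]
  congr 1
  simp only [mat]
  ring

/-- The divergence in a chart. -/
theorem divg_eq {p : M} {y : Eu n} (hy : y ∈ tgt p) {X : VF n M}
    (hX : DifferentiableAt ℝ (coordVF p X) y) :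
    divg g X (ψ p y) = divE (density g p) (coordVF p X) y := by
  have hq := mem_extChartAt_source (I := 𝓡 n) (ψ p y)
  have hqp : ψ (ψ p y) (pt (n := n) (ψ p y)) ∈ (extChartAt (𝓡 n) p).source := by
    rw [ψ_pt]; exact ψ_mem_source hy
  have hX' : DifferentiableAt ℝ (coordVF (ψ p y) X) (trans (ψ p y) p y) := by
    refine differentiableAt_coordVF (q := p) (pt_mem_tgt _) hqp ?_
    rwa [show pt (ψ p y) = trans (ψ p y) p y from rfl, trans_trans hy hq]
  refine (divE_trans (contDiffAt_trans hy hq) (isInvertible_fderiv_trans hy hq)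
    (differentiableAt_density g (trans_mem hq)) (density_pos g (trans_mem hq)).ne' ?_ hX hX'
    ?_).symm
  · filter_upwards [eventually_source hy hq] with z hz
    exact density_trans g hz.1 hz.2
  · filter_upwards [eventually_source hy hq] with z hz
    exact coordVF_trans hz.1 hz.2 X

/-- The inner product of bilinear forms, for an inverse Gram matrix `N`. -/
def innerE (N : Matrix (Fin n) (Fin n) ℝ) (A B : Eu n →L[ℝ] Eu n →L[ℝ] ℝ) : ℝ :=
  (1 / 2) * ∑ i, ∑ j, ∑ k, ∑ l, N i k * N j l * A (e i) (e j) * B (e k) (e l)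

/-- As a trace, invariance under a change of basis reduces to cancelling the base-change matrix
against its inverse by cyclicity. -/
theorem innerE_eq_trace (N : Matrix (Fin n) (Fin n) ℝ) (A B : Eu n →L[ℝ] Eu n →L[ℝ] ℝ) :
    innerE N A B = (1 / 2) * (N * mat₂ B * N.transpose * (mat₂ A).transpose).trace := by
  rw [innerE, Matrix.trace]
  congr 1
  refine Finset.sum_congr rfl fun i _ => ?_
  simp only [Matrix.diag_apply, Matrix.mul_apply, Matrix.transpose_apply, mat₂, Matrix.of_apply,
    Finset.sum_mul]
  refine Finset.sum_congr rfl fun j _ => ?_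
  rw [Finset.sum_comm]
  refine Finset.sum_congr rfl fun k _ => Finset.sum_congr rfl fun l _ => ?_
  ring

theorem innerE_pullTwo {N G : Matrix (Fin n) (Fin n) ℝ} {C : Eu n →L[ℝ] Eu n}
    (hC : IsUnit (mat C).det) (A B : Eu n →L[ℝ] Eu n →L[ℝ] ℝ)
    (hG : G = (mat C).transpose * N * mat C) :
    innerE G⁻¹ (pullTwo C A) (pullTwo C B) = innerE N⁻¹ A B := by
  have hT : IsUnit (mat C).transpose.det := by rwa [Matrix.det_transpose]
  rw [innerE_eq_trace, innerE_eq_trace, mat₂_pullTwo, mat₂_pullTwo, hG, Matrix.mul_inv_rev,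
    Matrix.mul_inv_rev]
  simp only [Matrix.transpose_mul, Matrix.transpose_transpose, Matrix.mul_assoc,
    Matrix.transpose_nonsing_inv]
  rw [Matrix.nonsing_inv_mul_cancel_left _ _ hT, Matrix.mul_nonsing_inv_cancel_left _ _ hC,
    Matrix.nonsing_inv_mul_cancel_left _ _ hT, Matrix.trace_mul_comm]
  simp only [Matrix.mul_assoc]
  rw [Matrix.mul_nonsing_inv _ hC, Matrix.mul_one]

/-- The inner product of two-tensors in a chart. -/
theorem innerTwo_eq {p : M} {y : Eu n} (hy : y ∈ tgt p) (α β : TwoTensor n M) :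
    innerTwo g α β (ψ p y) = innerE (gram g p y)⁻¹ (coordTwo p α y) (coordTwo p β y) := by
  have hq := mem_extChartAt_source (I := 𝓡 n) (ψ p y)
  rw [coordTwo_trans hy hq α, coordTwo_trans hy hq β]
  refine (innerE_pullTwo ?_ _ _ (gram_trans g hy hq)).symm
  obtain ⟨A, hA⟩ := isInvertible_fderiv_trans hy hq
  rw [← hA, mat, ← det_eq_matrix]
  exact A.toLinearEquiv.isUnit_det'

end

section

/-! ### Families of functions that depend smoothly on time -/

variable {n : ℕ} {E F : Type*} [NormedAddCommGroup E] [NormedSpace ℝ E]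
  [NormedAddCommGroup F] [NormedSpace ℝ F]

/-- `J` is an interval with more than one point. -/
structure IsIv (J : Set ℝ) : Prop where
  ord : J.OrdConnected
  nontriv : J.Nontrivial

theorem isIv_univ : IsIv univ := ⟨ordConnected_univ, nontrivial_univ⟩

theorem IsIv.convex {J : Set ℝ} (hJ : IsIv J) : Convex ℝ J := hJ.ord.convex

theorem IsIv.interior_nonempty {J : Set ℝ} (hJ : IsIv J) : (interior J).Nonempty := by
  obtain ⟨a, ha, b, hb, hab⟩ := hJ.nontriv
  wlog h : a < b generalizing a b
  · exact this b hb a ha hab.symm (lt_of_le_of_ne (not_lt.1 h) hab.symm)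
  refine ⟨(a + b) / 2, interior_mono (hJ.ord.out ha hb) ?_⟩
  rw [interior_Icc]
  constructor <;> linarith

theorem IsIv.uniqueDiffOn {J : Set ℝ} (hJ : IsIv J) : UniqueDiffOn ℝ J :=
  uniqueDiffOn_convex hJ.convex hJ.interior_nonempty

/-- Endpoints of `J` are limits of interior points, as the symmetry of second derivatives within `J
×ˢ U` demands. -/
theorem IsIv.subset_closure_interior {J : Set ℝ} (hJ : IsIv J) : J ⊆ closure (interior J) := by
  rw [hJ.convex.closure_interior_eq_closure_of_nonempty_interior hJ.interior_nonempty]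
  exact subset_closure

/-- `F t y` is jointly smooth for `(t, y) ∈ J × U`, and `F'` is its derivative in `t`. -/
structure TD (J : Set ℝ) (U : Set (Eu n)) (F F' : ℝ → Eu n → E) : Prop where
  smooth : ContDiffOn ℝ ∞ (fun q : ℝ × Eu n => F q.1 q.2) (J ×ˢ U)
  deriv : ∀ t ∈ J, ∀ y ∈ U, HasDerivWithinAt (fun s => F s y) (F' t y) J t

section
variable {J : Set ℝ} {U : Set (Eu n)} {f f' h h' : ℝ → Eu n → E}

theorem TD.congr (H : TD J U f f') (h0 : ∀ t ∈ J, ∀ y ∈ U, h t y = f t y)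
    (h1 : ∀ t ∈ J, ∀ y ∈ U, h' t y = f' t y) : TD J U h h' where
  smooth := H.smooth.congr fun q hq => h0 q.1 hq.1 q.2 hq.2
  deriv t ht y hy := by
    rw [h1 t ht y hy]
    exact (H.deriv t ht y hy).congr (fun s hs => h0 s hs y hy) (h0 t ht y hy)

theorem TD.slice (H : TD J U f f') {t : ℝ} (ht : t ∈ J) : ContDiffOn ℝ ∞ (f t) U :=
  ContDiffOn.comp (g := fun q : ℝ × Eu n => f q.1 q.2) (f := fun y : Eu n => (t, y)) H.smooth
    (contDiff_const.prodMk contDiff_id).contDiffOn (fun _ hy => ⟨ht, hy⟩)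

theorem TD.const {f : Eu n → E} (hf : ContDiffOn ℝ ∞ f U) :
    TD J U (fun _ => f) (fun _ _ => 0) where
  smooth := hf.comp contDiff_snd.contDiffOn fun _ hq => hq.2
  deriv _ _ _ _ := hasDerivWithinAt_const _ _ _

theorem TD.add (H : TD J U f f') (K : TD J U h h') :
    TD J U (fun t y => f t y + h t y) (fun t y => f' t y + h' t y) where
  smooth := H.smooth.add K.smooth
  deriv t ht y hy := (H.deriv t ht y hy).add (K.deriv t ht y hy)

theorem TD.sum {ι : Type*} {s : Finset ι} {f f' : ι → ℝ → Eu n → E}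
    (H : ∀ i ∈ s, TD J U (f i) (f' i)) :
    TD J U (fun t y => ∑ i ∈ s, f i t y) (fun t y => ∑ i ∈ s, f' i t y) where
  smooth := ContDiffOn.sum fun i hi => (H i hi).smooth
  deriv t ht y hy := HasDerivWithinAt.fun_sum fun i hi => (H i hi).deriv t ht y hy

/-- The coefficients do not depend on time, so `∂_t` passes through them. The linear differential
operators below are built from this rule, sums and `TD.fderiv`. -/
theorem TD.clm (H : TD J U f f') {L : Eu n → E →L[ℝ] F} (hL : ContDiffOn ℝ ∞ L U) :
    TD J U (fun t y => L y (f t y)) (fun t y => L y (f' t y)) where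
  smooth := (hL.comp contDiff_snd.contDiffOn fun _ hq => hq.2).clm_apply H.smooth
  deriv t ht y hy := (L y).hasFDerivAt.comp_hasDerivWithinAt t (H.deriv t ht y hy)

theorem TD.const_clm (H : TD J U f f') (L : E →L[ℝ] F) :
    TD J U (fun t y => L (f t y)) (fun t y => L (f' t y)) :=
  H.clm contDiffOn_const

theorem TD.of_apply_e {f f' : ℝ → Eu n → Eu n →L[ℝ] F}
    (H : ∀ i, TD J U (fun t y => f t y (e i)) (fun t y => f' t y (e i))) : TD J U f f' := by
  have key : ∀ A : Eu n →L[ℝ] F,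
      A = ∑ i, ContinuousLinearMap.smulRightL ℝ (Eu n) F (EuclideanSpace.proj i) (A (e i)) := by
    intro A
    ext v
    rw [clm_apply_eq_sum A v]
    simp
  exact (TD.sum fun i (_ : i ∈ Finset.univ) => (H i).const_clm
    (ContinuousLinearMap.smulRightL ℝ (Eu n) F (EuclideanSpace.proj i))).congr
    (fun t _ y _ => key _) (fun t _ y _ => key _)

/-- Both partial derivatives are components of the joint derivative `D` within `J ×ˢ U`, which is
smooth; `∂_t ∂_y = ∂_y ∂_t` is the symmetry of the second derivative. Derivatives within the set are
needed because `J` may contain endpoints. -/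
theorem TD.time_fderiv (H : TD J U f f') (hJ : IsIv J) (hU : IsOpen U) :
    ContDiffOn ℝ ∞ (fun q : ℝ × Eu n => f' q.1 q.2) (J ×ˢ U) ∧
    TD J U (fun t y => fderiv ℝ (f t) y) (fun t y => fderiv ℝ (f' t) y) := by
  set S : Set (ℝ × Eu n) := J ×ˢ U
  set f₂ : ℝ × Eu n → E := fun q => f q.1 q.2
  have hS : UniqueDiffOn ℝ S := hJ.uniqueDiffOn.prod hU.uniqueDiffOn
  set D := fderivWithin ℝ f₂ S
  have hD : ContDiffOn ℝ ∞ D S := H.smooth.fderivWithin hS (by simp)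
  have hf2 : ∀ q ∈ S, HasFDerivWithinAt f₂ (D q) S q := fun q hq =>
    (H.smooth.differentiableOn (by simp) q hq).hasFDerivWithinAt
  have hD2 : ∀ q ∈ S, HasFDerivWithinAt D (fderivWithin ℝ D S q) S q := fun q hq =>
    (hD.differentiableOn (by simp) q hq).hasFDerivWithinAt
  have ht0 : ∀ t : ℝ, ∀ y : Eu n, HasDerivWithinAt (fun s : ℝ => (s, y)) ((1 : ℝ), (0 : Eu n)) J t :=
    fun t y => (hasDerivWithinAt_id t J).prodMk (hasDerivWithinAt_const t J y)
  have hy0 : ∀ t : ℝ, ∀ y : Eu n, HasFDerivWithinAt (fun z : Eu n => (t, z))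
      (ContinuousLinearMap.inr ℝ ℝ (Eu n)) U y :=
    fun t y => (hasFDerivAt_prodMk_right t y).hasFDerivWithinAt
  have hmaps' : ∀ y ∈ U, MapsTo (fun s : ℝ => (s, y)) J S := fun y hy s hs => mk_mem_prod hs hy
  have hf' : ∀ t ∈ J, ∀ y ∈ U, f' t y = D (t, y) (1, 0) := by
    intro t ht y hy
    have := (hf2 (t, y) ⟨ht, hy⟩).comp_hasDerivWithinAt t (ht0 t y) (hmaps' y hy)
    exact (hJ.uniqueDiffOn t ht).eq_deriv J (H.deriv t ht y hy) this
  have hmaps : ∀ t ∈ J, MapsTo (fun z : Eu n => (t, z)) U S := fun t ht z hz => mk_mem_prod ht hz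
  have hfy : ∀ t ∈ J, ∀ y ∈ U, fderiv ℝ (f t) y = (D (t, y)).comp
      (ContinuousLinearMap.inr ℝ ℝ (Eu n)) := fun t ht y hy =>
    (((hf2 (t, y) ⟨ht, hy⟩).comp y (hy0 t y) (hmaps t ht)).hasFDerivAt
      (hU.mem_nhds hy)).fderiv
  refine ⟨(hD.clm_apply contDiffOn_const).congr fun q hq => hf' q.1 hq.1 q.2 hq.2, ?_, ?_⟩
  · exact (hD.clm_comp contDiffOn_const).congr fun q hq => hfy q.1 hq.1 q.2 hq.2
  · intro t ht y hy
    have e1 : HasDerivWithinAt (fun s => (D (s, y)).comp (ContinuousLinearMap.inr ℝ ℝ (Eu n)))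
        ((fderivWithin ℝ D S (t, y) (1, 0)).comp (ContinuousLinearMap.inr ℝ ℝ (Eu n))) J t := by
      have := (hD2 (t, y) ⟨ht, hy⟩).comp_hasDerivWithinAt t (ht0 t y) (hmaps' y hy)
      exact ((ContinuousLinearMap.compL ℝ (Eu n) (ℝ × Eu n) E).flip
        (ContinuousLinearMap.inr ℝ ℝ (Eu n))).hasFDerivAt.comp_hasDerivWithinAt t this
    have e2 : fderiv ℝ (f' t) y =
        (fderivWithin ℝ D S (t, y) (1, 0)).comp (ContinuousLinearMap.inr ℝ ℝ (Eu n)) := by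
      have h3 := ((hD2 (t, y) ⟨ht, hy⟩).comp y (hy0 t y) (hmaps t ht)).hasFDerivAt
        (hU.mem_nhds hy)
      have h4 := h3.clm_apply (hasFDerivAt_const ((1 : ℝ), (0 : Eu n)) y)
      have h5 : f' t =ᶠ[𝓝 y] fun z => (D ∘ fun z => (t, z)) z ((1 : ℝ), (0 : Eu n)) := by
        filter_upwards [hU.mem_nhds hy] with z hz using hf' t ht z hz
      rw [h5.fderiv_eq, h4.fderiv]
      ext v
      have hsymm : IsSymmSndFDerivWithinAt ℝ f₂ S (t, y) := by
        refine (H.smooth (t, y) ⟨ht, hy⟩).isSymmSndFDerivWithinAt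
          (by simpa using WithTop.coe_le_coe.2 (le_top : (2 : ℕ∞) ≤ ⊤)) hS ?_ ⟨ht, hy⟩
        rw [interior_prod_eq, closure_prod_eq, hU.interior_eq]
        exact ⟨hJ.subset_closure_interior ht, subset_closure hy⟩
      simpa using hsymm.eq (0, v) (1, 0)
    rw [e2]
    exact e1.congr (fun s hs => hfy s hs y hy) (hfy t ht y hy)

theorem TD.fderiv (H : TD J U f f') (hJ : IsIv J) (hU : IsOpen U) :
    TD J U (fun t y => fderiv ℝ (f t) y) (fun t y => fderiv ℝ (f' t) y) :=
  (H.time_fderiv hJ hU).2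

theorem TD.slice_deriv (H : TD J U f f') (hJ : IsIv J) (hU : IsOpen U) {t : ℝ} (ht : t ∈ J) :
    ContDiffOn ℝ ∞ (f' t) U :=
  ContDiffOn.comp (g := fun q : ℝ × Eu n => f' q.1 q.2) (f := fun y : Eu n => (t, y))
    (H.time_fderiv hJ hU).1 (contDiff_const.prodMk contDiff_id).contDiffOn (fun _ hy => ⟨ht, hy⟩)

end

end

section

variable {n : ℕ} {M : Type*} [TopologicalSpace M] [ChartedSpace (Eu n) M] [IsManifold (𝓡 n) ∞ M]

/-! ### Differential operators in charts -/

theorem mdifferentiableAt_of_chart {p : M} {y : Eu n} (hy : y ∈ tgt p) {f : M → ℝ}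
    (hf : DifferentiableAt ℝ (fun z => f (ψ p z)) y) :
    MDifferentiableAt (𝓡 n) 𝓘(ℝ, ℝ) f (ψ p y) := by
  have h1 : MDifferentiableAt (𝓡 n) 𝓘(ℝ, Eu n) (extChartAt (𝓡 n) p) (ψ p y) :=
    (contMDiffAt_chart (ψ_mem_source hy)).mdifferentiableAt (by simp)
  have h2 : MDifferentiableAt 𝓘(ℝ, Eu n) 𝓘(ℝ, ℝ) (fun z => f (ψ p z))
      (extChartAt (𝓡 n) p (ψ p y)) := by
    rw [(extChartAt (𝓡 n) p).right_inv hy]; exact hf.mdifferentiableAt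
  refine (h2.comp (ψ p y) h1).congr_of_eventuallyEq ?_
  filter_upwards [(isOpen_extChartAt_source p).mem_nhds (ψ_mem_source hy)] with x hx
  simp only [Function.comp_apply]
  rw [show ψ p (extChartAt (𝓡 n) p x) = x from (extChartAt (𝓡 n) p).left_inv hx]

/-- The differential of a function in a chart. -/
theorem coordOne_d0 {p : M} {y : Eu n} (hy : y ∈ tgt p) {f : M → ℝ}
    (hf : DifferentiableAt ℝ (fun z => f (ψ p z)) y) :
    coordOne p (d0 f) y = fderiv ℝ (fun z => f (ψ p z)) y := by
  have h := mfderiv_comp y (mdifferentiableAt_of_chart hy hf)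
    ((contMDiffAt_ψ hy).mdifferentiableAt (by simp))
  rw [mfderiv_eq_fderiv] at h
  exact h.symm

theorem d0_apply {p : M} {f : M → ℝ} (hf : DifferentiableAt ℝ (fun z => f (ψ p z)) (pt (n := n) p))
    (v : TangentSpace (𝓡 n) p) :
    d0 f p v = fderiv ℝ (fun z => f (ψ p z)) (pt p) v := by
  rw [← coordOne_d0 (pt_mem_tgt p) hf, coordOne_pt]
  rfl

theorem d1_eq (α : OneForm n M) (p : M) : d1 α p = extE (coordOne p α) (pt p) := by
  show pullTwo (dφ p) _ = _
  rw [dφ_eq]; rfl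

theorem d1_alt (α : OneForm n M) (p : M) (v w : TangentSpace (𝓡 n) p) :
    d1 α p v w = -d1 α p w v := by
  rw [d1_eq]
  exact (neg_sub _ _).symm

variable (g : Metric n M)

theorem metric_inverse_coord {p : M} {y : Eu n} (hy : y ∈ tgt p) (l : Eu n →L[ℝ] ℝ) (i : Fin n) :
    (coordTwo p g.inner y).inverse l i = ∑ j, (gram g p y)⁻¹ i j * l (e j) := by
  set v := (coordTwo p g.inner y).inverse l
  have h1 : ∀ j, l (e j) = (gram g p y).mulVec v.ofLp j := fun j => by
    have : l (e j) = coordTwo p g.inner y (e j) v := by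
      rw [metric_symm, metric_apply_inverse g hy]
    rw [this, clm_apply_eq_sum (coordTwo p g.inner y (e j)) v, Matrix.mulVec, dotProduct]
    simp only [gram_apply, smul_eq_mul, mul_comm]
  simp only [h1]
  have h2 := (gram_posDef g hy).isUnit
  rw [Matrix.isUnit_iff_isUnit_det] at h2
  have h3 : (gram g p y)⁻¹.mulVec ((gram g p y).mulVec v.ofLp) = v.ofLp := by
    rw [Matrix.mulVec_mulVec, Matrix.nonsing_inv_mul _ h2, Matrix.one_mulVec]
  exact (congrFun h3 i).symm

theorem gram_inv_eq {p : M} {y : Eu n} (hy : y ∈ tgt p) (i j : Fin n) :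
    (gram g p y)⁻¹ i j = (coordTwo p g.inner y).inverse (EuclideanSpace.proj j) i := by
  rw [metric_inverse_coord g hy]
  simp [e]

theorem gram_inv_symm {p : M} {y : Eu n} (hy : y ∈ tgt p) (i j : Fin n) :
    (gram g p y)⁻¹ i j = (gram g p y)⁻¹ j i := by
  have h := (gram_posDef g hy).isHermitian.inv
  have := congrFun (congrFun h i) j
  simpa using this.symm

theorem contDiffOn_gram_inv (p : M) (i j : Fin n) :
    ContDiffOn ℝ ∞ (fun y => (gram g p y)⁻¹ i j) (tgt p) := by
  refine ContDiffOn.congr (f := fun y => (EuclideanSpace.proj i : Eu n →L[ℝ] ℝ)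
    ((coordTwo p g.inner y).inverse (EuclideanSpace.proj j))) ?_ fun y hy => gram_inv_eq g hy i j
  exact contDiffOn_const.clm_apply ((contDiffOn_metric_inverse g p).clm_apply contDiffOn_const)

/-- The codifferential of a one-form is minus the divergence of the dual vector field. -/
theorem δ1_eq (α : OneForm n M) : δ1 g α = -divg g (sharp g α) := by
  funext p
  refine congrArg (fun r : ℝ => -((density g p (pt p))⁻¹ * r)) ?_
  refine Finset.sum_congr rfl fun i _ => ?_
  refine congrArg (fun L : Eu n →L[ℝ] ℝ => L (e i)) (Filter.EventuallyEq.fderiv_eq ?_)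
  filter_upwards [tgt_mem_nhds (pt_mem_tgt p)] with z hz
  rw [coordVF_sharp g hz, metric_inverse_coord g hz]

theorem divg_eq_divE (X : VF n M) (p : M) :
    divg g X p = divE (density g p) (coordVF p X) (pt p) := rfl

/-- A product rule for the divergence of the contraction of an antisymmetric tensor. -/
theorem divE_contract {ρ : Eu n → ℝ} {P : Fin n → Fin n → Eu n → ℝ} {a : Fin n → Eu n → ℝ}
    {X : Eu n → Eu n} {y : Eu n} (hρ : DifferentiableAt ℝ ρ y) (h0 : ρ y ≠ 0)
    (hP : ∀ i j, DifferentiableAt ℝ (P i j) y) (ha : ∀ j, DifferentiableAt ℝ (a j) y)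
    (hX : ∀ᶠ z in 𝓝 y, ∀ i, X z i = -∑ j, P i j z * a j z) :
    divE ρ X y = ∑ j, a j y * -((ρ y)⁻¹ * ∑ i, fderiv ℝ (fun z => ρ z * P i j z) y (e i)) -
      ∑ i, ∑ j, P i j y * fderiv ℝ (a j) y (e i) := by
  have h1 : ∀ i, fderiv ℝ (fun z => ρ z * X z i) y (e i) = -∑ j,
      (a j y * fderiv ℝ (fun z => ρ z * P i j z) y (e i) +
        ρ y * (P i j y * fderiv ℝ (a j) y (e i))) := fun i => by
    have e1 : (fun z => ρ z * X z i) =ᶠ[𝓝 y] fun z => -∑ j, (ρ z * P i j z) * a j z := by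
      filter_upwards [hX] with z hz
      rw [hz, mul_neg, Finset.mul_sum]
      simp only [mul_assoc]
    have e2 : HasFDerivAt (fun z => -∑ j, (ρ z * P i j z) * a j z) _ y :=
      (HasFDerivAt.fun_sum fun j (_ : j ∈ Finset.univ) =>
        ((hρ.mul (hP i j)).hasFDerivAt.fun_mul (ha j).hasFDerivAt)).fun_neg
    rw [e1.fderiv_eq, e2.fderiv]
    simp only [neg_apply, sum_apply, add_apply, smul_apply, smul_eq_mul]
    congr 1
    refine Finset.sum_congr rfl fun j _ => ?_
    have : (ρ * P i j) = fun z => ρ z * P i j z := rfl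
    rw [this]
    ring
  unfold divE
  simp only [h1, Finset.sum_neg_distrib, Finset.sum_add_distrib, mul_neg]
  rw [Finset.sum_comm (f := fun i j => a j y * _)]
  simp only [← Finset.mul_sum, mul_add]
  rw [← mul_assoc, inv_mul_cancel₀ h0, one_mul, neg_add, sub_eq_add_neg]
  congr 2
  rw [Finset.mul_sum]
  refine Finset.sum_congr rfl fun j _ => ?_
  ring

theorem innerE_eq_sum (N : Matrix (Fin n) (Fin n) ℝ) (A B : Eu n →L[ℝ] Eu n →L[ℝ] ℝ) :
    innerE N A B = (1 / 2) *
      ∑ k, ∑ l, (∑ i, ∑ j, N i k * N j l * A (e i) (e j)) * B (e k) (e l) := by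
  rw [innerE]
  congr 1
  simp only [Finset.sum_mul]
  calc _ = ∑ i, ∑ k, ∑ j, ∑ l, N i k * N j l * A (e i) (e j) * B (e k) (e l) :=
        Finset.sum_congr rfl fun i _ => Finset.sum_comm
    _ = ∑ k, ∑ i, ∑ j, ∑ l, N i k * N j l * A (e i) (e j) * B (e k) (e l) := Finset.sum_comm
    _ = ∑ k, ∑ i, ∑ l, ∑ j, N i k * N j l * A (e i) (e j) * B (e k) (e l) :=
        Finset.sum_congr rfl fun k _ => Finset.sum_congr rfl fun i _ => Finset.sum_comm
    _ = _ := Finset.sum_congr rfl fun k _ => Finset.sum_comm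

/-- Against an antisymmetric tensor the two halves of `D k l - D l k` contribute equally, which
absorbs the factor `1 / 2` of `innerTwo`. -/
theorem half_sum_antisymm {P D : Fin n → Fin n → ℝ} (hP : ∀ i j, P i j = -P j i) :
    (1 / 2) * ∑ k, ∑ l, P k l * (D k l - D l k) = ∑ k, ∑ l, P k l * D k l := by
  have h : ∑ k, ∑ l, P k l * D l k = -∑ k, ∑ l, P k l * D k l := by
    rw [Finset.sum_comm, ← Finset.sum_neg_distrib]
    refine Finset.sum_congr rfl fun k _ => ?_
    rw [← Finset.sum_neg_distrib]
    refine Finset.sum_congr rfl fun l _ => ?_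
    rw [hP]; ring
  simp only [mul_sub, Finset.sum_sub_distrib, h]
  ring

/-- The codifferential of a two-form is the formal adjoint of the exterior derivative. -/
theorem δ2_apply {β : TwoTensor n M} {V : VF n M} {x : M}
    (hβ : DifferentiableAt ℝ (coordTwo x β) (pt x))
    (halt : ∀ z v w, β z v w = -β z w v)
    (hV : DifferentiableAt ℝ (coordVF x V) (pt x)) :
    δ2 g β x (V x) = innerTwo g β (d1 (flat g V)) x + divg g (sharp g (ι2 V β)) x := by
  have hx := pt_mem_tgt (n := n) x
  have hn := tgt_mem_nhds hx
  set N : Eu n → Matrix (Fin n) (Fin n) ℝ := fun z => (gram g x z)⁻¹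
  set B := coordTwo x β
  have hBalt : ∀ z v w, B z v w = -B z w v := fun z v w => halt _ _ _
  -- `P` is `β` with both indices raised, and `a` below consists of the components of `V♭`.
  set P : Fin n → Fin n → Eu n → ℝ := fun i j z => ∑ k, ∑ l, N z i k * N z j l * B z (e k) (e l)
  set a : Fin n → Eu n → ℝ := fun j z => coordOne x (flat g V) z (e j)
  have hG : DifferentiableAt ℝ (coordTwo x g.inner) (pt x) :=
    ((contDiffOn_metric g x).contDiffAt hn).differentiableAt (by simp)
  have hfl : coordOne x (flat g V) =ᶠ[𝓝 (pt x)] fun z => coordTwo x g.inner z (coordVF x V z) := by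
    filter_upwards [hn] with z hz using coordOne_flat g hz V
  have hα : DifferentiableAt ℝ (coordOne x (flat g V)) (pt x) :=
    (hG.clm_apply hV).congr_of_eventuallyEq hfl
  have ha : ∀ j, DifferentiableAt ℝ (a j) (pt x) := fun j =>
    hα.clm_apply (differentiableAt_const _)
  have hN : ∀ i j, DifferentiableAt ℝ (fun z => N z i j) (pt x) := fun i j =>
    ((contDiffOn_gram_inv g x i j).contDiffAt hn).differentiableAt (by simp)
  have hP : ∀ i j, DifferentiableAt ℝ (P i j) (pt x) := fun i j => by
    refine DifferentiableAt.fun_sum fun k _ => DifferentiableAt.fun_sum fun l _ => ?_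
    exact ((hN i k).mul (hN j l)).mul ((hβ.clm_apply (differentiableAt_const _)).clm_apply
      (differentiableAt_const _))
  have hPalt : ∀ i j z, P i j z = -P j i z := fun i j z => by
    simp only [P]
    rw [Finset.sum_comm, ← Finset.sum_neg_distrib]
    refine Finset.sum_congr rfl fun k _ => ?_
    rw [← Finset.sum_neg_distrib]
    refine Finset.sum_congr rfl fun l _ => ?_
    rw [hBalt]; ring
  -- Raising the index of `β(V, ·)` contracts the first index of `P` with `a`; antisymmetry moves
  -- the contraction to the second index at the price of a sign. In the divergence of this field,
  -- derivatives of `P` give `δβ(V)` and derivatives of `a` give `-⟨β, dV♭⟩`.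
  have hX : ∀ᶠ z in 𝓝 (pt x), ∀ i,
      coordVF x (sharp g (ι2 V β)) z i = -∑ j, P i j z * a j z := by
    filter_upwards [hn] with z hz i
    rw [coordVF_sharp g hz, metric_inverse_coord g hz, coordOne_ι2 hz]
    have hv : ∀ l, coordVF x V z l = ∑ j, N z l j * a j z := fun l => by
      rw [← metric_inverse_coord g hz, coordOne_flat g hz, metric_inverse_apply g hz]
    have h1 : ∀ k, N z i k * (B z (coordVF x V z) (e k)) =
        ∑ j, ∑ l, N z i k * N z l j * a j z * B z (e l) (e k) := fun k => by
      rw [clm_apply_eq_sum (B z) (coordVF x V z)]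
      simp only [sum_apply, smul_apply, hv, smul_eq_mul, Finset.sum_mul, Finset.mul_sum]
      rw [Finset.sum_comm]
      refine Finset.sum_congr rfl fun j _ => Finset.sum_congr rfl fun l _ => ?_
      ring
    calc _ = ∑ k, ∑ j, ∑ l, N z i k * N z l j * a j z * B z (e l) (e k) :=
          Finset.sum_congr rfl fun k _ => h1 k
      _ = ∑ j, ∑ k, ∑ l, N z i k * N z l j * a j z * B z (e l) (e k) := Finset.sum_comm
      _ = _ := by
        rw [← Finset.sum_neg_distrib]
        refine Finset.sum_congr rfl fun j _ => ?_
        simp only [P, Finset.sum_mul, ← Finset.sum_neg_distrib]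
        refine Finset.sum_congr rfl fun k _ => Finset.sum_congr rfl fun l _ => ?_
        rw [hBalt z (e l), show N z l j = N z j l from gram_inv_symm g hz l j]
        ring
  rw [divg_eq_divE, divE_contract (differentiableAt_density g hx) (density_pos g hx).ne' hP ha hX]
  set D : Fin n → Fin n → ℝ := fun i j => fderiv ℝ (coordOne x (flat g V)) (pt x) (e i) (e j)
  have hD : ∀ i j, fderiv ℝ (a j) (pt x) (e i) = D i j := fun i j => by
    rw [(hα.hasFDerivAt.clm_apply (hasFDerivAt_const (e j) _)).fderiv]
    simp [D]
  have hin : innerTwo g β (d1 (flat g V)) x = ∑ i, ∑ j, P i j (pt x) * D i j := by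
    have : innerTwo g β (d1 (flat g V)) x =
        innerE (N (pt x)) (B (pt x)) (coordTwo x (d1 (flat g V)) (pt x)) := rfl
    rw [this, coordTwo_d1 hx hα, innerE_eq_sum, ← half_sum_antisymm fun i j => hPalt i j _]
    congr 1
    refine Finset.sum_congr rfl fun k _ => Finset.sum_congr rfl fun l _ => ?_
    rw [extE_apply]
    congr 1
    refine Finset.sum_congr rfl fun i _ => Finset.sum_congr rfl fun j _ => ?_
    rw [show N (pt x) i k = N (pt x) k i from gram_inv_symm g hx i k,
      show N (pt x) j l = N (pt x) l j from gram_inv_symm g hx j l]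
  have hδ : δ2 g β x (V x) = ∑ j, δ2Coord g β x j * a j (pt x) := by
    have : δ2 g β x (V x) = coordTwo x g.inner (pt x) (δ2Coord g β x) (coordVF x V (pt x)) := by
      rw [coordVF_pt]
      show coordTwo x g.inner (pt x) (δ2Coord g β x) (dφ x (V x)) = _
      rw [dφ_eq]; rfl
    rw [this, clm_apply_eq_sum (coordTwo x g.inner (pt x)) (δ2Coord g β x)]
    simp only [sum_apply, smul_apply, smul_eq_mul, a, coordOne_flat g hx]
    refine Finset.sum_congr rfl fun j _ => ?_
    rw [metric_symm]
  simp only [hD]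
  rw [hin, hδ, add_sub_cancel]
  refine Finset.sum_congr rfl fun j _ => ?_
  rw [mul_comm]; rfl

end

section

variable {n : ℕ} {M : Type*} [TopologicalSpace M] [ChartedSpace (Eu n) M] [IsManifold (𝓡 n) ∞ M]

/-! ### Operators on time-dependent fields -/

theorem differentiableAt_clm_of_apply_e {F : Type*} [NormedAddCommGroup F] [NormedSpace ℝ F]
    {A : Eu n → Eu n →L[ℝ] F} {y : Eu n} (h : ∀ i, DifferentiableAt ℝ (fun z => A z (e i)) y) :
    DifferentiableAt ℝ A y := by
  have key : A = fun z => ∑ i,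
      ContinuousLinearMap.smulRightL ℝ (Eu n) F (EuclideanSpace.proj i) (A z (e i)) := by
    funext z
    ext v
    rw [clm_apply_eq_sum (A z) v]
    simp
  rw [key]
  exact DifferentiableAt.fun_sum fun i _ => (differentiableAt_const
    (ContinuousLinearMap.smulRightL ℝ (Eu n) F (EuclideanSpace.proj i))).clm_apply (h i)

theorem differentiableAt_coordTwo {q p : M} {y : Eu n} (hy : y ∈ tgt p)
    (hq : ψ p y ∈ (extChartAt (𝓡 n) q).source) {β : TwoTensor n M}
    (hβ : DifferentiableAt ℝ (coordTwo q β) (trans q p y)) :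
    DifferentiableAt ℝ (coordTwo p β) y := by
  have h1 := (contDiffAt_trans hy hq).differentiableAt (by simp)
  have h2 := differentiableAt_fderiv (contDiffAt_trans hy hq)
  have h4 : DifferentiableAt ℝ (fun z => coordTwo q β (trans q p z)) y :=
    DifferentiableAt.comp (F := Eu n) (G := Eu n →L[ℝ] Eu n →L[ℝ] ℝ) (g := coordTwo q β) y hβ h1
  refine DifferentiableAt.congr_of_eventuallyEq (f := fun z =>
    pullTwo (fderiv ℝ (trans q p) z) (coordTwo q β (trans q p z))) ?_ ?_
  · exact differentiableAt_clm_of_apply_e fun i => differentiableAt_clm_of_apply_e fun j =>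
      (h4.clm_apply (h2.clm_apply (differentiableAt_const (e i)))).clm_apply
        (h2.clm_apply (differentiableAt_const (e j)))
  · filter_upwards [eventually_source hy hq] with z hz
    rw [coordTwo_trans hz.1 hz.2 β]

/-- The vector field whose components in the chart at `p` are constant. -/
def constField (p : M) (v : Eu n) : VF n M := fun x => Dψ p (extChartAt (𝓡 n) p x) v

theorem coordVF_constField {p : M} {y : Eu n} (hy : y ∈ tgt p) (v : Eu n) :
    coordVF p (constField p v) y = v := by
  rw [coordVF_eq]
  show (Dψ p y).inverse (Dψ p (extChartAt (𝓡 n) p (ψ p y)) v) = v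
  rw [(extChartAt (𝓡 n) p).right_inv hy, Dψ_inverse_apply hy]

variable (g : Metric n M)

/-- The codifferential of a two-form in a chart. -/
theorem coordOne_δ2 {p : M} {y : Eu n} (hy : y ∈ tgt p) {β : TwoTensor n M}
    (hβ : ContDiffOn ℝ ∞ (coordTwo p β) (tgt p)) (halt : ∀ z v w, β z v w = -β z w v)
    (v : Eu n) :
    coordOne p (δ2 g β) y v =
      innerE (gram g p y)⁻¹ (coordTwo p β y) (extE (fun z => coordTwo p g.inner z v) y) +
      divE (density g p) (fun z => (coordTwo p g.inner z).inverse (coordTwo p β z v)) y := by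
  have hq := mem_extChartAt_source (I := 𝓡 n) (ψ p y)
  have hqp : ψ (ψ p y) (pt (n := n) (ψ p y)) ∈ (extChartAt (𝓡 n) p).source := by
    rw [ψ_pt]; exact ψ_mem_source hy
  have hty : trans p (ψ p y) (pt (n := n) (ψ p y)) = y := trans_trans hy hq
  have hd : DifferentiableAt ℝ (coordTwo p β) y :=
    (hβ.contDiffAt (tgt_mem_nhds hy)).differentiableAt (by simp)
  have hGd : DifferentiableAt ℝ (coordTwo p g.inner) y :=
    ((contDiffOn_metric g p).contDiffAt (tgt_mem_nhds hy)).differentiableAt (by simp)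
  have hGi : DifferentiableAt ℝ (fun z => (coordTwo p g.inner z).inverse) y :=
    ((contDiffOn_metric_inverse g p).contDiffAt (tgt_mem_nhds hy)).differentiableAt (by simp)
  have hV : coordVF p (constField p v) =ᶠ[𝓝 y] fun _ => v := by
    filter_upwards [tgt_mem_nhds hy] with z hz using coordVF_constField hz v
  have hVd : DifferentiableAt ℝ (coordVF p (constField p v)) y :=
    (differentiableAt_const v).congr_of_eventuallyEq hV
  have hfl : coordOne p (flat g (constField p v)) =ᶠ[𝓝 y] fun z => coordTwo p g.inner z v := by
    filter_upwards [tgt_mem_nhds hy] with z hz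
    rw [coordOne_flat g hz, coordVF_constField hz]
  have hsh : coordVF p (sharp g (ι2 (constField p v) β)) =ᶠ[𝓝 y]
      fun z => (coordTwo p g.inner z).inverse (coordTwo p β z v) := by
    filter_upwards [tgt_mem_nhds hy] with z hz
    rw [coordVF_sharp g hz, coordOne_ι2 hz, coordVF_constField hz]
  -- `δ2Coord` is never transformed between charts. Instead `δβ` is tested on the field with
  -- constant components `v` in the chart at `p`, and the right-hand side of `δ2_apply` involves
  -- only operators already known in every chart.
  have h1 := δ2_apply g (β := β) (V := constField p v) (x := ψ p y)
    (differentiableAt_coordTwo (pt_mem_tgt _) hqp (by rwa [hty])) halt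
    (differentiableAt_coordVF (pt_mem_tgt _) hqp (by rwa [hty]))
  have h2 : coordOne p (δ2 g β) y v = δ2 g β (ψ p y) (constField p v (ψ p y)) := by
    rw [← coordOne_coordVF hy, coordVF_constField hy]
  rw [h2, h1, innerTwo_eq g hy, coordTwo_d1 hy ?_, extE_congr hfl, divg_eq g hy ?_, divE_congr hsh]
  · exact (hGi.clm_apply (hd.clm_apply (differentiableAt_const v))).congr_of_eventuallyEq hsh
  · exact (hGd.clm_apply (differentiableAt_const v)).congr_of_eventuallyEq hfl

section TD
variable {E : Type*} [NormedAddCommGroup E] [NormedSpace ℝ E]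
  {J : Set ℝ} {U : Set (Eu n)}

theorem TD.smul {f f' : ℝ → Eu n → E} (H : TD J U f f') {c : Eu n → ℝ} (hc : ContDiffOn ℝ ∞ c U) :
    TD J U (fun t y => c y • f t y) (fun t y => c y • f' t y) :=
  H.clm (L := fun y => c y • ContinuousLinearMap.id ℝ E) (hc.smul contDiffOn_const)

theorem TD.divE {f f' : ℝ → Eu n → Eu n} (H : TD J U f f') (hJ : IsIv J) (hU : IsOpen U)
    {ρ : Eu n → ℝ} (hρ : ContDiffOn ℝ ∞ ρ U) (h0 : ∀ y ∈ U, ρ y ≠ 0) :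
    TD J U (fun t y => divE ρ (f t) y) (fun t y => divE ρ (f' t) y) := by
  refine (TD.sum (s := Finset.univ) fun i _ =>
    ((((H.const_clm (EuclideanSpace.proj i)).smul hρ).fderiv hJ hU).const_clm
      (ContinuousLinearMap.apply ℝ ℝ (e i)))).smul (hρ.inv h0)

theorem innerE_eq_clm (N : Matrix (Fin n) (Fin n) ℝ) (A B : Eu n →L[ℝ] Eu n →L[ℝ] ℝ) :
    innerE N A B = ∑ i, ∑ j, ((1 / 2) * ∑ k, ∑ l, N i k * N j l * B (e k) (e l)) •
      A (e i) (e j) := by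
  simp only [innerE, Finset.mul_sum, smul_eq_mul, Finset.sum_mul]
  refine Finset.sum_congr rfl fun i _ => Finset.sum_congr rfl fun j _ =>
    Finset.sum_congr rfl fun k _ => Finset.sum_congr rfl fun l _ => ?_
  ring

theorem TD.innerE {f f' : ℝ → Eu n → Eu n →L[ℝ] Eu n →L[ℝ] ℝ} (H : TD J U f f')
    {N : Eu n → Matrix (Fin n) (Fin n) ℝ} (hN : ∀ i j, ContDiffOn ℝ ∞ (fun y => N y i j) U)
    {B : Eu n → Eu n →L[ℝ] Eu n →L[ℝ] ℝ} (hB : ContDiffOn ℝ ∞ B U) :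
    TD J U (fun t y => innerE (N y) (f t y) (B y)) (fun t y => innerE (N y) (f' t y) (B y)) := by
  have h1 : ∀ i j, TD J U (fun t y => f t y (e i) (e j)) (fun t y => f' t y (e i) (e j)) :=
    fun i j => H.const_clm ((ContinuousLinearMap.apply ℝ ℝ (e j)).comp
      (ContinuousLinearMap.apply ℝ (Eu n →L[ℝ] ℝ) (e i)))
  have h2 : ∀ k l, ContDiffOn ℝ ∞ (fun y => B y (e k) (e l)) U := fun k l =>
    (hB.clm_apply contDiffOn_const).clm_apply contDiffOn_const
  have h3 : ∀ i j, ContDiffOn ℝ ∞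
      (fun y => (1 / 2) * ∑ k, ∑ l, N y i k * N y j l * B y (e k) (e l)) U := fun i j =>
    contDiffOn_const.mul (ContDiffOn.sum fun k _ => ContDiffOn.sum fun l _ =>
      ((hN i k).mul (hN j l)).mul (h2 k l))
  simp only [innerE_eq_clm]
  exact TD.sum fun i _ => TD.sum fun j _ => (h1 i j).smul (h3 i j)

/-- Antisymmetrization of bilinear forms. -/
def altL : (Eu n →L[ℝ] Eu n →L[ℝ] ℝ) →L[ℝ] (Eu n →L[ℝ] Eu n →L[ℝ] ℝ) :=
  ContinuousLinearMap.id ℝ _ - ((ContinuousLinearMap.flipₗᵢ ℝ (Eu n) (Eu n)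
    ℝ).toContinuousLinearEquiv : (Eu n →L[ℝ] Eu n →L[ℝ] ℝ) →L[ℝ] (Eu n →L[ℝ] Eu n →L[ℝ] ℝ))

end TD

variable (n) in
/-- Time-dependent functions that are jointly smooth in the chart at `p`. -/
abbrev TDF (J : Set ℝ) (p : M) (f f' : ℝ → M → ℝ) : Prop :=
  TD J (tgt (n := n) p) (fun t y => f t (ψ p y)) (fun t y => f' t (ψ p y))

/-- Time-dependent vector fields that are jointly smooth in the chart at `p`. -/
abbrev TDV (J : Set ℝ) (p : M) (X X' : ℝ → VF n M) : Prop :=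
  TD J (tgt p) (fun t => coordVF p (X t)) (fun t => coordVF p (X' t))

/-- Time-dependent one-forms that are jointly smooth in the chart at `p`. -/
abbrev TDO (J : Set ℝ) (p : M) (α α' : ℝ → OneForm n M) : Prop :=
  TD J (tgt p) (fun t => coordOne p (α t)) (fun t => coordOne p (α' t))

/-- Time-dependent two-tensors that are jointly smooth in the chart at `p`. -/
abbrev TDT (J : Set ℝ) (p : M) (β β' : ℝ → TwoTensor n M) : Prop :=
  TD J (tgt p) (fun t => coordTwo p (β t)) (fun t => coordTwo p (β' t))

variable {J : Set ℝ} {p : M}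

theorem diffAt_of_smooth {F : Type*} [NormedAddCommGroup F] [NormedSpace ℝ F] {f : Eu n → F}
    (hf : ContDiffOn ℝ ∞ f (tgt p)) {y : Eu n} (hy : y ∈ tgt p) : DifferentiableAt ℝ f y :=
  (hf.contDiffAt (tgt_mem_nhds hy)).differentiableAt (by simp)

theorem TDV.flat {X X' : ℝ → VF n M} (H : TDV J p X X') :
    TDO J p (fun t => flat g (X t)) (fun t => flat g (X' t)) :=
  (H.clm (contDiffOn_metric g p)).congr (fun _ _ _ hy => coordOne_flat g hy _)
    (fun _ _ _ hy => coordOne_flat g hy _)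

theorem TDO.sharp {α α' : ℝ → OneForm n M} (H : TDO J p α α') :
    TDV J p (fun t => sharp g (α t)) (fun t => sharp g (α' t)) :=
  (H.clm (contDiffOn_metric_inverse g p)).congr (fun _ _ _ hy => coordVF_sharp g hy _)
    (fun _ _ _ hy => coordVF_sharp g hy _)

theorem TDV.divg {X X' : ℝ → VF n M} (hJ : IsIv J) (H : TDV J p X X') :
    TDF n J p (fun t => divg g (X t)) (fun t => divg g (X' t)) :=
  (TD.divE H hJ (isOpen_tgt p) (contDiffOn_density g p) fun _ hy => (density_pos g hy).ne').congr
    (fun _ ht _ hy => divg_eq g hy (diffAt_of_smooth (H.slice ht) hy))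
    (fun _ ht _ hy => divg_eq g hy (diffAt_of_smooth (H.slice_deriv hJ (isOpen_tgt p) ht) hy))

theorem TDF.neg {f f' : ℝ → M → ℝ} (H : TDF n J p f f') :
    TDF n J p (fun t => -f t) (fun t => -f' t) :=
  (H.const_clm (-ContinuousLinearMap.id ℝ ℝ)).congr (fun _ _ _ _ => rfl) (fun _ _ _ _ => rfl)

theorem TDO.δ1 {α α' : ℝ → OneForm n M} (hJ : IsIv J) (H : TDO J p α α') :
    TDF n J p (fun t => δ1 g (α t)) (fun t => δ1 g (α' t)) := by
  simp only [δ1_eq]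
  exact TDF.neg (TDV.divg g hJ (TDO.sharp g H))

theorem TDF.d0 {f f' : ℝ → M → ℝ} (hJ : IsIv J) (H : TDF n J p f f') :
    TDO J p (fun t => d0 (n := n) (f t)) (fun t => d0 (f' t)) :=
  (TD.fderiv H hJ (isOpen_tgt p)).congr
    (fun _ ht _ hy => coordOne_d0 hy (diffAt_of_smooth (H.slice ht) hy))
    (fun _ ht _ hy => coordOne_d0 hy (diffAt_of_smooth (H.slice_deriv hJ (isOpen_tgt p) ht) hy))

theorem TDO.d1 {α α' : ℝ → OneForm n M} (hJ : IsIv J) (H : TDO J p α α') :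
    TDT J p (fun t => d1 (α t)) (fun t => d1 (α' t)) :=
  ((TD.fderiv H hJ (isOpen_tgt p)).const_clm altL).congr
    (fun _ ht _ hy => coordTwo_d1 hy (diffAt_of_smooth (H.slice ht) hy))
    (fun _ ht _ hy => coordTwo_d1 hy (diffAt_of_smooth (H.slice_deriv hJ (isOpen_tgt p) ht) hy))

theorem TDT.δ2 {β β' : ℝ → TwoTensor n M} (hJ : IsIv J) (H : TDT J p β β')
    (halt : ∀ t z v w, β t z v w = -β t z w v) (halt' : ∀ t z v w, β' t z v w = -β' t z w v) :
    TDO J p (fun t => δ2 g (β t)) (fun t => δ2 g (β' t)) := by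
  refine TD.of_apply_e fun i => ?_
  have hGe : ContDiffOn ℝ ∞ (fun z => coordTwo p g.inner z (e i)) (tgt p) :=
    (contDiffOn_metric g p).clm_apply contDiffOn_const
  have hB : ContDiffOn ℝ ∞ (extE fun z => coordTwo p g.inner z (e i)) (tgt p) := by
    have h1 := hGe.fderiv_of_isOpen (isOpen_tgt p) (m := ∞) (by simp)
    have h2 : ∀ v w : Eu n, ContDiffOn ℝ ∞
        (fun y => fderiv ℝ (fun z => coordTwo p g.inner z (e i)) y v w) (tgt p) := fun v w =>
      (h1.clm_apply contDiffOn_const).clm_apply contDiffOn_const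
    exact contDiffOn_clm_of_apply_e fun k => contDiffOn_clm_of_apply_e fun l =>
      (h2 (e k) (e l)).sub (h2 (e l) (e k))
  have h1 := TD.innerE H (fun i j => contDiffOn_gram_inv g p i j) hB
  have h2 := TD.divE ((H.const_clm (ContinuousLinearMap.apply ℝ (Eu n →L[ℝ] ℝ) (e i))).clm
    (contDiffOn_metric_inverse g p)) hJ (isOpen_tgt p) (contDiffOn_density g p)
    fun _ hy => (density_pos g hy).ne'
  exact (h1.add h2).congr (fun t ht y hy => coordOne_δ2 g hy (H.slice ht) (halt t) _)
    (fun t ht y hy => coordOne_δ2 g hy (H.slice_deriv hJ (isOpen_tgt p) ht) (halt' t) _)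

/-- Contains both the smoothness of `AX` and the identity `∂_t (AX) = A (∂_t X)`, which turns `A
u_t` into `m_t` in the EPDiff equation. -/
theorem TDV.inertia {X X' : ℝ → VF n M} (hJ : IsIv J) (H : TDV J p X X') (a b c : ℝ) :
    TDO J p (fun t => inertia g a b c (X t)) (fun t => inertia g a b c (X' t)) := by
  have h1 := TDV.flat g H
  have h2 := TDF.d0 hJ (TDO.δ1 g hJ h1)
  have h3 := TDT.δ2 g hJ (TDO.d1 hJ h1) (fun _ _ => d1_alt _ _) (fun _ _ => d1_alt _ _)
  exact (((h1.smul (contDiffOn_const (c := a))).add (h2.smul (contDiffOn_const (c := b)))).add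
    (h3.smul (contDiffOn_const (c := c)))).congr (fun _ _ _ _ => rfl) (fun _ _ _ _ => rfl)

end

section

/-! ### The Riemannian volume -/

section
variable {n : ℕ} {M : Type*} [TopologicalSpace M] [ChartedSpace (Eu n) M] [IsManifold (𝓡 n) ∞ M]
  [MeasurableSpace M] [BorelSpace M] (g : Metric n M)

/-- Continuity of `ψ p` is available only on the target of the chart, so measurability is obtained
on the subtype. -/
theorem measurableSet_chart (p : M) {A : Set M} (hA : MeasurableSet A) :
    MeasurableSet (tgt (n := n) p ∩ ψ p ⁻¹' A) := by
  have hc : ContinuousOn (ψ p) (tgt (n := n) p) := continuousOn_extChartAt_symm p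
  have h1 : Measurable ((tgt (n := n) p).domRestrict (ψ p)) :=
    (continuousOn_iff_continuous_domRestrict.1 hc).measurable
  have h2 := (isOpen_tgt (n := n) p).measurableSet.subtype_image (h1 hA)
  convert h2 using 1
  ext y
  simp [Set.domRestrict_apply, and_comm]

theorem aemeasurable_ψ (p : M) : AEMeasurable (ψ (n := n) p)
    ((volume.restrict (tgt p)).withDensity (fun y => ENNReal.ofReal (density g p y))) :=
  ((continuousOn_extChartAt_symm p : ContinuousOn (ψ (n := n) p) (tgt p)).aemeasurable
    (isOpen_tgt p).measurableSet).mono_ac (withDensity_absolutelyContinuous _ _)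

theorem chartVol_apply (p : M) {A : Set M} (hA : MeasurableSet A) :
    chartVol g p A = ∫⁻ y in tgt p ∩ ψ p ⁻¹' A, ENNReal.ofReal (density g p y) := by
  have h1 : NullMeasurableSet (ψ p ⁻¹' A) (volume.restrict (tgt (n := n) p)) := by
    have := (continuousOn_extChartAt_symm p : ContinuousOn (ψ (n := n) p) (tgt p)).aemeasurable
      (μ := volume) (isOpen_tgt p).measurableSet
    exact this.nullMeasurableSet_preimage hA
  rw [chartVol, Measure.map_apply_of_aemeasurable (aemeasurable_ψ g p) hA,
    withDensity_apply₀ _ (h1)]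
  rw [Measure.restrict_restrict₀ h1, inter_comm]

theorem chartVol_inter_source (p : M) {A : Set M} (hA : MeasurableSet A) :
    chartVol g p (A ∩ (extChartAt (𝓡 n) p).source) = chartVol g p A := by
  rw [chartVol_apply g p hA,
    chartVol_apply g p (hA.inter (isOpen_extChartAt_source p).measurableSet)]
  congr 2
  ext y
  simp only [mem_inter_iff, mem_preimage]
  exact ⟨fun h => ⟨h.1, h.2.1⟩, fun h => ⟨h.1, h.2, ψ_mem_source h.1⟩⟩

/-- Change of variables along the transition map; its Jacobian is exactly the ratio of the
densities. -/
theorem chartVol_eq (p q : M) {A : Set M} (hA : MeasurableSet A)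
    (hp : A ⊆ (extChartAt (𝓡 n) p).source) (hq : A ⊆ (extChartAt (𝓡 n) q).source) :
    chartVol g p A = chartVol g q A := by
  rw [chartVol_apply g p hA, chartVol_apply g q hA]
  have himg : trans q p '' (tgt p ∩ ψ p ⁻¹' A) = tgt (n := n) q ∩ ψ q ⁻¹' A := by
    ext z
    constructor
    · rintro ⟨y, ⟨hy, hyA⟩, rfl⟩
      refine ⟨trans_mem (hq hyA), ?_⟩
      rw [mem_preimage, ψ_trans (hq hyA)]
      exact hyA
    · rintro ⟨hz, hzA⟩
      refine ⟨trans p q z, ⟨trans_mem (hp hzA), ?_⟩, trans_trans hz (hp hzA)⟩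
      rw [mem_preimage, ψ_trans (hp hzA)]
      exact hzA
  rw [← himg, lintegral_image_eq_lintegral_abs_det_fderiv_mul volume (measurableSet_chart p hA)
    (f' := fun y => fderiv ℝ (trans q p) y)]
  · refine setLIntegral_congr_fun (measurableSet_chart p hA) fun y hy => ?_
    rw [density_trans g hy.1 (hq hy.2), ENNReal.ofReal_mul (abs_nonneg _)]
  · intro y hy
    exact ((contDiffAt_trans hy.1 (hq hy.2)).differentiableAt
      (by simp)).hasFDerivAt.hasFDerivWithinAt
  · intro y hy z hz h
    rw [← trans_trans hy.1 (hq hy.2), h, trans_trans hz.1 (hq hz.2)]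

/-- The point `p` serves to make the family nonempty, so that it can be enumerated by `ℕ`. -/
theorem exists_countable_atlas [CompactSpace M] (p : M) :
    ∃ q : ℕ → M, ⋃ k, (extChartAt (𝓡 n) (q k)).source = univ := by
  obtain ⟨s, hs, hU⟩ := countable_cover_nhds (X := M)
    (fun x => extChartAt_source_mem_nhds (I := 𝓡 n) x)
  have hne : s.Nonempty := by
    by_contra h
    rw [not_nonempty_iff_eq_empty] at h
    have : p ∈ (univ : Set M) := trivial
    rw [← hU, h] at this
    simp at this
  obtain ⟨q, rfl⟩ := hs.exists_eq_range hne
  refine ⟨q, ?_⟩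
  rw [← hU, biUnion_range]

theorem chartVol_le_vol (p : M) : chartVol g p ≤ vol g := le_iSup (fun p => chartVol g p) p

/-- On the domain of a chart, the volume is the one given by the density in this chart. -/
theorem vol_apply_of_subset [CompactSpace M] (p : M) {B : Set M} (hB : MeasurableSet B)
    (hp : B ⊆ (extChartAt (𝓡 n) p).source) : vol g B = chartVol g p B := by
  obtain ⟨q, hq⟩ := exists_countable_atlas (n := n) p
  set A := disjointed fun k => (extChartAt (𝓡 n) (q k)).source
  have hAm : ∀ k, MeasurableSet (A k) :=
    MeasurableSet.disjointed fun k => (isOpen_extChartAt_source (q k)).measurableSet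
  have hAs : ∀ k, A k ⊆ (extChartAt (𝓡 n) (q k)).source := fun k => disjointed_subset _ k
  have hAd : Pairwise (Function.onFun Disjoint A) := disjoint_disjointed _
  have hAU : ⋃ k, A k = univ := by rw [← hq]; exact iUnion_disjointed
  -- An explicit gluing over disjoint pieces of a countable atlas. It agrees with each `chartVol` on
  -- that chart's domain, hence is an upper bound of all of them, and so bounds the supremum `vol g`
  -- from above.
  set ν : Measure M := Measure.sum fun k => (chartVol g (q k)).restrict (A k)
  have hdec : ∀ (r : M) {C : Set M}, MeasurableSet C → C ⊆ (extChartAt (𝓡 n) r).source →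
      ν C = chartVol g r C := by
    intro r C hC hr
    have h1 : C = ⋃ k, C ∩ A k := by rw [← inter_iUnion, hAU, inter_univ]
    conv_rhs => rw [h1]
    rw [measure_iUnion (fun i j hij => (hAd hij).mono inter_subset_right inter_subset_right)
      (fun k => hC.inter (hAm k)), Measure.sum_apply _ hC]
    refine tsum_congr fun k => ?_
    rw [Measure.restrict_apply hC]
    exact chartVol_eq g (q k) r (hC.inter (hAm k)) (inter_subset_right.trans (hAs k))
      (inter_subset_left.trans hr)
  have hle : vol g ≤ ν := by
    refine iSup_le fun r => Measure.le_iff.2 fun C hC => ?_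
    rw [← chartVol_inter_source g r hC, ← hdec r
      (hC.inter (isOpen_extChartAt_source r).measurableSet) inter_subset_right]
    exact measure_mono inter_subset_left
  exact le_antisymm ((hle B).trans_eq (hdec p hB hp)) (chartVol_le_vol g p B)

theorem vol_restrict_source [CompactSpace M] (p : M) :
    (vol g).restrict (extChartAt (𝓡 n) p).source = chartVol g p := by
  ext B hB
  rw [Measure.restrict_apply hB, ← chartVol_inter_source g p hB]
  exact vol_apply_of_subset g p (hB.inter (isOpen_extChartAt_source p).measurableSet)
    inter_subset_right

/-- Integration in a chart. -/
theorem integral_vol_eq [CompactSpace M] (p : M) {f : M → ℝ} (hf : Continuous f)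
    (hs : ∀ x, x ∉ (extChartAt (𝓡 n) p).source → f x = 0) :
    ∫ x, f x ∂(vol g) = ∫ y in tgt p, density g p y * f (ψ p y) := by
  rw [← setIntegral_eq_integral_of_forall_compl_eq_zero hs, vol_restrict_source, chartVol,
    integral_map (aemeasurable_ψ g p) hf.aestronglyMeasurable,
    integral_withDensity_eq_integral_toReal_smul₀]
  · refine setIntegral_congr_fun (isOpen_tgt p).measurableSet fun y hy => ?_
    simp only [ENNReal.toReal_ofReal (density_pos g hy).le, smul_eq_mul]
  · exact ((contDiffOn_density g p).continuousOn.aemeasurable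
      (isOpen_tgt p).measurableSet).ennreal_ofReal
  · exact Filter.Eventually.of_forall fun _ => ENNReal.ofReal_lt_top

/-- The density is bounded on a closed ball inside a chart, so the measure is locally finite;
compactness does the rest. -/
theorem isFiniteMeasure_vol [CompactSpace M] : IsFiniteMeasure (vol g) := by
  have : IsLocallyFiniteMeasure (vol g) := by
    refine ⟨fun p => ?_⟩
    obtain ⟨r, hr, hrs⟩ := Metric.nhds_basis_closedBall.mem_iff.1 (tgt_mem_nhds (pt_mem_tgt (n := n) p))
    set U := (extChartAt (𝓡 n) p).source ∩ extChartAt (𝓡 n) p ⁻¹' Metric.ball (pt p) r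
    have hUo : IsOpen U := (continuousOn_extChartAt p).isOpen_inter_preimage
      (isOpen_extChartAt_source p) Metric.isOpen_ball
    refine ⟨U, hUo.mem_nhds ⟨mem_extChartAt_source p, Metric.mem_ball_self hr⟩, ?_⟩
    obtain ⟨C, hC⟩ := (isCompact_closedBall (pt p) r).bddAbove_image
      ((contDiffOn_density g p).continuousOn.mono hrs)
    rw [vol_apply_of_subset g p hUo.measurableSet inter_subset_left,
      chartVol_apply g p hUo.measurableSet]
    calc _ ≤ ∫⁻ y in Metric.closedBall (pt p) r, ENNReal.ofReal (density g p y) := by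
          refine lintegral_mono_set fun y hy => ?_
          have := hy.2.2
          rw [mem_preimage, (extChartAt (𝓡 n) p).right_inv hy.1] at this
          exact Metric.ball_subset_closedBall this
      _ ≤ ∫⁻ y in Metric.closedBall (pt p) r, ENNReal.ofReal C := by
          refine setLIntegral_mono' Metric.isClosed_closedBall.measurableSet fun y hy => ?_
          exact ENNReal.ofReal_le_ofReal (hC ⟨y, hy, rfl⟩)
      _ < ⊤ := by
          rw [setLIntegral_const]
          exact ENNReal.mul_lt_top ENNReal.ofReal_lt_top measure_closedBall_lt_top
  exact ⟨isCompact_univ.measure_lt_top⟩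

/-- Densities are positive. Used to pass from a vanishing integral of a continuous nonnegative
function to the function being zero. -/
theorem isOpenPosMeasure_vol : (vol g).IsOpenPosMeasure := by
  refine ⟨fun U hU ⟨p, hp⟩ h0 => ?_⟩
  have h1 : chartVol g p U = 0 := le_antisymm ((chartVol_le_vol g p U).trans_eq h0) zero_le
  rw [chartVol_apply g p hU.measurableSet] at h1
  set S := tgt (n := n) p ∩ ψ p ⁻¹' U
  have hSo : IsOpen S := (continuousOn_extChartAt_symm p).isOpen_inter_preimage (isOpen_tgt p) hU
  have hS : S.Nonempty := ⟨pt p, pt_mem_tgt p, by rw [mem_preimage, ψ_pt]; exact hp⟩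
  have hm : AEMeasurable (fun y => ENNReal.ofReal (density g p y)) (volume.restrict S) :=
    (((contDiffOn_density g p).continuousOn.mono inter_subset_left).aemeasurable
      hSo.measurableSet).ennreal_ofReal
  rw [lintegral_eq_zero_iff' hm, Filter.EventuallyEq, ae_restrict_iff' hSo.measurableSet] at h1
  have h2 : volume S = 0 := by
    refine measure_mono_null (t := {y | ¬(y ∈ S → ENNReal.ofReal (density g p y) = 0)})
      (fun y hy hy' => ?_) (ae_iff.1 h1)
    exact (density_pos g hy.1).not_ge (ENNReal.ofReal_eq_zero.1 (hy' hy))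
  exact (hSo.measure_pos volume hS).ne' h2

end

/-- Integration by parts against the constant function `1`. -/
theorem integral_fderiv_eq_zero {n : ℕ} {f : Eu n → ℝ} (hf : ContDiff ℝ 1 f)
    (hc : HasCompactSupport f) (v : Eu n) : ∫ y, fderiv ℝ f y v = 0 := by
  have h1 : Integrable (fun y => fderiv ℝ f y v) :=
    (((hf.continuous_fderiv one_ne_zero).clm_apply continuous_const).integrable_of_hasCompactSupport
      (hc.fderiv_apply ℝ v))
  have := integral_mul_fderiv_eq_neg_fderiv_mul_of_integrable (μ := (volume : Measure (Eu n)))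
    (f := fun _ => (1 : ℝ)) (g := f) (v := v) (by simp) (by simpa using h1)
    (by simpa using hf.continuous.integrable_of_hasCompactSupport hc)
    (fun _ _ => differentiableAt_const _) (fun x _ => hf.differentiable one_ne_zero x)
  simpa using this

end

section

variable {n : ℕ} {M : Type*} [TopologicalSpace M] [ChartedSpace (Eu n) M] [IsManifold (𝓡 n) ∞ M]

/-! ### Smooth functions, fields and forms -/

variable (n) in
/-- Functions that are smooth in all preferred charts. -/
def SmF (f : M → ℝ) : Prop := ∀ p, ContDiffOn ℝ ∞ (fun y => f (ψ (n := n) p y)) (tgt p)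

/-- Vector fields that are smooth in all preferred charts. -/
def SmV (X : VF n M) : Prop := ∀ p, ContDiffOn ℝ ∞ (coordVF p X) (tgt p)

/-- One-forms that are smooth in all preferred charts. -/
def SmO (α : OneForm n M) : Prop := ∀ p, ContDiffOn ℝ ∞ (coordOne p α) (tgt p)

theorem smV_iff {X : VF n M} : SmV X ↔ SmoothVF X :=
  ⟨smoothVF_of_coordVF, contDiffOn_coordVF⟩

/-- A fixed field is a family with zero time derivative. Smoothness of every operator on fixed
fields is then the slice at time `0` of its time-dependent version. -/
theorem SmV.td {X : VF n M} (hX : SmV X) (p : M) : TDV univ p (fun _ => X) (fun _ => 0) :=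
  (TD.const (hX p)).congr (fun _ _ _ _ => rfl) (fun _ _ y _ => (Dψ p y).inverse.map_zero)

theorem SmO.td {α : OneForm n M} (hα : SmO α) (p : M) : TDO univ p (fun _ => α) (fun _ => 0) :=
  (TD.const (hα p)).congr (fun _ _ _ _ => rfl) (fun _ _ _ _ => rfl)

theorem SmF.td {f : M → ℝ} (hf : SmF n f) (p : M) : TDF n univ p (fun _ => f) (fun _ => 0) :=
  (TD.const (hf p)).congr (fun _ _ _ _ => rfl) (fun _ _ _ _ => rfl)

theorem SmF.diff {f : M → ℝ} (hf : SmF n f) {p : M} {y : Eu n} (hy : y ∈ tgt p) :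
    DifferentiableAt ℝ (fun y => f (ψ p y)) y := diffAt_of_smooth (hf p) hy

theorem SmV.diff {X : VF n M} (hX : SmV X) {p : M} {y : Eu n} (hy : y ∈ tgt p) :
    DifferentiableAt ℝ (coordVF p X) y := diffAt_of_smooth (hX p) hy

theorem SmO.diff {α : OneForm n M} (hα : SmO α) {p : M} {y : Eu n} (hy : y ∈ tgt p) :
    DifferentiableAt ℝ (coordOne p α) y := diffAt_of_smooth (hα p) hy

theorem SmF.continuous {f : M → ℝ} (hf : SmF n f) : Continuous f := by
  rw [continuous_iff_continuousAt]
  intro x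
  have h1 : ContinuousAt (fun y => f (ψ (n := n) x y)) (extChartAt (𝓡 n) x x) :=
    (hf.diff (pt_mem_tgt x)).continuousAt
  refine (h1.comp (f := extChartAt (𝓡 n) x) (continuousAt_extChartAt x)).congr ?_
  filter_upwards [extChartAt_source_mem_nhds (I := 𝓡 n) x] with z hz
  simp only [Function.comp_apply]
  rw [show ψ (n := n) x (extChartAt (𝓡 n) x z) = z from (extChartAt (𝓡 n) x).left_inv hz]

theorem SmF.d0 {f : M → ℝ} (hf : SmF n f) : SmO (d0 f : OneForm n M) := fun p =>
  (TDF.d0 isIv_univ (hf.td p)).slice (mem_univ 0)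

theorem SmO.ι1 {α : OneForm n M} (hα : SmO α) {X : VF n M} (hX : SmV X) : SmF n (ι1 X α) :=
  fun p => ((hα p).clm_apply (hX p)).congr fun _ hy => (coordOne_coordVF hy α X).symm

theorem SmO.ι2_d1 {α : OneForm n M} (hα : SmO α) {X : VF n M} (hX : SmV X) :
    SmO (ι2 X (d1 α)) := fun p =>
  (((TDO.d1 isIv_univ (hα.td p)).slice (mem_univ 0)).clm_apply (hX p)).congr
    fun _ hy => coordOne_ι2 hy _ _

theorem SmO.add {α β : OneForm n M} (hα : SmO α) (hβ : SmO β) : SmO (α + β) := fun p =>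
  (hα p).add (hβ p)

theorem SmO.neg {α : OneForm n M} (hα : SmO α) : SmO (-α) := fun p => (hα p).neg

theorem SmO.smul {α : OneForm n M} (hα : SmO α) {f : M → ℝ} (hf : SmF n f) : SmO (f • α) :=
  fun p => (hf p).smul (hα p)

theorem SmV.smul {X : VF n M} (hX : SmV X) {f : M → ℝ} (hf : SmF n f) : SmV (f • X) :=
  fun p => ((hf p).smul (hX p)).congr fun _ _ => coordVF_smul _ _ _ _

variable (g : Metric n M)

theorem SmV.flat {X : VF n M} (hX : SmV X) : SmO (flat g X) := fun p =>
  (TDV.flat g (hX.td p)).slice (mem_univ 0)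

theorem SmO.sharp {α : OneForm n M} (hα : SmO α) : SmV (sharp g α) := fun p =>
  (TDO.sharp g (hα.td p)).slice (mem_univ 0)

theorem SmV.divg {X : VF n M} (hX : SmV X) : SmF n (divg g X) := fun p =>
  (TDV.divg g isIv_univ (hX.td p)).slice (mem_univ 0)

theorem SmO.δ1 {α : OneForm n M} (hα : SmO α) : SmF n (δ1 g α) := fun p =>
  (TDO.δ1 g isIv_univ (hα.td p)).slice (mem_univ 0)

theorem SmO.δ2_d1 {α : OneForm n M} (hα : SmO α) : SmO (δ2 g (d1 α)) := fun p =>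
  (TDT.δ2 g isIv_univ (TDO.d1 isIv_univ (hα.td p)) (fun _ _ => d1_alt _ _)
    (fun _ _ => d1_alt _ _)).slice (mem_univ 0)

theorem SmV.inertia {X : VF n M} (hX : SmV X) (a b c : ℝ) : SmO (inertia g a b c X) := fun p =>
  (TDV.inertia g isIv_univ (hX.td p) a b c).slice (mem_univ 0)

/-! ### The divergence theorem -/

theorem tr_add (A B : Eu n →L[ℝ] Eu n) : tr (A + B) = tr A + tr B := by simp [tr]

theorem divE_sum {ι : Type*} (s : Finset ι) {ρ : Eu n → ℝ} {X : ι → Eu n → Eu n} {y : Eu n}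
    (hρ : DifferentiableAt ℝ ρ y) (h0 : ρ y ≠ 0) (hX : ∀ i ∈ s, DifferentiableAt ℝ (X i) y) :
    divE ρ (fun z => ∑ i ∈ s, X i z) y = ∑ i ∈ s, divE ρ (X i) y := by
  rw [divE_eq hρ h0 (DifferentiableAt.fun_sum hX), fderiv_fun_sum hX]
  rw [Finset.sum_congr rfl fun i hi => divE_eq hρ h0 (hX i hi), Finset.sum_add_distrib,
    ← Finset.mul_sum, map_sum]
  congr 1
  simp only [tr_eq_sum, sum_apply]
  rw [Finset.sum_comm]
  refine Finset.sum_congr rfl fun i _ => ?_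
  simp

theorem divE_smul {ρ f : Eu n → ℝ} {X : Eu n → Eu n} {y : Eu n} (hρ : DifferentiableAt ℝ ρ y)
    (h0 : ρ y ≠ 0) (hf : DifferentiableAt ℝ f y) (hX : DifferentiableAt ℝ X y) :
    divE ρ (fun z => f z • X z) y = f y * divE ρ X y + fderiv ℝ f y (X y) := by
  rw [divE_eq hρ h0 (hf.fun_smul hX), divE_eq hρ h0 hX, (hf.hasFDerivAt.fun_smul hX.hasFDerivAt).fderiv,
    tr_add, clm_apply_eq_sum (fderiv ℝ f y) (X y)]
  have h1 : tr (f y • fderiv ℝ X y) = f y * tr (fderiv ℝ X y) := by simp [tr]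
  have h2 : tr ((fderiv ℝ f y).smulRight (X y)) = ∑ i, X y i • fderiv ℝ f y (e i) := by
    rw [tr_eq_sum]
    simp [mul_comm]
  rw [h1, h2, map_smul, smul_eq_mul]
  ring

theorem divg_smul {f : M → ℝ} (hf : SmF n f) {X : VF n M} (hX : SmV X) (p : M) :
    divg g (f • X) p = f p * divg g X p + d0 f p (X p) := by
  have hp := pt_mem_tgt (n := n) p
  have h1 : coordVF p (f • X) = fun y => f (ψ p y) • coordVF p X y :=
    funext fun y => coordVF_smul p f X y
  rw [divg_eq_divE, h1, divE_smul (f := fun y => f (ψ p y)) (differentiableAt_density g hp)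
    (density_pos g hp).ne' (hf.diff hp) (hX.diff hp), d0_apply (hf.diff hp), ψ_pt,
    divg_eq_divE, ← coordVF_pt p X]

variable [CompactSpace M] [MeasurableSpace M] [BorelSpace M]

theorem SmF.integrable {f : M → ℝ} (hf : SmF n f) : Integrable f (vol g) := by
  have := isFiniteMeasure_vol g
  exact hf.continuous.integrable_of_hasCompactSupport (HasCompactSupport.of_compactSpace f)

/-- In the chart, `√det g · X^i` extended by zero is a compactly supported `C¹` function on `Eu n`,
and `div X dμ` is the sum of its partial derivatives times Lebesgue measure. -/
theorem integral_divg_of_support {X : VF n M} (hX : SmV X) {p : M} {K : Set M} (hK : IsClosed K)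
    (hKp : K ⊆ (extChartAt (𝓡 n) p).source) (hXK : ∀ x, x ∉ K → X x = 0) :
    ∫ x, divg g X x ∂(vol g) = 0 := by
  set K' : Set (Eu n) := extChartAt (𝓡 n) p '' K
  have hK' : IsCompact K' := hK.isCompact.image_of_continuousOn
    ((continuousOn_extChartAt p).mono hKp)
  have hK't : K' ⊆ tgt p := by
    rintro _ ⟨x, hx, rfl⟩
    exact (extChartAt (𝓡 n) p).map_source (hKp hx)
  have hz : ∀ y ∈ tgt p, y ∉ K' → coordVF p X y = 0 := fun y hy hyK => by
    rw [coordVF_eq]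
    have : (show M → Eu n from X) (ψ p y) = 0 := hXK _ fun h =>
      hyK ⟨ψ p y, h, (extChartAt (𝓡 n) p).right_inv hy⟩
    rw [this, map_zero]
  set F : Fin n → Eu n → ℝ := fun i => (tgt p).indicator fun y => density g p y * coordVF p X y i
  have hF0 : ∀ i y, y ∉ K' → F i y = 0 := fun i y hy => by
    simp only [F]
    by_cases h : y ∈ tgt p
    · rw [indicator_of_mem h, hz y h hy]; simp
    · rw [indicator_of_notMem h]
  have hFev : ∀ i, ∀ y ∈ tgt p, F i =ᶠ[𝓝 y] fun y => density g p y * coordVF p X y i :=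
    fun i y hy => by
      filter_upwards [tgt_mem_nhds hy] with z hz
      exact indicator_of_mem hz _
  have hFev0 : ∀ i, ∀ y ∉ tgt p, F i =ᶠ[𝓝 y] fun _ => 0 := fun i y hy => by
    filter_upwards [hK'.isClosed.isOpen_compl.mem_nhds fun h => hy (hK't h)] with z hz
    exact hF0 i z hz
  have hF : ∀ i, ContDiff ℝ 1 (F i) := fun i => by
    rw [contDiff_iff_contDiffAt]
    intro y
    by_cases hy : y ∈ tgt p
    · have h1 : ContDiffOn ℝ ∞ (fun y => density g p y * coordVF p X y i) (tgt p) :=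
        (contDiffOn_density g p).mul ((contDiffOn_const
          (c := (EuclideanSpace.proj i : Eu n →L[ℝ] ℝ))).clm_apply (hX p))
      exact ((h1.contDiffAt (tgt_mem_nhds hy)).of_le (by simp)).congr_of_eventuallyEq
        (hFev i y hy)
    · exact contDiffAt_const.congr_of_eventuallyEq (hFev0 i y hy)
  have hFc : ∀ i, HasCompactSupport (F i) := fun i => HasCompactSupport.intro hK' (hF0 i)
  -- Off the chart domain `X` vanishes on a whole neighbourhood, since `K` is closed; so its
  -- derivatives vanish too and the integral may be taken in the chart.
  have hoff : ∀ x, x ∉ (extChartAt (𝓡 n) p).source → divg g X x = 0 := fun x hx => by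
    have h1 : coordVF x X =ᶠ[𝓝 (pt x)] fun _ => 0 := by
      have h2 : ContinuousAt (ψ (n := n) x) (pt x) := continuousAt_ψ (pt_mem_tgt x)
      have h3 : Kᶜ ∈ 𝓝 (ψ (n := n) x (pt x)) := by
        rw [ψ_pt]; exact hK.isOpen_compl.mem_nhds fun h => hx (hKp h)
      filter_upwards [h2.eventually h3] with y hy
      rw [coordVF_eq]
      have : (show M → Eu n from X) (ψ x y) = 0 := hXK _ hy
      rw [this, map_zero]
    rw [divg_eq_divE, divE_congr h1]
    simp [divE]
  rw [integral_vol_eq g p (hX.divg g).continuous hoff]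
  have h4 : ∫ y in tgt p, density g p y * divg g X (ψ p y) =
      ∫ y in tgt p, ∑ i, fderiv ℝ (F i) y (e i) := by
    refine setIntegral_congr_fun (isOpen_tgt p).measurableSet fun y hy => ?_
    rw [divg_eq g hy (hX.diff hy), divE, ← mul_assoc, mul_inv_cancel₀ (density_pos g hy).ne',
      one_mul]
    refine Finset.sum_congr rfl fun i _ => ?_
    rw [(hFev i y hy).fderiv_eq]
  rw [h4, setIntegral_eq_integral_of_forall_compl_eq_zero, integral_finsetSum]
  · exact Finset.sum_eq_zero fun i _ => integral_fderiv_eq_zero (hF i) (hFc i) _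
  · intro i _
    exact (((hF i).continuous_fderiv one_ne_zero).clm_apply
      continuous_const).integrable_of_hasCompactSupport ((hFc i).fderiv_apply ℝ _)
  · intro y hy
    refine Finset.sum_eq_zero fun i _ => ?_
    rw [(hFev0 i y hy).fderiv_eq]
    simp

variable [T2Space M]

/-- The divergence theorem on a closed manifold. -/
theorem integral_divg {X : VF n M} (hX : SmV X) : ∫ x, divg g X x ∂(vol g) = 0 := by
  -- A finite subcover by chart domains and a partition of unity subordinate to it split `X` into a
  -- finite sum of fields, each supported in one chart.
  obtain ⟨t, ht⟩ := CompactSpace.elim_nhds_subcover _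
    (fun x : M => extChartAt_source_mem_nhds (I := 𝓡 n) x)
  obtain ⟨f, hf⟩ := SmoothPartitionOfUnity.exists_isSubordinate (𝓡 n) (isClosed_univ (X := M))
    (fun i : t => (extChartAt (𝓡 n) (i : M)).source) (fun i => isOpen_extChartAt_source _)
    (by
      intro x _
      have hx : x ∈ ⋃ y ∈ t, (extChartAt (𝓡 n) y).source := by rw [ht]; trivial
      simp only [mem_iUnion] at hx ⊢
      obtain ⟨y, hy, hxy⟩ := hx
      exact ⟨⟨y, hy⟩, hxy⟩)
  have hfs : ∀ i, SmF n (f i) := fun i p => contMDiffOn_iff_contDiffOn.1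
    ((f i).contMDiff.comp_contMDiffOn (contMDiffOn_extChartAt_symm p))
  have hY : ∀ i, SmV ((f i : M → ℝ) • X) := fun i => hX.smul (hfs i)
  have hsum : ∀ p, divg g X p = ∑ i, divg g ((f i : M → ℝ) • X) p := fun p => by
    have hp := pt_mem_tgt (n := n) p
    have h1 : coordVF p X = fun y => ∑ i, coordVF p ((f i : M → ℝ) • X) y := by
      funext y
      simp only [coordVF_smul]
      rw [← Finset.sum_smul]
      have := f.sum_eq_one (mem_univ (ψ p y))
      rw [finsum_eq_sum_of_fintype] at this
      rw [this, one_smul]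
    rw [divg_eq_divE, h1, divE_sum _ (differentiableAt_density g hp) (density_pos g hp).ne'
      fun i _ => (hY i).diff hp]
    rfl
  simp only [hsum]
  rw [integral_finsetSum _ fun i _ => ((hY i).divg g).integrable g]
  refine Finset.sum_eq_zero fun i _ => integral_divg_of_support g (hY i) (isClosed_tsupport (f i))
    (hf i) fun x hx => ?_
  have : f i x = 0 := image_eq_zero_of_notMem_tsupport hx
  show f i x • X x = 0
  rw [this, zero_smul]

end

section

variable {n : ℕ} {M : Type*} [TopologicalSpace M] [ChartedSpace (Eu n) M] [IsManifold (𝓡 n) ∞ M]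

/-! ### Cartan calculus -/

/-- The bracket on a manifold is defined by pulling back to the preferred chart at `p`, whose
differential at `p` is the identity. -/
theorem mlieBracket_eq (X Y : VF n M) (p : M) :
    mlieBracket (𝓡 n) X Y p = fderiv ℝ (coordVF p Y) (pt p) (coordVF p X (pt p)) -
      fderiv ℝ (coordVF p X) (pt p) (coordVF p Y (pt p)) := by
  have h1 : ∀ Z : VF n M, mpullbackWithin 𝓘(ℝ, Eu n) (𝓡 n) (extChartAt (𝓡 n) p).symm Z
      (range (𝓡 n)) = coordVF p Z := fun Z => by
    funext y
    rw [mpullbackWithin_apply]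
    simp only [ModelWithCorners.range_eq_univ, mfderivWithin_univ]
    rfl
  have h3 : mlieBracket (𝓡 n) X Y p =
      (mfderiv (𝓡 n) 𝓘(ℝ, Eu n) (extChartAt (𝓡 n) p) p : Eu n →L[ℝ] Eu n).inverse
        (lieBracketWithin ℝ (E := Eu n)
          (mpullbackWithin 𝓘(ℝ, Eu n) (𝓡 n) (extChartAt (𝓡 n) p).symm X (range (𝓡 n)))
          (mpullbackWithin 𝓘(ℝ, Eu n) (𝓡 n) (extChartAt (𝓡 n) p).symm Y (range (𝓡 n)))
          ((extChartAt (𝓡 n) p).symm ⁻¹' univ ∩ range (𝓡 n)) (pt p)) := rfl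
  rw [h3, h1, h1]
  have h2 : (mfderiv (𝓡 n) 𝓘(ℝ, Eu n) (extChartAt (𝓡 n) p) p : Eu n →L[ℝ] Eu n) =
    ContinuousLinearMap.id ℝ (Eu n) := dφ_eq p
  simp only [ModelWithCorners.range_eq_univ, preimage_univ, inter_self, lieBracketWithin_univ]
  refine (congrArg (fun L : Eu n →L[ℝ] Eu n => L.inverse _) h2).trans ?_
  rw [ContinuousLinearMap.inverse_id]
  rfl

/-- Differential of `α(X)`. -/
theorem d0_ι1 {α : OneForm n M} (hα : SmO α) {X : VF n M} (hX : SmV X) (p : M) (v : Eu n) :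
    d0 (ι1 X α) p v = fderiv ℝ (coordOne p α) (pt p) v (X p) +
      α p (fderiv ℝ (coordVF p X) (pt p) v) := by
  have hp := pt_mem_tgt (n := n) p
  have h1 : (fun y => ι1 X α (ψ p y)) =ᶠ[𝓝 (pt p)] fun y => coordOne p α y (coordVF p X y) := by
    filter_upwards [tgt_mem_nhds hp] with y hy
    exact (coordOne_coordVF hy α X).symm
  refine (d0_apply ((hα.ι1 hX).diff hp) v).trans ?_
  rw [h1.fderiv_eq, ((hα.diff hp).hasFDerivAt.clm_apply (hX.diff hp).hasFDerivAt).fderiv]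
  simp only [add_apply, coordVF_pt, coordOne_pt]
  exact add_comm _ _

/-- Cartan's formula for the Lie derivative of a one-form. -/
theorem lieOne_eq {α : OneForm n M} (hα : SmO α) {X : VF n M} (hX : SmV X) :
    lieOne X α = ι2 X (d1 α) + d0 (ι1 X α) := by
  funext p
  ext v
  have h0 : lieOne X α p v = fderiv ℝ (coordOne p α) (pt p) (X p) v +
      α p (fderiv ℝ (coordVF p X) (pt p) v) := by
    show (fderiv ℝ (coordOne p α) (pt p) (coordVF p X (pt p)) +
      (coordOne p α (pt p)).comp (fderiv ℝ (coordVF p X) (pt p))) (dφ p v) = _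
    rw [dφ_eq, coordVF_pt, coordOne_pt]
    rfl
  have h1 : (ι2 X (d1 α) + d0 (ι1 X α) : OneForm n M) p v = d1 α p (X p) v + d0 (ι1 X α) p v := rfl
  have h2 : d1 α p (X p) v = fderiv ℝ (coordOne p α) (pt p) (X p) v -
      fderiv ℝ (coordOne p α) (pt p) v (X p) := by
    rw [d1_eq]; rfl
  have h3 : d0 (ι1 X α) p v = fderiv ℝ (coordOne p α) (pt p) v (X p) +
      α p (fderiv ℝ (coordVF p X) (pt p) v) := d0_ι1 hα hX p v
  linear_combination h0 - h1 - h2 - h3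

theorem d1_d0 {f : M → ℝ} (hf : SmF n f) : d1 (d0 f : OneForm n M) = 0 := by
  funext p
  have hp := pt_mem_tgt (n := n) p
  have h1 : coordOne p (d0 f : OneForm n M) =ᶠ[𝓝 (pt p)] fderiv ℝ fun y => f (ψ p y) := by
    filter_upwards [tgt_mem_nhds hp] with y hy
    exact coordOne_d0 hy (hf.diff hy)
  rw [d1_eq, extE_congr h1, extE_fderiv ((hf p).contDiffAt (tgt_mem_nhds hp))]
  rfl

theorem SmV.mlieBracket {X Y : VF n M} (hX : SmV X) (hY : SmV Y) :
    SmV (mlieBracket (𝓡 n) X Y) := by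
  rw [smV_iff] at *
  unfold SmoothVF at *
  have h2 : IsManifold (𝓡 n) (minSmoothness ℝ 2) M := .of_le (n := ∞) (by
    rw [minSmoothness_of_isRCLikeNormedField]
    simpa using WithTop.coe_le_coe.2 (le_top : (2 : ℕ∞) ≤ ⊤))
  have h3 : IsManifold (𝓡 n) ((⊤ : ℕ∞) + 1) M := ‹IsManifold (𝓡 n) ∞ M›
  exact ContDiff.mlieBracket_vectorField (m := ⊤) (n := ⊤) hX hY (by simp)

variable (g : Metric n M)

/-- Combines `X(α(Z)) = (𝓛_X α)(Z) + α([X, Z])` with `div(f X) = f div X + df(X)` for `f = α(Z)`. It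
exhibits `𝓛_X + div X` as the adjoint of `-[X, ·]` up to a divergence. -/
theorem cartan_divg {α : OneForm n M} (hα : SmO α) {X Z : VF n M} (hX : SmV X) (hZ : SmV Z)
    (p : M) :
    ι1 Z (ι2 X (d1 α) + d0 (ι1 X α) + divg g X • α) p =
      divg g (ι1 Z α • X) p - ι1 (mlieBracket (𝓡 n) X Z) α p := by
  rw [divg_smul g (hα.ι1 hZ) hX]
  have h1 : ι1 Z (ι2 X (d1 α) + d0 (ι1 X α) + divg g X • α) p =
    d1 α p (X p) (Z p) + d0 (ι1 X α) p (Z p) + divg g X p * α p (Z p) := rfl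
  have h2 : ι1 (mlieBracket (𝓡 n) X Z) α p = α p (fderiv ℝ (coordVF p Z) (pt p) (X p)) -
      α p (fderiv ℝ (coordVF p X) (pt p) (Z p)) := by
    rw [ι1, mlieBracket_eq, coordVF_pt, coordVF_pt]
    exact (α p).map_sub _ _
  have h3 : d1 α p (X p) (Z p) = fderiv ℝ (coordOne p α) (pt p) (X p) (Z p) -
      fderiv ℝ (coordOne p α) (pt p) (Z p) (X p) := by
    rw [d1_eq]; rfl
  have h4 : d0 (ι1 X α) p (Z p) = fderiv ℝ (coordOne p α) (pt p) (Z p) (X p) +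
      α p (fderiv ℝ (coordVF p X) (pt p) (Z p)) := d0_ι1 hα hX p (Z p)
  have h5 : d0 (ι1 Z α) p (X p) = fderiv ℝ (coordOne p α) (pt p) (X p) (Z p) +
      α p (fderiv ℝ (coordVF p Z) (pt p) (X p)) := d0_ι1 hα hZ p (X p)
  have h6 : ι1 Z α p = α p (Z p) := rfl
  linear_combination h1 + h2 + h3 + h4 - h5 - divg g X p * h6

/-! ### Integral identities -/

variable [CompactSpace M] [T2Space M] [MeasurableSpace M] [BorelSpace M]

theorem integral_cartan {α : OneForm n M} (hα : SmO α) {X Z : VF n M} (hX : SmV X) (hZ : SmV Z) :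
    ∫ x, ι1 Z (ι2 X (d1 α) + d0 (ι1 X α) + divg g X • α) x ∂(vol g) =
      -∫ x, ι1 (mlieBracket (𝓡 n) X Z) α x ∂(vol g) := by
  simp only [cartan_divg g hα hX hZ]
  rw [integral_sub, integral_divg g (hX.smul (hα.ι1 hZ)), zero_sub]
  · exact SmF.integrable g ((hX.smul (hα.ι1 hZ)).divg g)
  · exact SmF.integrable g (hα.ι1 (hX.mlieBracket hZ))

theorem integral_mul_divg {f : M → ℝ} (hf : SmF n f) {X : VF n M} (hX : SmV X) :
    ∫ x, f x * divg g X x ∂(vol g) = -∫ x, ι1 X (d0 f) x ∂(vol g) := by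
  have h1 : ∀ x, f x * divg g X x = divg g (f • X) x - ι1 X (d0 f) x := fun x => by
    rw [divg_smul g hf hX, ι1]; ring
  simp only [h1]
  rw [integral_sub, integral_divg g (hX.smul hf), zero_sub]
  · exact SmF.integrable g ((hX.smul hf).divg g)
  · exact SmF.integrable g (hf.d0.ι1 hX)

/-- By `δ2_apply` the function `⟨dα, dV♭⟩` is `(δdα)(V)` minus a divergence. Both are smooth, so
integrability comes from the same decomposition. -/
theorem integral_ι1_δ2 {α : OneForm n M} (hα : SmO α) {V : VF n M} (hV : SmV V) :
    Integrable (fun x => innerTwo g (d1 α) (d1 (flat g V)) x) (vol g) ∧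
    ∫ x, ι1 V (δ2 g (d1 α)) x ∂(vol g) =
      ∫ x, innerTwo g (d1 α) (d1 (flat g V)) x ∂(vol g) := by
  have hW : SmV (sharp g (ι2 V (d1 α))) := (hα.ι2_d1 hV).sharp g
  have h1 : ∀ x, innerTwo g (d1 α) (d1 (flat g V)) x =
      ι1 V (δ2 g (d1 α)) x - divg g (sharp g (ι2 V (d1 α))) x := fun x => by
    have h2 : DifferentiableAt ℝ (coordTwo x (d1 α)) (pt x) := diffAt_of_smooth
      ((TDO.d1 isIv_univ (hα.td x)).slice (mem_univ 0)) (pt_mem_tgt x)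
    rw [ι1, δ2_apply g h2 (d1_alt α) (hV.diff (pt_mem_tgt x)), add_sub_cancel_right]
  have h3 := SmF.integrable g ((hα.δ2_d1 g).ι1 hV)
  have h4 := SmF.integrable g (hW.divg g)
  simp only [h1]
  refine ⟨h3.sub h4, ?_⟩
  rw [integral_sub h3 h4, integral_divg g hW, sub_zero]

/-- `A` is the inertia operator of the `a`-`b`-`c` metric. -/
theorem abcInner_eq (a b c : ℝ) {u v : VF n M} (hu : SmV u) (hv : SmV v) :
    abcInner g a b c u v = ∫ x, ι1 v (inertia g a b c u) x ∂(vol g) := by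
  have hf := hu.flat g
  have hδ := hf.δ1 g
  have h1 : ∀ x, ι1 v (inertia g a b c u) x = a * innerVF g u v x +
      b * ι1 v (d0 (δ1 g (flat g u))) x + c * ι1 v (δ2 g (d1 (flat g u))) x := fun x => rfl
  have i1 : Integrable (innerVF g u v) (vol g) := SmF.integrable g (hf.ι1 hv)
  have i2 : Integrable (ι1 v (d0 (δ1 g (flat g u)))) (vol g) := SmF.integrable g (hδ.d0.ι1 hv)
  have i3 : Integrable (ι1 v (δ2 g (d1 (flat g u)))) (vol g) :=
    SmF.integrable g ((hf.δ2_d1 g).ι1 hv)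
  simp only [h1]
  have i12 : Integrable (fun x => a * innerVF g u v x + b * ι1 v (d0 (δ1 g (flat g u))) x)
      (vol g) := (i1.const_mul a).add (i2.const_mul b)
  rw [integral_add i12 (i3.const_mul c),
    integral_add (i1.const_mul a) (i2.const_mul b), integral_const_mul, integral_const_mul,
    integral_const_mul, (integral_ι1_δ2 g hf hv).2, abcInner]
  congr 3
  have h2 : δ1 g (flat g v) = -divg g v := by rw [δ1_eq, sharp_flat]
  simp only [h2, Pi.neg_apply, mul_neg]
  rw [integral_neg, integral_mul_divg g hδ hv, neg_neg]

/-- A smooth one-form that annihilates all smooth vector fields on average vanishes. -/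
theorem eq_zero_of_integral {α : OneForm n M} (hα : SmO α)
    (h : ∀ Z : VF n M, SmV Z → ∫ x, ι1 Z α x ∂(vol g) = 0) : α = 0 := by
  have := isFiniteMeasure_vol g
  have := isOpenPosMeasure_vol g
  -- The test field is `α♯`: the integrand becomes `|α♯|²`, which is continuous and nonnegative,
  -- hence zero everywhere.
  have hs := hα.sharp g
  have h1 : ∀ x, ι1 (sharp g α) α x = g.inner x (sharp g α x) (sharp g α x) := fun x =>
    (inner_sharp g α x _).symm
  have h2 : 0 ≤ ι1 (sharp g α) α := fun x => by
    rw [h1]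
    by_cases hx : sharp g α x = 0
    · rw [hx]; simp
    · exact (g.pos x _ hx).le
  have h3 := (integral_eq_zero_iff_of_nonneg h2 (SmF.integrable g (hα.ι1 hs))).1 (h _ hs)
  have h4 := (hα.ι1 hs).continuous.ae_eq_iff_eq (vol g) continuous_const |>.1 h3
  funext x
  ext v
  have h5 : sharp g α x = 0 := by
    by_contra hx
    have := g.pos x _ hx
    rw [← h1, h4] at this
    exact lt_irrefl _ this
  rw [← inner_sharp g α x v, h5]
  simp

end

section

variable {n : ℕ} {M : Type*} [TopologicalSpace M] [ChartedSpace (Eu n) M] [IsManifold (𝓡 n) ∞ M]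

/-! ### The Euler–Arnold equation of the `a`-`b`-`c` metric -/

/-- At a fixed point of `M` the coordinates are obtained by a linear map independent of time, so the
derivative taken in the tangent space is the derivative of the coordinates. -/
theorem SmoothTimeVF.td {J : Set ℝ} (hJ : IsIv J) {u : ℝ → VF n M} (hu : SmoothTimeVF J u)
    (p : M) : TDV J p u (dtVF J u) where
  smooth := contDiffOn_coordVF_of_smoothTimeVF hu p
  deriv t ht y hy := by
    have h1 : DifferentiableWithinAt ℝ (fun s => coordVF p (u s) y) J t :=
      DifferentiableWithinAt.comp (𝕜 := ℝ) (g := fun q : ℝ × Eu n => coordVF p (u q.1) q.2)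
        (f := fun s : ℝ => (s, y)) t
        ((contDiffOn_coordVF_of_smoothTimeVF hu p (t, y) ⟨ht, hy⟩).differentiableWithinAt
          (by simp)) (by fun_prop) fun s hs => ⟨hs, hy⟩
    have h2 : HasDerivWithinAt (F := Eu n) (fun s => u s (ψ p y))
        (Dψ p y (derivWithin (fun s => coordVF p (u s) y) J t)) J t := by
      have h3 := (Dψ p y).hasFDerivAt.comp_hasDerivWithinAt t h1.hasDerivWithinAt
      exact h3.congr (fun s _ => (Dψ_apply_inverse hy (u s (ψ p y) : Eu n)).symm)
        (Dψ_apply_inverse hy (u t (ψ p y) : Eu n)).symm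
    have h4 : coordVF p (dtVF J u t) y = derivWithin (fun s => coordVF p (u s) y) J t :=
      (congrArg (Dψ p y).inverse (h2.derivWithin (hJ.uniqueDiffOn t ht))).trans
        (Dψ_inverse_apply hy _)
    rw [h4]
    exact h1.hasDerivWithinAt

theorem SmO.const_smul {α : OneForm n M} (hα : SmO α) (c : ℝ) : SmO (c • α) :=
  fun p => (contDiffOn_const (c := c)).smul (hα p)

theorem d0_add {f h : M → ℝ} (hf : SmF n f) (hh : SmF n h) :
    d0 (n := n) (f + h) = d0 f + d0 h := by
  funext p
  have hp := pt_mem_tgt (n := n) p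
  ext v
  have h1 : d0 (f + h) p v = fderiv ℝ (fun z => f (ψ p z) + h (ψ p z)) (pt p) v :=
    d0_apply (f := f + h) ((hf.diff hp).fun_add (hh.diff hp)) v
  rw [fderiv_fun_add (hf.diff hp) (hh.diff hp)] at h1
  have h2 := d0_apply (hf.diff hp) v
  have h3 := d0_apply (hh.diff hp) v
  exact h1.trans (congrArg₂ (· + ·) h2.symm h3.symm)

theorem d0_const_smul {f : M → ℝ} (hf : SmF n f) (c : ℝ) :
    d0 (n := n) (c • f) = c • d0 f := by
  funext p
  have hp := pt_mem_tgt (n := n) p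
  ext v
  have h1 : d0 (c • f) p v = fderiv ℝ (fun z => c * f (ψ p z)) (pt p) v :=
    d0_apply (f := c • f) ((hf.diff hp).const_mul c) v
  rw [fderiv_const_mul (hf.diff hp)] at h1
  exact h1.trans (congrArg (c * ·) (d0_apply (hf.diff hp) v).symm)

theorem d1_add {α β : OneForm n M} (hα : SmO α) (hβ : SmO β) : d1 (α + β) = d1 α + d1 β := by
  funext p
  have hp := pt_mem_tgt (n := n) p
  have h1 : coordOne p (α + β) = fun y => coordOne p α y + coordOne p β y := rfl
  show d1 (α + β) p = d1 α p + d1 β p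
  rw [d1_eq, d1_eq, d1_eq, extE, h1, fderiv_fun_add (hα.diff hp) (hβ.diff hp)]
  ext v w
  exact add_sub_add_comm _ _ _ _

theorem d1_const_smul {α : OneForm n M} (hα : SmO α) (c : ℝ) : d1 (c • α) = c • d1 α := by
  funext p
  have hp := pt_mem_tgt (n := n) p
  have h1 : coordOne p (c • α) = fun y => c • coordOne p α y := rfl
  show d1 (c • α) p = c • d1 α p
  rw [d1_eq, d1_eq, extE, h1, fderiv_fun_const_smul (hα.diff hp)]
  ext v w
  exact (mul_sub _ _ _).symm

variable (g : Metric n M)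

theorem flat_neg (X : VF n M) : flat g (-X) = -flat g X :=
  funext fun x => (g.inner x).map_neg (X x)

theorem δ1_neg (α : OneForm n M) : δ1 g (-α) = -δ1 g α := by
  funext p
  have h1 : ∀ y (v : Eu n), coordOne p (-α) y v = -coordOne p α y v := fun _ _ => rfl
  simp only [δ1, h1, mul_neg, Finset.sum_neg_distrib, Pi.neg_apply, fderiv_fun_neg, neg_apply]

theorem d0_neg (f : M → ℝ) : d0 (n := n) (-f) = -d0 f := by
  funext p
  exact mvfderiv_neg

theorem d1_neg (α : OneForm n M) : d1 (-α) = -d1 α := by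
  funext p
  have h1 : coordOne p (-α) = fun y => -coordOne p α y := rfl
  show d1 (-α) p = -d1 α p
  rw [d1_eq, d1_eq, extE, h1, fderiv_fun_neg]
  ext v w
  exact (neg_sub_neg _ _).trans (neg_sub _ _).symm

theorem δ2_neg (β : TwoTensor n M) : δ2 g (-β) = -δ2 g β := by
  funext p
  have h1 : ∀ y (v w : Eu n), coordTwo p (-β) y v w = -coordTwo p β y v w := fun _ _ _ => rfl
  have h2 : δ2Coord g (-β) p = -δ2Coord g β p := by
    ext i
    simp only [δ2Coord, h1, mul_neg, Finset.sum_neg_distrib, fderiv_fun_neg, neg_apply,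
      PiLp.neg_apply]
  show (coordTwo p g.inner (pt p) (δ2Coord g (-β) p)).comp (dφ p) = -(_)
  rw [h2, map_neg]
  rfl

theorem inertia_neg (a b c : ℝ) (X : VF n M) : inertia g a b c (-X) = -inertia g a b c X := by
  simp only [inertia, flat_neg, δ1_neg, d0_neg, d1_neg, δ2_neg, smul_neg, neg_add]

/-- The operator `α ↦ 𝓛_X α + (div X) α`, by Cartan's formula. -/
def transport (X : VF n M) (α : OneForm n M) : OneForm n M :=
  ι2 X (d1 α) + d0 (ι1 X α) + divg g X • α

theorem transport_add {X : VF n M} (hX : SmV X) {α β : OneForm n M} (hα : SmO α) (hβ : SmO β) :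
    transport g X (α + β) = transport g X α + transport g X β := by
  have h1 : ι1 X (α + β) = ι1 X α + ι1 X β := rfl
  have h2 : ι2 X (d1 α + d1 β) = ι2 X (d1 α) + ι2 X (d1 β) := rfl
  rw [transport, d1_add hα hβ, h1, d0_add (hα.ι1 hX) (hβ.ι1 hX), h2, smul_add, transport, transport]
  abel

theorem transport_smul {X : VF n M} (hX : SmV X) {α : OneForm n M} (hα : SmO α) (c : ℝ) :
    transport g X (c • α) = c • transport g X α := by
  have h1 : ι1 X (c • α) = c • ι1 X α := rfl
  have h2 : ι2 X (c • d1 α) = c • ι2 X (d1 α) := rfl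
  rw [transport, d1_const_smul hα, h1, d0_const_smul (hα.ι1 hX), h2, smul_comm, transport, smul_add,
    smul_add]

theorem SmV.transport {X : VF n M} (hX : SmV X) {α : OneForm n M} (hα : SmO α) :
    SmO (transport g X α) :=
  ((hα.ι2_d1 hX).add (hα.ι1 hX).d0).add (hα.smul (hX.divg g))

/-- The right-hand side of the Euler–Arnold equation. -/
theorem transport_inertia {X : VF n M} (hX : SmV X) (a b c : ℝ) :
    transport g X (inertia g a b c X) =
      a • (divg g X • flat g X + ι2 X (d1 (flat g X)) + d0 (innerVF g X X)) +
      b • (divg g X • d0 (δ1 g (flat g X)) + d0 (ι1 X (d0 (δ1 g (flat g X))))) +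
      c • (divg g X • δ2 g (d1 (flat g X)) + ι2 X (d1 (δ2 g (d1 (flat g X)))) +
        d0 (ι1 X (δ2 g (d1 (flat g X))))) := by
  have hF := hX.flat g
  have hδ := hF.δ1 g
  have hE := hF.δ2_d1 g
  rw [inertia, transport_add g hX ((hF.const_smul a).add (hδ.d0.const_smul b)) (hE.const_smul c),
    transport_add g hX (hF.const_smul a) (hδ.d0.const_smul b), transport_smul g hX hF,
    transport_smul g hX hδ.d0, transport_smul g hX hE]
  have h1 : ι2 X (0 : TwoTensor n M) = 0 := rfl
  have h2 : ι1 X (flat g X) = innerVF g X X := rfl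
  -- `d d δu♭ = 0` is why the `b` bracket has no `ι_u d` term.
  simp only [transport, d1_d0 hδ, h1, h2, zero_add]
  congr 1
  · congr 1
    · congr 1; abel
    · congr 1; abel
  · congr 1; abel

variable [CompactSpace M] [T2Space M] [MeasurableSpace M] [BorelSpace M]

/-- Both sides of the defining relation of `B` are integrals of a one-form on the test field, by
`abcInner_eq` and `integral_cartan`. They agree for all tests iff the forms agree, whether or not
`A` is injective. -/
theorem isB_iff (a b c : ℝ) {X w : VF n M} (hX : SmV X) (hw : SmV w) :
    IsB (abcInner g a b c) X X w ↔
      inertia g a b c w = transport g X (inertia g a b c X) := by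
  have hA := hX.inertia g a b c
  have hW := hw.inertia g a b c
  have h1 : ∀ z : VF n M, SmV z → abcInner g a b c X (ad X z) =
      ∫ x, ι1 z (transport g X (inertia g a b c X)) x ∂(vol g) := fun z hz => by
    have h2 : SmV (ad X z) := fun p => ((hX.mlieBracket hz) p).neg.congr
      fun y _ => coordVF_neg p _ y
    have h3 : ∀ x, ι1 (ad X z) (inertia g a b c X) x =
        -ι1 (mlieBracket (𝓡 n) X z) (inertia g a b c X) x := fun x =>
      (inertia g a b c X x).map_neg _
    rw [abcInner_eq g a b c hX h2, transport, integral_cartan g hA hX hz]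
    simp only [h3]
    exact integral_neg _
  constructor
  · rintro ⟨-, h⟩
    refine sub_eq_zero.1 (eq_zero_of_integral g
      (α := inertia g a b c w - transport g X (inertia g a b c X)) ?_ fun z hz => ?_)
    · rw [sub_eq_add_neg]
      exact hW.add (hX.transport g hA).neg
    · have h4 := h z (smV_iff.1 hz)
      rw [h1 z hz, abcInner_eq g a b c hw hz] at h4
      refine (integral_sub (SmF.integrable g (hW.ι1 hz))
        (SmF.integrable g ((hX.transport g hA).ι1 hz))).trans ?_
      rw [h4, sub_self]
  · intro h
    refine ⟨smV_iff.1 hw, fun z hz => ?_⟩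
    rw [← smV_iff] at hz
    rw [h1 z hz, abcInner_eq g a b c hw hz, h]

/-- The witness `w` is forced to be `-u_t`, which is smooth in space because `u` is jointly smooth.
-/
theorem solvesEulerArnold_iff_transport {J : Set ℝ} (hJ : IsIv J) {u : ℝ → VF n M}
    (hu : SmoothTimeVF J u) (a b c : ℝ) :
    SolvesEulerArnold (abcInner g a b c) J u ↔ ∀ t ∈ J,
      inertia g a b c (dtVF J u t) = -transport g (u t) (inertia g a b c (u t)) := by
  have h1 : ∀ t ∈ J, SmV (u t) := fun t ht p => (hu.td hJ p).slice ht
  have h2 : ∀ t ∈ J, SmV (-dtVF J u t) := fun t ht p =>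
    ((hu.td hJ p).slice_deriv hJ (isOpen_tgt p) ht).neg.congr fun y _ => coordVF_neg p _ y
  refine forall₂_congr fun t ht => ?_
  have h3 := isB_iff g a b c (h1 t ht) (h2 t ht)
  rw [inertia_neg, neg_eq_iff_eq_neg] at h3
  rw [← h3]
  constructor
  · rintro ⟨w, hw, h⟩
    rwa [h, neg_neg]
  · exact fun h => ⟨_, h, (neg_neg _).symm⟩

theorem solvesEulerArnold_iff {J : Set ℝ} (hJ : IsIv J) {u : ℝ → VF n M}
    (hu : SmoothTimeVF J u) (a b c : ℝ) :
    SolvesEulerArnold (abcInner g a b c) J u ↔ ∀ t ∈ J,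
      inertia g a b c (dtVF J u t) =
        -(a • (divg g (u t) • flat g (u t) + ι2 (u t) (d1 (flat g (u t)))
            + d0 (innerVF g (u t) (u t))))
        - b • (divg g (u t) • d0 (δ1 g (flat g (u t)))
            + d0 (ι1 (u t) (d0 (δ1 g (flat g (u t))))))
        - c • (divg g (u t) • δ2 g (d1 (flat g (u t)))
            + ι2 (u t) (d1 (δ2 g (d1 (flat g (u t)))))
            + d0 (ι1 (u t) (δ2 g (d1 (flat g (u t)))))) := by
  rw [solvesEulerArnold_iff_transport g hJ hu]
  refine forall₂_congr fun t ht => ?_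
  rw [transport_inertia g fun p => (hu.td hJ p).slice ht, neg_add, neg_add, ← sub_eq_add_neg,
    ← sub_eq_add_neg]

end

section

variable {n : ℕ} {M : Type*} [TopologicalSpace M] [ChartedSpace (Eu n) M] [IsManifold (𝓡 n) ∞ M]

/-! ### The Burgers and EPDiff equations -/

variable (g : Metric n M)

/-- Write `G` for the metric and `x` for the components of `X`. Then both sides, evaluated on `v`,
are `G(DX x, v) + DG(x)(x, v) - ½ DG(v)(x, x)`: the two first Christoffel terms coincide when both
arguments are `X`. -/
theorem flat_nabla {X : VF n M} (hX : SmV X) :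
    flat g (nabla g X X) = ι2 X (d1 (flat g X)) + (1 / 2 : ℝ) • d0 (innerVF g X X) := by
  rw [nabla, flat_sharp]
  funext p
  have hp := pt_mem_tgt (n := n) p
  have hF := hX.flat g
  set G := coordTwo p g.inner with hG
  set x : Eu n := coordVF p X (pt p) with hx
  have hGd : DifferentiableAt ℝ G (pt p) := diffAt_of_smooth (contDiffOn_metric g p) hp
  have hxX : x = X p := coordVF_pt p X
  have h1 : coordOne p (flat g X) =ᶠ[𝓝 (pt p)] fun y => G y (coordVF p X y) := by
    filter_upwards [tgt_mem_nhds hp] with y hy using coordOne_flat g hy X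
  have h2 : ∀ v w : Eu n, fderiv ℝ (coordOne p (flat g X)) (pt p) v w =
      G (pt p) (fderiv ℝ (coordVF p X) (pt p) v) w + fderiv ℝ G (pt p) v x w := fun v w => by
    rw [h1.fderiv_eq, (hGd.hasFDerivAt.clm_apply (hX.diff hp).hasFDerivAt).fderiv]
    rfl
  ext v
  have h3 : d1 (flat g X) p (X p) v = fderiv ℝ (coordOne p (flat g X)) (pt p) x v -
      fderiv ℝ (coordOne p (flat g X)) (pt p) v x := by
    rw [d1_eq, hxX]; rfl
  have h4 : d0 (innerVF g X X) p v = fderiv ℝ (coordOne p (flat g X)) (pt p) v x +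
      G (pt p) x (fderiv ℝ (coordVF p X) (pt p) v) := by
    have := d0_ι1 hF hX p v
    rw [hxX, hG, coordTwo_pt]
    exact this
  have h5 : G (pt p) x (fderiv ℝ (coordVF p X) (pt p) v) =
      G (pt p) (fderiv ℝ (coordVF p X) (pt p) v) x := metric_symm g p _ _ _
  have h6 := h2 x v
  have h7 := h2 v x
  rw [dφ_eq]
  show G (pt p) (fderiv ℝ (coordVF p X) (pt p) x) v + (1 / 2 : ℝ) * (fderiv ℝ G (pt p) x x v +
    fderiv ℝ G (pt p) x x v - fderiv ℝ G (pt p) v x x) =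
    d1 (flat g X) p (X p) v + (1 / 2 : ℝ) * d0 (innerVF g X X) p v
  linear_combination -h3 - (1 / 2 : ℝ) * h4 - (1 / 2 : ℝ) * h5 - h6 + (1 / 2 : ℝ) * h7

theorem flat_add (X Y : VF n M) : flat g (X + Y) = flat g X + flat g Y :=
  funext fun x => (g.inner x).map_add (X x) (Y x)

theorem flat_smul (f : M → ℝ) (X : VF n M) : flat g (f • X) = f • flat g X :=
  funext fun x => (g.inner x).map_smul (f x) (X x)

theorem flat_const_smul (c : ℝ) (X : VF n M) : flat g (c • X) = c • flat g X :=
  funext fun x => (g.inner x).map_smul c (X x)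

variable [CompactSpace M] [T2Space M] [MeasurableSpace M] [BorelSpace M]

theorem solvesEulerArnold_iff_burgers {J : Set ℝ} (hJ : IsIv J) {u : ℝ → VF n M}
    (hu : SmoothTimeVF J u) :
    SolvesEulerArnold (abcInner g 1 0 0) J u ↔ ∀ t ∈ J,
      dtVF J u t + nabla g (u t) (u t) + divg g (u t) • u t
        + (1 / 2 : ℝ) • grad g (innerVF g (u t) (u t)) = 0 := by
  rw [solvesEulerArnold_iff g hJ hu]
  refine forall₂_congr fun t ht => ?_
  have h0 : flat g (0 : VF n M) = 0 := funext fun x => (g.inner x).map_zero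
  rw [← (flat_injective g).eq_iff, flat_add, flat_add, flat_add, flat_const_smul, flat_smul, grad,
    flat_sharp, flat_nabla g fun p => (hu.td hJ p).slice ht, inertia, h0]
  simp only [one_smul, zero_smul, add_zero, sub_zero]
  rw [eq_neg_iff_add_eq_zero]
  refine Eq.congr_left ?_
  -- One half of `d|u|²` belongs to `(∇_u u)♭`; the other half is the gradient term of the equation.
  have h1 : d0 (n := n) (innerVF g (u t) (u t)) = (1 / 2 : ℝ) • d0 (innerVF g (u t) (u t)) +
    (1 / 2 : ℝ) • d0 (innerVF g (u t) (u t)) := by rw [← add_smul]; norm_num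
  conv_lhs => rw [h1]
  abel

theorem solvesEulerArnold_iff_epdiff {J : Set ℝ} (hJ : IsIv J) {u : ℝ → VF n M}
    (hu : SmoothTimeVF J u) {m : ℝ → OneForm n M}
    (hm : ∀ t, m t = flat g (u t) - laplaceOne g (flat g (u t))) :
    SolvesEulerArnold (abcInner g 1 1 1) J u ↔ ∀ t ∈ J,
      dtOne J m t + lieOne (u t) (m t) + divg g (u t) • m t = 0 := by
  -- Since `-Δ = dδ + δd`, the momentum `m` is `Au` for `a = b = c = 1`.
  obtain rfl : m = fun t => inertia g 1 1 1 (u t) := by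
    funext t
    rw [hm, laplaceOne, sub_neg_eq_add, inertia, one_smul, one_smul, one_smul, add_assoc]
  rw [solvesEulerArnold_iff_transport g hJ hu]
  refine forall₂_congr fun t ht => ?_
  have hX : SmV (u t) := fun p => (hu.td hJ p).slice ht
  have h1 : dtOne J (fun t => inertia g 1 1 1 (u t)) t = inertia g 1 1 1 (dtVF J u t) := by
    funext p
    have h2 := (TDV.inertia g hJ (hu.td hJ p) 1 1 1).deriv t ht (pt p) (pt_mem_tgt p)
    simp only [coordOne_pt] at h2
    exact h2.derivWithin (hJ.uniqueDiffOn t ht)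
  rw [h1, lieOne_eq (hX.inertia g 1 1 1) hX, eq_neg_iff_add_eq_zero, transport]
  simp only [add_assoc]

end

section

/-! ### Curves -/

section Curve
variable {n : ℕ} {M : Type*} [TopologicalSpace M] [ChartedSpace (Eu n) M] [IsManifold (𝓡 n) ∞ M]

/-- A curve in the chart at `p`. -/
def crv (p : M) (γ : ℝ → M) (x : ℝ) : Eu n := extChartAt (𝓡 n) p (γ x)

theorem crv_mem_tgt {γ : ℝ → M} {p : M} {x : ℝ} (hx : γ x ∈ (extChartAt (𝓡 n) p).source) :
    crv (n := n) p γ x ∈ tgt p := (extChartAt (𝓡 n) p).map_source hx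

/-- The component of a vector field along a unit speed curve. -/
def cpt (g : Metric n M) (γ : ℝ → M) (X : VF n M) (x : ℝ) : ℝ :=
  g.inner (γ x) (X (γ x)) (velocity γ x)

variable {γ : ℝ → M} (hγ : ContMDiff 𝓘(ℝ, ℝ) (𝓡 n) ∞ γ)
include hγ

theorem contDiffAt_crv {p : M} {x : ℝ} (hx : γ x ∈ (extChartAt (𝓡 n) p).source) :
    ContDiffAt ℝ ∞ (crv (n := n) p γ) x :=
  ((contMDiffAt_chart hx).comp x (hγ x)).contDiffAt

theorem eventually_mem_source {p : M} {x : ℝ} (hx : γ x ∈ (extChartAt (𝓡 n) p).source) :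
    ∀ᶠ z in 𝓝 x, γ z ∈ (extChartAt (𝓡 n) p).source :=
  hγ.continuous.continuousAt.eventually ((isOpen_extChartAt_source p).mem_nhds hx)

theorem Dψ_deriv_crv {p : M} {x : ℝ} (hx : γ x ∈ (extChartAt (𝓡 n) p).source) :
    Dψ p (crv p γ x) (deriv (crv p γ) x) = velocity (n := n) γ x := by
  have hy : crv (n := n) p γ x ∈ tgt p := (extChartAt (𝓡 n) p).map_source hx
  have h1 : γ =ᶠ[𝓝 x] ψ (n := n) p ∘ crv p γ := by
    filter_upwards [eventually_mem_source hγ hx] with z hz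
    exact ((extChartAt (𝓡 n) p).left_inv hz).symm
  have h2 := h1.mfderiv_eq (I := 𝓘(ℝ, ℝ)) (I' := 𝓡 n)
  rw [mfderiv_comp x ((contMDiffAt_ψ hy).mdifferentiableAt (by simp))
    ((contDiffAt_crv hγ hx).differentiableAt (by simp)).mdifferentiableAt, mfderiv_eq_fderiv] at h2
  exact (congrArg (fun L : ℝ →L[ℝ] Eu n => L 1) h2).symm

theorem hasDerivAt_comp_curve {f : M → ℝ} (hf : SmF n f) (x : ℝ) :
    HasDerivAt (fun z => f (γ z)) (d0 (n := n) f (γ x) (velocity γ x)) x := by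
  have hp := pt_mem_tgt (n := n) (γ x)
  have hx := mem_extChartAt_source (I := 𝓡 n) (γ x)
  have h1 : (fun z => f (γ z)) =ᶠ[𝓝 x] fun z => f (ψ (n := n) (γ x) (crv (γ x) γ z)) := by
    filter_upwards [eventually_mem_source hγ hx] with z hz
    exact congrArg f ((extChartAt (𝓡 n) (γ x)).left_inv hz).symm
  have h2 : HasDerivAt (fun z => f (ψ (n := n) (γ x) (crv (γ x) γ z)))
      (fderiv ℝ (fun y => f (ψ (n := n) (γ x) y)) (pt (γ x)) (deriv (crv (γ x) γ) x)) x :=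
    HasFDerivAt.comp_hasDerivAt (l := fun y => f (ψ (n := n) (γ x) y)) x
      (hf.diff hp).hasFDerivAt ((contDiffAt_crv hγ hx).differentiableAt (by simp)).hasDerivAt
  have h3 : deriv (crv (n := n) (γ x) γ) x = velocity (n := n) γ x := by
    have := Dψ_deriv_crv hγ hx
    rw [show crv (n := n) (γ x) γ x = pt (γ x) from rfl, Dψ_pt] at this
    exact this
  have h4 : d0 (n := n) f (γ x) (velocity γ x) =
      fderiv ℝ (fun y => f (ψ (n := n) (γ x) y)) (pt (γ x)) (deriv (crv (γ x) γ) x) :=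
    (d0_apply (hf.diff hp) _).trans (congrArg _ h3.symm)
  rw [h4]
  exact h2.congr_of_eventuallyEq h1

variable (g : Metric n M)

theorem cpt_eq {p : M} {x : ℝ} (hx : γ x ∈ (extChartAt (𝓡 n) p).source) (X : VF n M) :
    cpt g γ X x = coordTwo p g.inner (crv p γ x) (coordVF p X (crv p γ x))
      (deriv (crv p γ) x) := by
  have hy : crv (n := n) p γ x ∈ tgt p := (extChartAt (𝓡 n) p).map_source hx
  have h1 : ψ (n := n) p (crv p γ x) = γ x := (extChartAt (𝓡 n) p).left_inv hx
  rw [coordTwo_eq, coordVF_eq, pullTwo_apply, Dψ_apply_inverse hy, Dψ_deriv_crv hγ hx, h1]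
  rfl

theorem inner_velocity_eq {p : M} {x : ℝ} (hx : γ x ∈ (extChartAt (𝓡 n) p).source) :
    g.inner (γ x) (velocity γ x) (velocity γ x) = coordTwo p g.inner (crv p γ x)
      (deriv (crv p γ) x) (deriv (crv p γ) x) := by
  have h1 : ψ (n := n) p (crv p γ x) = γ x := (extChartAt (𝓡 n) p).left_inv hx
  rw [coordTwo_eq, pullTwo_apply, Dψ_deriv_crv hγ hx, h1]
  rfl

theorem contDiffAt_deriv_crv {p : M} {x : ℝ} (hx : γ x ∈ (extChartAt (𝓡 n) p).source) :
    ContDiffAt ℝ ∞ (deriv (crv (n := n) p γ)) x := by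
  have h1 := (contDiffAt_crv hγ hx).fderiv_right (m := ∞) (by simp)
  exact h1.clm_apply (contDiffAt_const (c := (1 : ℝ)))

theorem contDiff_cpt {X : VF n M} (hX : SmV X) : ContDiff ℝ ∞ (cpt g γ X) := by
  rw [contDiff_iff_contDiffAt]
  intro x
  have hx := mem_extChartAt_source (I := 𝓡 n) (γ x)
  have hp := tgt_mem_nhds (pt_mem_tgt (n := n) (γ x))
  have h1 := contDiffAt_crv hγ hx
  have h2 : ContDiffAt ℝ ∞ (fun z => coordTwo (γ x) g.inner (crv (γ x) γ z)) x :=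
    ContDiffAt.comp (g := coordTwo (γ x) g.inner) x ((contDiffOn_metric g _).contDiffAt hp) h1
  have h3 : ContDiffAt ℝ ∞ (fun z => coordVF (γ x) X (crv (γ x) γ z)) x :=
    ContDiffAt.comp (g := coordVF (γ x) X) x ((hX _).contDiffAt hp) h1
  refine ((h2.clm_apply h3).clm_apply (contDiffAt_deriv_crv hγ hx)).congr_of_eventuallyEq ?_
  filter_upwards [eventually_mem_source hγ hx] with z hz using cpt_eq hγ g hz X

end Curve

/-! ### The circle -/

section Circle
variable {M : Type*} [TopologicalSpace M] [ChartedSpace (Eu 1) M] [IsManifold (𝓡 1) ∞ M]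
  (g : Metric 1 M)

theorem eq_smul_of_ne_zero {v : Eu 1} (hv : v ≠ 0) (w : Eu 1) : ∃ c : ℝ, w = c • v := by
  have h0 : v 0 ≠ 0 := fun h => hv (by ext i; rw [Subsingleton.elim i 0]; exact h)
  refine ⟨w 0 / v 0, ?_⟩
  ext i
  rw [Subsingleton.elim i 0]
  simp [h0]

theorem eq_smul_e (v : Eu 1) : v = v 0 • e 0 := by
  conv_lhs => rw [sum_apply_e v]
  simp

theorem density_sq {p : M} {y : Eu 1} (hy : y ∈ tgt p) :
    density g p y ^ 2 = coordTwo p g.inner y (e 0) (e 0) := by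
  rw [density, Real.sq_sqrt (gram_posDef g hy).det_pos.le, Matrix.det_fin_one, gram_apply]

theorem metric_eq {p : M} {y : Eu 1} (hy : y ∈ tgt p) (v w : Eu 1) :
    coordTwo p g.inner y v w = density g p y ^ 2 * (v 0 * w 0) := by
  rw [density_sq g hy]
  conv_lhs => rw [eq_smul_e v, eq_smul_e w]
  simp only [map_smul, smul_apply, smul_eq_mul]
  ring

/-- An antisymmetric form on a line vanishes. This removes `c` from all equations on the circle. -/
theorem d1_eq_zero (α : OneForm 1 M) : d1 α = 0 := by
  funext p
  rw [d1_eq]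
  refine ContinuousLinearMap.ext fun v => ContinuousLinearMap.ext fun w => ?_
  have h1 : ∀ v w : Eu 1, extE (coordOne p α) (pt p) v w = 0 := fun v w => by
    rw [eq_smul_e v, eq_smul_e w, extE_apply]
    simp only [map_smul, smul_apply]
    rw [smul_comm, sub_self]
  exact h1 v w

theorem δ2_zero : δ2 g (0 : TwoTensor 1 M) = 0 := by
  have h0 : -(0 : TwoTensor 1 M) = 0 := funext fun x =>
    neg_zero (G := Eu 1 →L[ℝ] Eu 1 →L[ℝ] ℝ)
  have h := δ2_neg g (0 : TwoTensor 1 M)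
  rw [h0] at h
  funext x
  ext v
  have h1 : δ2 g (0 : TwoTensor 1 M) x v = -δ2 g (0 : TwoTensor 1 M) x v :=
    congrArg (fun α : OneForm 1 M => α x v) h
  exact self_eq_neg.1 h1

variable {γ : ℝ → M} (hγ : IsArclength g γ)
include hγ

/-- In a chart, unit speed means that `s = √g · γ'` satisfies `s² = 1`. Hence `√g X` along the curve
is `s` times the component of `X`, and its derivative computes the divergence. -/
theorem divg_curve {X : VF 1 M} (hX : SmV X) (x : ℝ) :
    divg g X (γ x) = deriv (cpt g γ X) x := by
  have hx := mem_extChartAt_source (I := 𝓡 1) (γ x)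
  set p := γ x with hp
  have hy : crv p γ x ∈ tgt p := pt_mem_tgt (n := 1) p
  set s : ℝ → ℝ := fun z => density g p (crv p γ z) * deriv (crv (n := 1) p γ) z 0 with hs
  have hsq : ∀ z, γ z ∈ (extChartAt (𝓡 1) p).source → s z * s z = 1 := fun z hz => by
    have h1 := inner_velocity_eq hγ.1 g hz
    rw [hγ.2.2, metric_eq g (crv_mem_tgt hz)] at h1
    rw [h1, hs]
    ring
  have hc : ContinuousAt s x := by
    have h1 : ContinuousAt (fun z => density g p (crv p γ z)) x :=
      ContinuousAt.comp (g := density g p) (differentiableAt_density g hy).continuousAt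
        (contDiffAt_crv hγ.1 hx).continuousAt
    exact h1.mul ((EuclideanSpace.proj (𝕜 := ℝ) (0 : Fin 1)).continuous.continuousAt.comp
      (contDiffAt_deriv_crv hγ.1 hx).continuousAt)
  have hs0 : s x * s x = 1 := hsq x hx
  -- A continuous function with values `±1` is locally constant, so `s` passes through the
  -- derivative; its sign records the orientation of the chart and drops out at the end.
  have hev : ∀ᶠ z in 𝓝 x, s z = s x := by
    have h1 : ∀ᶠ z in 𝓝 x, 0 < s z * s x :=
      (hc.mul (continuousAt_const (y := s x))).eventually (lt_mem_nhds (hs0 ▸ one_pos : 0 < s x * s x))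
    filter_upwards [h1, eventually_mem_source hγ.1 hx] with z h2 hz
    have h3 : (s z - s x) * (s z + s x) = 0 := by linear_combination hsq z hz - hs0
    rcases mul_eq_zero.1 h3 with h4 | h4
    · exact sub_eq_zero.1 h4
    · nlinarith
  set F : Eu 1 → ℝ := fun y => density g p y * coordVF p X y 0 with hF
  have hFd : DifferentiableAt ℝ F (crv p γ x) :=
    (differentiableAt_density g hy).mul (fderiv_coord (hX.diff hy) 0).differentiableAt
  have h5 : (fun z => F (crv p γ z)) =ᶠ[𝓝 x] fun z => s x * cpt g γ X z := by
    filter_upwards [hev, eventually_mem_source hγ.1 hx] with z h6 hz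
    rw [cpt_eq hγ.1 g hz, metric_eq g (crv_mem_tgt hz), ← h6]
    have := hsq z hz
    simp only [hs, hF] at this ⊢
    linear_combination (-density g p (crv p γ z) * coordVF p X (crv p γ z) 0) * this
  have h7 : HasDerivAt (fun z => F (crv p γ z))
      (fderiv ℝ F (crv p γ x) (deriv (crv p γ) x)) x :=
    HasFDerivAt.comp_hasDerivAt (l := F) x hFd.hasFDerivAt
      ((contDiffAt_crv hγ.1 hx).differentiableAt (by simp)).hasDerivAt
  have h8 : HasDerivAt (fun z => s x * cpt g γ X z) (s x * deriv (cpt g γ X) x) x :=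
    (((contDiff_cpt hγ.1 g hX).differentiable (by simp)) x).hasDerivAt.const_mul _
  have h9 := h7.unique (h8.congr_of_eventuallyEq h5)
  rw [eq_smul_e (deriv (crv p γ) x), map_smul, smul_eq_mul] at h9
  have h10 : divg g X p = (density g p (crv p γ x))⁻¹ * fderiv ℝ F (crv p γ x) (e 0) := by
    rw [divg, Fin.sum_univ_one]; rfl
  have hd := (density_pos g hy).ne'
  rw [h10, inv_mul_eq_iff_eq_mul₀ hd]
  have h11 : s x = density g p (crv p γ x) * deriv (crv p γ) x 0 := rfl
  linear_combination (-fderiv ℝ F (crv p γ x) (e 0)) * hs0 +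
    density g p (crv p γ x) * s x * h9 + density g p (crv p γ x) * deriv (cpt g γ X) x * hs0 +
    s x * fderiv ℝ F (crv p γ x) (e 0) * h11

theorem eq_cpt_smul (X : VF 1 M) (x : ℝ) : X (γ x) = cpt g γ X x • velocity γ x := by
  have h0 : (velocity (n := 1) γ x : Eu 1) ≠ 0 := fun h => by
    have h1 : g.inner (γ x) (velocity γ x) (velocity γ x) = 0 := by
      have : velocity (n := 1) γ x = 0 := h
      rw [this]; simp
    rw [hγ.2.2] at h1
    exact one_ne_zero h1
  obtain ⟨c, hc⟩ := eq_smul_of_ne_zero h0 (X (γ x))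
  have hc' : X (γ x) = c • velocity γ x := hc
  have h2 : cpt g γ X x = c := by
    rw [cpt, hc', map_smul, smul_apply, hγ.2.2, smul_eq_mul, mul_one]
  rw [h2]
  exact hc'

/-- The velocity spans each tangent line and `γ` reaches every point, so equations of one-forms on
`M` become scalar equations along `γ`. -/
theorem oneForm_ext_iff {α β : OneForm 1 M} :
    α = β ↔ ∀ x, α (γ x) (velocity γ x) = β (γ x) (velocity γ x) := by
  refine ⟨fun h x => by rw [h], fun h => funext fun q => ?_⟩
  obtain ⟨x, rfl⟩ := hγ.2.1 q
  ext v
  have h1 := eq_cpt_smul g hγ (constField (γ x) v) x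
  have h2 : constField (n := 1) (γ x) v (γ x) = v := by
    show Dψ (γ x) (pt (γ x)) v = v
    rw [Dψ_pt]; rfl
  rw [h2] at h1
  rw [h1, map_smul, map_smul, h]

/-- As `dα = 0` in dimension one, Cartan's formula leaves only `d(α(X)) + (div X) α`. -/
theorem transport_curve {X : VF 1 M} (hX : SmV X) {α : OneForm 1 M} (hα : SmO α) (x : ℝ) :
    transport g X α (γ x) (velocity γ x) =
      deriv (fun z => cpt g γ X z * α (γ z) (velocity γ z)) x +
      deriv (cpt g γ X) x * α (γ x) (velocity γ x) := by
  have h1 : (fun z => cpt g γ X z * α (γ z) (velocity γ z)) = fun z => ι1 X α (γ z) :=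
    funext fun z => by rw [ι1, eq_cpt_smul g hγ X z, map_smul, smul_eq_mul]
  rw [h1, (hasDerivAt_comp_curve hγ.1 (hα.ι1 hX) x).deriv, ← divg_curve g hγ hX, transport,
    d1_eq_zero]
  have h2 : ι2 X (0 : TwoTensor 1 M) = 0 := rfl
  rw [h2, zero_add]
  rfl

/-- `δX♭ = -div X` is minus the derivative of the component, whence the sign of the `b` term. -/
theorem inertia_curve (a b c : ℝ) {X : VF 1 M} (hX : SmV X) (x : ℝ) :
    inertia g a b c X (γ x) (velocity γ x) =
      a * cpt g γ X x - b * deriv (deriv (cpt g γ X)) x := by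
  have h1 : deriv (deriv (cpt g γ X)) x =
      -(d0 (n := 1) (δ1 g (flat g X)) (γ x) (velocity γ x)) := by
    have h2 : deriv (cpt g γ X) = fun z => -δ1 g (flat g X) (γ z) := funext fun z => by
      rw [← divg_curve g hγ hX, δ1_eq, sharp_flat, Pi.neg_apply, neg_neg]
    rw [h2]
    exact (hasDerivAt_comp_curve hγ.1 ((hX.flat g).δ1 g) x).neg.deriv
  rw [inertia, d1_eq_zero, δ2_zero, smul_zero, add_zero, h1, mul_neg, sub_neg_eq_add]
  rfl

theorem pt_t_component {J : Set ℝ} (hJ : IsIv J) {u : ℝ → VF 1 M} (hu : SmoothTimeVF J u) {t : ℝ}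
    (ht : t ∈ J) : pt_t J (component g γ u) t = cpt g γ (dtVF J u t) := by
  funext x
  have h1 := (hu.td hJ (γ x)).deriv t ht (pt (γ x)) (pt_mem_tgt _)
  simp only [coordVF_pt] at h1
  let L : Eu 1 →L[ℝ] ℝ := ContinuousLinearMap.flip
    (show Eu 1 →L[ℝ] Eu 1 →L[ℝ] ℝ from g.inner (γ x)) (velocity γ x)
  exact (L.hasFDerivAt.comp_hasDerivWithinAt t h1).derivWithin (hJ.uniqueDiffOn t ht)

variable [CompactSpace M] [T2Space M] [MeasurableSpace M] [BorelSpace M]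

/-- Expansion of `a f_t - b f_txx = -((f m)' + f' m)` with `m = a f - b f''`. The three equations on
the circle are special cases. -/
theorem solvesEulerArnold_iff_circle {J : Set ℝ} (hJ : IsIv J) {u : ℝ → VF 1 M}
    (hu : SmoothTimeVF J u) {f : ℝ → ℝ → ℝ} (hf : f = component g γ u) (a b c : ℝ) :
    SolvesEulerArnold (abcInner g a b c) J u ↔ ∀ t ∈ J, ∀ x,
      a * (pt_t J f t x + 3 * f t x * pt_x 1 f t x) =
      b * (pt_x 2 (pt_t J f) t x + 2 * pt_x 1 f t x * pt_x 2 f t x + f t x * pt_x 3 f t x) := by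
  rw [solvesEulerArnold_iff_transport g hJ hu]
  refine forall₂_congr fun t ht => ?_
  have hX : SmV (u t) := fun p => (hu.td hJ p).slice ht
  have hX' : SmV (dtVF J u t) := fun p => (hu.td hJ p).slice_deriv hJ (isOpen_tgt p) ht
  rw [oneForm_ext_iff g hγ]
  refine forall_congr' fun x => ?_
  have h1 : (-transport g (u t) (inertia g a b c (u t)) : OneForm 1 M) (γ x) (velocity γ x) =
    -(transport g (u t) (inertia g a b c (u t)) (γ x) (velocity γ x)) := rfl
  have h2 : f t = cpt g γ (u t) := by rw [hf]; rfl
  have h3 : pt_t J f t = cpt g γ (dtVF J u t) := by rw [hf]; exact pt_t_component g hγ hJ hu ht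
  rw [h1, transport_curve g hγ hX (hX.inertia g a b c), inertia_curve g hγ a b c hX']
  simp only [inertia_curve g hγ a b c hX]
  have h4 : ContDiff ℝ ∞ (f t) := by rw [h2]; exact contDiff_cpt hγ.1 g hX
  have h5 : ContDiff ℝ ∞ (deriv (f t)) := ((contDiff_infty_iff_deriv (𝕜 := ℝ)).1 h4).2
  have h6 : ContDiff ℝ ∞ (deriv (deriv (f t))) := ((contDiff_infty_iff_deriv (𝕜 := ℝ)).1 h5).2
  have e1 := (h4.differentiable (by simp) x).hasDerivAt
  have e3 := (h6.differentiable (by simp) x).hasDerivAt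
  simp only [pt_x, iteratedDeriv_succ, iteratedDeriv_zero]
  rw [h3, ← h2, (e1.fun_mul ((e1.const_mul a).fun_sub (e3.const_mul b))).deriv]
  constructor <;> intro h <;> linear_combination h

end Circle

end

end EulerArnold

end

/-! ### The main theorem -/

open EulerArnold in
theorem mainTheorem12 {n : ℕ} {M : Type*} [TopologicalSpace M] [T2Space M] [CompactSpace M]
    [ChartedSpace (Eu n) M] [IsManifold (𝓡 n) ∞ M] [MeasurableSpace M] [BorelSpace M]
    (g : Metric n M) :
    -- `A` is the inertia operator of the metric
    (∀ (a b c : ℝ) (u v : VF n M), SmoothVF u → SmoothVF v →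
      abcInner g a b c u v = ∫ x, ι1 v (inertia g a b c u) x ∂(vol g)) ∧
    ∀ (J : Set ℝ), J.OrdConnected → J.Nontrivial →
    ∀ (u : ℝ → VF n M), SmoothTimeVF J u →
    -- the Euler–Arnold equation of the `a`-`b`-`c` metric
    (∀ a b c : ℝ, SolvesEulerArnold (abcInner g a b c) J u ↔ ∀ t ∈ J,
      inertia g a b c (dtVF J u t) =
        -(a • (divg g (u t) • flat g (u t) + ι2 (u t) (d1 (flat g (u t)))
            + d0 (innerVF g (u t) (u t))))
        - b • (divg g (u t) • d0 (δ1 g (flat g (u t)))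
            + d0 (ι1 (u t) (d0 (δ1 g (flat g (u t))))))
        - c • (divg g (u t) • δ2 g (d1 (flat g (u t)))
            + ι2 (u t) (d1 (δ2 g (d1 (flat g (u t)))))
            + d0 (ι1 (u t) (δ2 g (d1 (flat g (u t))))))) ∧
    -- `a = 1`, `b = c = 0`: the multi-dimensional Burgers equation
    (SolvesEulerArnold (abcInner g 1 0 0) J u ↔ ∀ t ∈ J,
      dtVF J u t + nabla g (u t) (u t) + divg g (u t) • u t
        + (1 / 2 : ℝ) • grad g (innerVF g (u t) (u t)) = 0) ∧
    -- `a = b = c = 1`: the EPDiff equation for `m = u♭ - Δu♭`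
    (∀ m : ℝ → OneForm n M, (∀ t, m t = flat g (u t) - laplaceOne g (flat g (u t))) →
      (SolvesEulerArnold (abcInner g 1 1 1) J u ↔ ∀ t ∈ J,
        dtOne J m t + lieOne (u t) (m t) + divg g (u t) • m t = 0)) ∧
    -- the case of the circle
    (n = 1 → ∀ γ : ℝ → M, IsArclength g γ →
      ∀ f : ℝ → ℝ → ℝ, f = component g γ u →
      -- `a = 0`: the Hunter–Saxton equation
      (∀ b c : ℝ, b ≠ 0 → (SolvesEulerArnold (abcInner g 0 b c) J u ↔ ∀ t ∈ J, ∀ x,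
        pt_x 2 (pt_t J f) t x + 2 * pt_x 1 f t x * pt_x 2 f t x + f t x * pt_x 3 f t x = 0)) ∧
      -- `b = 0`: the Burgers equation
      (∀ a c : ℝ, a ≠ 0 → (SolvesEulerArnold (abcInner g a 0 c) J u ↔ ∀ t ∈ J, ∀ x,
        pt_t J f t x + 3 * f t x * pt_x 1 f t x = 0)) ∧
      -- `a = b = 1`: the Camassa–Holm equation
      (∀ c : ℝ, SolvesEulerArnold (abcInner g 1 1 c) J u ↔ ∀ t ∈ J, ∀ x,
        pt_t J f t x - pt_x 2 (pt_t J f) t x + 3 * f t x * pt_x 1 f t x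
          - 2 * pt_x 1 f t x * pt_x 2 f t x - f t x * pt_x 3 f t x = 0)) := by
  refine ⟨fun a b c u v hu hv => abcInner_eq g a b c (smV_iff.2 hu) (smV_iff.2 hv),
    fun J hJ hJ' u hu => ?_⟩
  have hI : IsIv J := ⟨hJ, hJ'⟩
  refine ⟨solvesEulerArnold_iff g hI hu, solvesEulerArnold_iff_burgers g hI hu,
    fun m hm => solvesEulerArnold_iff_epdiff g hI hu hm, ?_⟩
  rintro rfl γ hγ f hf
  refine ⟨fun b c hb => ?_, fun a c ha => ?_, fun c => ?_⟩
  · rw [solvesEulerArnold_iff_circle g hγ hI hu hf]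
    refine forall₂_congr fun t _ => forall_congr' fun x => ?_
    rw [zero_mul, eq_comm, mul_eq_zero, or_iff_right hb]
  · rw [solvesEulerArnold_iff_circle g hγ hI hu hf]
    refine forall₂_congr fun t _ => forall_congr' fun x => ?_
    rw [zero_mul, mul_eq_zero, or_iff_right ha]
  · rw [solvesEulerArnold_iff_circle g hγ hI hu hf]
    refine forall₂_congr fun t _ => forall_congr' fun x => ?_
    constructor <;> intro h <;> linear_combination h
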